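/- All graphs are finite and simple. A graph is $n$-connected if it has more than $n$ vertices and it remains connected after the deletion of any set of fewer than $n$ vertices. For a set $S$ of vertices, an odd $S$-cycle is a cycle of odd length that contains at least one vertex of $S$. Theorem. Let $k\ge 0$ be an integer, let $G$ be a $50k$-connected graph, and let $S\subseteq V(G)$. Then at least one of the following two statements holds. (i) $G$ contains $k$ pairwise vertex-disjoint odd $S$-cycles. (ii) There is a set $X\subseteq V(G)$ with $|X|\le 2k-2$ such that $G-X$ contains no odd $S$-cycle; and, if $|S|\ge k$, there is also a set $Y\subseteq V(G)$ with $|Y|\le 3k-3$ such that $G-Y$ is bipartite. -/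

import Mathlib

namespace OddCyclePacking

variable {V : Type*}

/-- The graph `G - X`, obtained from `G` by deleting the vertices in `X`. -/
abbrev deleteVertices (G : SimpleGraph V) (X : Finset V) : SimpleGraph {v : V | v ∉ X} :=
  G.induce {v : V | v ∉ X}

/-- `G` is `n`-connected: it has more than `n` vertices and no set of fewer than `n` vertices
disconnects it. -/
def IsVertexConnected (G : SimpleGraph V) (n : ℕ) : Prop :=
  n < Nat.card V ∧ ∀ X : Finset V, X.card < n → (deleteVertices G X).Connected

/-- The closed walk `c` is an odd `S`-cycle: a cycle of odd length that contains a vertex of `S`. -/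
def IsOddSCycle {G : SimpleGraph V} (S : Set V) {v : V} (c : G.Walk v v) : Prop :=
  c.IsCycle ∧ Odd c.length ∧ ∃ s ∈ S, s ∈ c.support

/-- `G` contains `k` pairwise vertex-disjoint odd `S`-cycles. -/
def HasDisjointOddSCycles (G : SimpleGraph V) (S : Set V) (k : ℕ) : Prop :=
  ∃ (v : Fin k → V) (c : ∀ i, G.Walk (v i) (v i)),
    (∀ i, IsOddSCycle S (c i)) ∧
    ∀ i j, i ≠ j → ∀ w, w ∈ (c i).support → w ∉ (c j).support

/-- `X` is an odd `S`-cycle cover of `G`: the graph `G - X` contains no odd `S`-cycle. -/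
def IsOddSCycleCover (G : SimpleGraph V) (S : Set V) (X : Finset V) : Prop :=
  ∀ (v : {v : V | v ∉ X}) (c : (deleteVertices G X).Walk v v),
    ¬ IsOddSCycle (Subtype.val ⁻¹' S) c

/-- `Y` is an odd cycle cover of `G`: the graph `G - Y` is bipartite. -/
def IsOddCycleCover (G : SimpleGraph V) (Y : Finset V) : Prop :=
  (deleteVertices G Y).IsBipartite

end OddCyclePacking

/-! If `|S| < k`, deleting `S` is enough, so let `|S| ≥ k ≥ 1`. The cycles are always assembled in
the same way. One finds a set `W` and a graph `K ≤ G`, properly 2-coloured on `W`, in which any `2k`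
disjoint pairs of vertices of `W` can be linked inside `W`. The parity of a link is then determined
by the colours of its ends. So an odd `S`-cycle needs only a path with ends in `W` and otherwise
outside `W` whose parity disagrees with its end colours (`IsOddAPath`) and which meets `S`, or such
a path together with a disjoint ear through `S`. One or two links complete these pieces to a cycle
(`completable_of_isEar`), and all links are found simultaneously.

Links come from `Massed.linked`, in the manner of Thomas and Wollan: a set `X` in a graph that is
dense outside `X` and has no dense part behind a small separator is linked. In a minimal
counterexample every edge outside `X` lies in many triangles, so a vertex of small degree has a
small closed neighbourhood of large minimum degree. Such a set contains a highly linked set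
(`denseSetsContainLinked`), to which `X` is joined by Menger's theorem.

Far from bipartite (`packing_or_isOddCycleCover`). Fix `T ⊆ S` with `k` vertices. The bipartite
graph of a maximum cut of `G - T` contains a highly linked set `U`. A min-max theorem for odd
`U`-paths, derived from Tutte's theorem on a double cover, gives either fewer than `6k` vertices
meeting all odd `U`-paths of `G - T`, which together with `T` meet all odd cycles, or `3k` disjoint
odd `U`-paths. In the second case a fan of `2k` paths from neighbours of `T` to `U` makes an ear
through each vertex of `T`. It can be chosen to miss `k` of the odd paths, and each ear is paired
with one of these.

Close to bipartite (`packing_or_covers_of_isOddCycleCover`). If at most `7k` vertices meet all odd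
cycles, there is a 2-colouring, proper outside them, in which every vertex has many neighbours of
the opposite colour. A matching of `k` monochromatic edges, each provided with its own vertex of
`S`, gives the packing. If there is none, the ends of a maximum matching of monochromatic edges,
with a few corrections, give the two covers. -/

namespace OddCyclePacking

/-! ### Connections inside a set, separations and linkages. -/

section Basics
open scoped Classical
variable {V : Type*}

/-- `a` and `b` are joined by a walk of `G` inside `C`. -/
def Conn (G : SimpleGraph V) (C : Finset V) (a b : V) : Prop :=
  ∃ w : G.Walk a b, ∀ x ∈ w.support, x ∈ C

/-- `(A, B)` is a separation of `G[W]`. -/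
def Sep (G : SimpleGraph V) (W A B : Finset V) : Prop :=
  A ∪ B = W ∧ ∀ a ∈ A, ∀ b ∈ B, a ∉ B → b ∉ A → ¬ G.Adj a b

variable {G H : SimpleGraph V} {C D : Finset V} {a b c : V}

theorem Conn.refl (h : a ∈ C) : Conn G C a a := ⟨.nil, by simpa using h⟩

theorem Conn.left (h : Conn G C a b) : a ∈ C := by
  obtain ⟨w, hw⟩ := h; exact hw _ w.start_mem_support

theorem Conn.right (h : Conn G C a b) : b ∈ C := by
  obtain ⟨w, hw⟩ := h; exact hw _ w.end_mem_support

theorem Conn.symm (h : Conn G C a b) : Conn G C b a := by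
  obtain ⟨w, hw⟩ := h; exact ⟨w.reverse, by simpa using hw⟩

theorem Conn.trans (h : Conn G C a b) (h' : Conn G C b c) : Conn G C a c := by
  obtain ⟨w, hw⟩ := h
  obtain ⟨w', hw'⟩ := h'
  refine ⟨w.append w', fun x hx => ?_⟩
  rcases SimpleGraph.Walk.mem_support_append_iff _ _ |>.1 hx with h | h
  · exact hw x h
  · exact hw' x h

theorem Conn.mono (h : Conn G C a b) (hCD : C ⊆ D) (hGH : ∀ x y, x ∈ C → y ∈ C → G.Adj x y → H.Adj x y) :
    Conn H D a b := by
  obtain ⟨w, hw⟩ := h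
  induction w with
  | nil => exact Conn.refl (hCD (hw _ (by simp)))
  | @cons u v w' hadj p ih =>
    simp only [SimpleGraph.Walk.support_cons, List.mem_cons, forall_eq_or_imp] at hw
    have hv := hw.2 v p.start_mem_support
    obtain ⟨q, hq⟩ := ih hw.2
    refine ⟨.cons (hGH _ _ hw.1 hv hadj) q, ?_⟩
    simp only [SimpleGraph.Walk.support_cons, List.mem_cons, forall_eq_or_imp]
    exact ⟨hCD hw.1, hq⟩

theorem Conn.mono_set (h : Conn G C a b) (hCD : C ⊆ D) : Conn G D a b :=
  h.mono hCD fun _ _ _ _ => id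

theorem Conn.adj (h : G.Adj a b) (ha : a ∈ C) (hb : b ∈ C) : Conn G C a b :=
  ⟨h.toWalk, by simp [ha, hb]⟩

/-- A walk can be cut at the first vertex satisfying `P`. -/
theorem exists_first_hit (P : V → Prop) {a b : V} (w : G.Walk a b) (h : ∃ x ∈ w.support, P x) :
    ∃ q, ∃ r : G.Walk a q, P q ∧ (∀ x ∈ r.support, x ∈ w.support) ∧ ∀ x ∈ r.support, P x → x = q := by
  induction w with
  | nil =>
    simp only [SimpleGraph.Walk.support_nil, List.mem_singleton, exists_eq_left] at h
    exact ⟨_, .nil, h, by simp, by simp⟩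
  | @cons u v w' hadj p ih =>
    by_cases hu : P u
    · exact ⟨u, .nil, hu, by simp, by simp⟩
    · simp only [SimpleGraph.Walk.support_cons, List.mem_cons, exists_eq_or_imp, hu, false_or] at h
      obtain ⟨q, r, hq, hr, hr'⟩ := ih h
      refine ⟨q, .cons hadj r, hq, ?_, ?_⟩
      · simp only [SimpleGraph.Walk.support_cons, List.mem_cons]
        rintro x (rfl | hx)
        · exact Or.inl rfl
        · exact Or.inr (hr x hx)
      · simp only [SimpleGraph.Walk.support_cons, List.mem_cons]
        rintro x (rfl | hx) hPx
        · exact absurd hPx hu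
        · exact hr' x hx hPx

theorem Sep.symm {W A B : Finset V} (h : Sep G W A B) : Sep G W B A :=
  ⟨by rw [Finset.union_comm]; exact h.1, fun a ha b hb hab hba hadj => h.2 b hb a ha hba hab hadj.symm⟩

/-- Disjoint connections inside `W` from each vertex of `X` to `Z`. -/
def Linkage (G : SimpleGraph V) (W X Z : Finset V) (C : V → Finset V) (f : V → V) : Prop :=
  (∀ x ∈ X, f x ∈ Z ∧ C x ⊆ W ∧ Conn G (C x) x (f x) ∧ ∀ z ∈ C x, z ∈ Z → z = f x) ∧
    ∀ x ∈ X, ∀ y ∈ X, x ≠ y → Disjoint (C x) (C y)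

theorem Linkage.injOn {W X Z : Finset V} {C : V → Finset V} {f : V → V} (h : Linkage G W X Z C f) :
    Set.InjOn f X := by
  intro x hx y hy hxy
  by_contra hne
  have h1 := (h.1 x hx).2.2.1.right
  have h2 := (h.1 y hy).2.2.1.right
  rw [hxy] at h1
  exact Finset.disjoint_left.1 (h.2 x hx y hy hne) h1 h2

end Basics

/-! ### Menger's theorem. -/

section Menger
open scoped Classical
variable {V : Type*}

/-- Menger's theorem: `X` is completely linked to `Z` in `G[W]`, or a separation of order less
than `|X|` separates them. -/
theorem menger [Finite V] (G : SimpleGraph V) : ∀ (W X Z : Finset V), X ⊆ W → Z ⊆ W →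
    (∃ C f, Linkage G W X Z C f) ∨
      ∃ A B, Sep G W A B ∧ X ⊆ A ∧ Z ⊆ B ∧ (A ∩ B).card < X.card := by
  -- The induction deletes edges and leaves `W`, `X`, `Z` free, because both halves of a separation
  -- become instances of their own.
  induction G using WellFoundedLT.induction with
  | ind G IH =>
  intro W X Z hXW hZW
  by_cases hE : ∃ x y, G.Adj x y
  swap
  · push Not at hE
    by_cases hXZ : X ⊆ Z
    · refine Or.inl ⟨fun x => {x}, id, fun x hx => ⟨hXZ hx, by simpa using hXW hx,
        Conn.refl (by simp), by simp⟩, fun x _ y _ hxy => by simpa using hxy⟩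
    · refine Or.inr ⟨(W \ Z) ∪ X, Z, ⟨?_, fun a _ b _ _ _ => hE a b⟩, Finset.subset_union_right,
        subset_rfl, ?_⟩
      · ext v; simp only [Finset.mem_union, Finset.mem_sdiff]
        constructor
        · rintro ((h | h) | h)
          exacts [h.1, hXW h, hZW h]
        · intro h; by_cases hv : v ∈ Z <;> simp [h, hv]
      · obtain ⟨v, hv, hvZ⟩ := Finset.not_subset.1 hXZ
        apply Finset.card_lt_card
        refine ⟨fun u hu => ?_, fun h => ?_⟩
        · simp only [Finset.mem_inter, Finset.mem_union, Finset.mem_sdiff] at hu; tauto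
        · have := h hv; simp [hvZ] at this
  obtain ⟨x, y, hxy⟩ := hE
  set G' := G.deleteEdges {s(x, y)} with hG'
  have hG'lt : G' < G := by
    refine lt_of_le_of_ne (SimpleGraph.deleteEdges_le _) fun h => ?_
    have : ¬ G'.Adj x y := by simp [hG', SimpleGraph.deleteEdges_adj]
    rw [h] at this; exact this hxy
  have hle : ∀ u v, G'.Adj u v → G.Adj u v := fun u v h => hG'lt.le h
  have hadj : ∀ u v, G.Adj u v → ¬ G'.Adj u v → (u = x ∧ v = y) ∨ (u = y ∧ v = x) := by
    intro u v h h'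
    by_contra hne
    apply h'
    rw [hG', SimpleGraph.deleteEdges_adj]
    refine ⟨h, ?_⟩
    simpa using hne
  rcases IH G' hG'lt W X Z hXW hZW with ⟨C, f, h1, h2⟩ | ⟨A, B, hS, hXA, hZB, hlt⟩
  · exact Or.inl ⟨C, f, fun x hx => ⟨(h1 x hx).1, (h1 x hx).2.1,
      (h1 x hx).2.2.1.mono subset_rfl fun _ _ _ _ h => hle _ _ h, (h1 x hx).2.2.2⟩, h2⟩
  by_cases hSG : Sep G W A B
  · exact Or.inr ⟨A, B, hSG, hXA, hZB, hlt⟩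
  -- the deleted edge crosses
  obtain ⟨x, y, hxy, hxA, hyB, hxB, hyA, hadj⟩ : ∃ x y, G.Adj x y ∧ x ∈ A ∧ y ∈ B ∧ x ∉ B ∧ y ∉ A ∧
      ∀ u v, G.Adj u v → ¬ G'.Adj u v → (u = x ∧ v = y) ∨ (u = y ∧ v = x) := by
    have : ∃ a ∈ A, ∃ b ∈ B, a ∉ B ∧ b ∉ A ∧ G.Adj a b := by
      by_contra hcon
      push Not at hcon
      exact hSG ⟨hS.1, hcon⟩
    obtain ⟨a, ha, b, hb, haB, hbA, hab⟩ := this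
    have h' := hS.2 a ha b hb haB hbA
    rcases hadj a b hab h' with ⟨rfl, rfl⟩ | ⟨rfl, rfl⟩
    · exact ⟨a, b, hab, ha, hb, haB, hbA, hadj⟩
    · exact ⟨a, b, hab, ha, hb, haB, hbA, fun u v h1 h2 => (hadj u v h1 h2).symm⟩
  by_cases hno : ∃ A B, Sep G W A B ∧ X ⊆ A ∧ Z ⊆ B ∧ (A ∩ B).card < X.card
  · exact Or.inr hno
  refine Or.inl ?_
  have hAW : A ⊆ W := hS.1 ▸ Finset.subset_union_left
  have hBW : B ⊆ W := hS.1 ▸ Finset.subset_union_right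
  have hAB : ∀ v ∈ W, v ∈ A ∨ v ∈ B := fun v hv => by
    rw [← hS.1] at hv; exact Finset.mem_union.1 hv
  have hxS : x ∉ A ∩ B := by simp [hxB]
  have hyS : y ∉ A ∩ B := by simp [hyA]
  -- Moving `y` into the separator repairs the separation at the cost of one vertex. As `G` has no
  -- separation of order below `|X|`, the order of `(A, B)` is exactly `|X| - 1`.
  have hSep1 : Sep G W (insert y A) B := by
    refine ⟨?_, fun a ha b hb haB hbA h => ?_⟩
    · rw [Finset.insert_union, hS.1, Finset.insert_eq_of_mem (hBW hyB)]
    · have hay : a ≠ y := fun e => haB (e ▸ hyB)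
      have haA : a ∈ A := Finset.mem_of_mem_insert_of_ne ha hay
      have hby : b ≠ y := fun e => hbA (e ▸ Finset.mem_insert_self _ _)
      have hbA' : b ∉ A := fun h => hbA (Finset.mem_insert_of_mem h)
      rcases hadj a b h (hS.2 a haA b hb haB hbA') with h | h
      · exact hby h.2
      · exact hay h.1
  have hcard : X.card = (A ∩ B).card + 1 := by
    have h1 : ¬ ((insert y A) ∩ B).card < X.card := fun h =>
      hno ⟨_, _, hSep1, hXA.trans (Finset.subset_insert _ _), hZB, h⟩
    rw [Finset.insert_inter_of_mem hyB, Finset.card_insert_of_notMem hyS] at h1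
    omega
  -- A small separation of `G'[A]` would have `x` on its far side. Adding `B` to that side would
  -- give a small separation of `G`, since the deleted edge does not cross it. The other half is
  -- symmetric.
  have key1 : ∃ C f, Linkage G' A X (insert x (A ∩ B)) C f := by
    refine (IH G' hG'lt A X (insert x (A ∩ B)) hXA ?_).resolve_right ?_
    · exact Finset.insert_subset hxA Finset.inter_subset_left
    rintro ⟨A1, B1, hS1, hXA1, hZB1, hlt1⟩
    have hA1A : A1 ⊆ A := hS1.1 ▸ Finset.subset_union_left
    apply hno
    refine ⟨A1, B1 ∪ B, ⟨?_, fun a ha b hb haB hbA h => ?_⟩, hXA1,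
      hZB.trans Finset.subset_union_right, lt_of_le_of_lt (Finset.card_le_card ?_) hlt1⟩
    · rw [← Finset.union_assoc, hS1.1, hS.1]
    · simp only [Finset.mem_union, not_or] at haB hb
      have hG'ab : G'.Adj a b := by
        by_contra h'
        rcases hadj a b h h' with ⟨e, -⟩ | ⟨e, -⟩
        · exact haB.1 (e ▸ hZB1 (Finset.mem_insert_self _ _))
        · exact haB.2 (e ▸ hyB)
      by_cases hbB1 : b ∈ B1
      · exact hS1.2 a ha b hbB1 haB.1 hbA hG'ab
      · have hbB := hb.resolve_left hbB1
        by_cases hbA' : b ∈ A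
        · exact hbB1 (hZB1 (Finset.mem_insert_of_mem (Finset.mem_inter.2 ⟨hbA', hbB⟩)))
        · exact hS.2 a (hA1A ha) b hbB haB.2 hbA' hG'ab
    · intro v hv
      simp only [Finset.mem_inter, Finset.mem_union] at hv ⊢
      refine ⟨hv.1, hv.2.elim id fun h => hZB1 (Finset.mem_insert_of_mem
        (Finset.mem_inter.2 ⟨hA1A hv.1, h⟩))⟩
  have key2 : ∃ C f, Linkage G' B (insert y (A ∩ B)) Z C f := by
    refine (IH G' hG'lt B (insert y (A ∩ B)) Z ?_ hZB).resolve_right ?_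
    · exact Finset.insert_subset hyB Finset.inter_subset_right
    rintro ⟨A1, B1, hS1, hXA1, hZB1, hlt1⟩
    rw [Finset.card_insert_of_notMem hyS, ← hcard] at hlt1
    have hB1B : B1 ⊆ B := hS1.1 ▸ Finset.subset_union_right
    apply hno
    refine ⟨A ∪ A1, B1, ⟨?_, fun a ha b hb haB hbA h => ?_⟩, hXA.trans Finset.subset_union_left,
      hZB1, lt_of_le_of_lt (Finset.card_le_card ?_) hlt1⟩
    · rw [Finset.union_assoc, hS1.1, hS.1]
    · simp only [Finset.mem_union, not_or] at hbA ha
      have hG'ab : G'.Adj a b := by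
        by_contra h'
        rcases hadj a b h h' with ⟨-, e⟩ | ⟨-, e⟩
        · exact hbA.2 (e ▸ hXA1 (Finset.mem_insert_self _ _))
        · exact hbA.1 (e ▸ hxA)
      by_cases haA1 : a ∈ A1
      · exact hS1.2 a haA1 b hb haB hbA.2 hG'ab
      · have haA := ha.resolve_right haA1
        by_cases haB' : a ∈ B
        · exact haA1 (hXA1 (Finset.mem_insert_of_mem (Finset.mem_inter.2 ⟨haA, haB'⟩)))
        · exact hS.2 a haA b (hB1B hb) haB' hbA.1 hG'ab
    · intro v hv
      simp only [Finset.mem_inter, Finset.mem_union] at hv ⊢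
      refine ⟨hv.1.elim (fun h => hXA1 (Finset.mem_insert_of_mem
        (Finset.mem_inter.2 ⟨h, hB1B hv.2⟩))) id, hv.2⟩
  obtain ⟨C1, f1, h1⟩ := key1
  obtain ⟨C2, f2, h2⟩ := key2
  -- The first system ends in `A ∩ B` and `x`, the second begins in `A ∩ B` and `y`; `n` matches
  -- them, using the deleted edge at `x`.
  let n : V → V := fun v => if v = x then y else v
  have hn : ∀ u ∈ X, n (f1 u) ∈ insert y (A ∩ B) := by
    intro u hu
    have := (h1.1 u hu).1
    by_cases h : f1 u = x
    · simp [n, h]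
    · simp only [n, h, if_false]
      exact Finset.mem_insert_of_mem (Finset.mem_of_mem_insert_of_ne this h)
  have hninj : ∀ u ∈ X, ∀ v ∈ X, n (f1 u) = n (f1 v) → u = v := by
    intro u hu v hv h
    have hu' := (h1.1 u hu).1
    have hv' := (h1.1 v hv).1
    have hyu : f1 u ≠ y := fun e => by
      rw [e] at hu'; rcases Finset.mem_insert.1 hu' with e | e
      · exact hxB (e ▸ hyB)
      · exact hyS e
    have hyv : f1 v ≠ y := fun e => by
      rw [e] at hv'; rcases Finset.mem_insert.1 hv' with e | e
      · exact hxB (e ▸ hyB)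
      · exact hyS e
    apply h1.injOn hu hv
    by_cases e1 : f1 u = x <;> by_cases e2 : f1 v = x
    · rw [e1, e2]
    · simp only [n, e1, e2, if_true, if_false] at h; exact absurd h.symm hyv
    · simp only [n, e1, e2, if_true, if_false] at h; exact absurd h hyu
    · simpa only [n, e1, e2, if_false] using h
  -- how the two systems meet
  have hmeet : ∀ u ∈ X, ∀ t ∈ insert y (A ∩ B), ∀ w, w ∈ C1 u → w ∈ C2 t → w = f1 u ∧ w = t := by
    intro u hu t ht w hw1 hw2
    have hwS : w ∈ A ∩ B := Finset.mem_inter.2 ⟨(h1.1 u hu).2.1 hw1, (h2.1 t ht).2.1 hw2⟩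
    refine ⟨(h1.1 u hu).2.2.2 w hw1 (Finset.mem_insert_of_mem hwS), ?_⟩
    by_contra hne
    exact Finset.disjoint_left.1 (h2.2 w (Finset.mem_insert_of_mem hwS) t ht hne)
      (h2.1 w (Finset.mem_insert_of_mem hwS)).2.2.1.left hw2
  refine ⟨fun u => C1 u ∪ C2 (n (f1 u)), fun u => f2 (n (f1 u)), fun u hu => ?_, ?_⟩
  · obtain ⟨a1, a2, a3, a4⟩ := h1.1 u hu
    obtain ⟨b1, b2, b3, b4⟩ := h2.1 _ (hn u hu)
    refine ⟨b1, Finset.union_subset (a2.trans hAW) (b2.trans hBW), ?_, ?_⟩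
    · have c1 : Conn G (C1 u ∪ C2 (n (f1 u))) u (f1 u) :=
        a3.mono Finset.subset_union_left fun _ _ _ _ h => hle _ _ h
      have c2 : Conn G (C1 u ∪ C2 (n (f1 u))) (n (f1 u)) (f2 (n (f1 u))) :=
        b3.mono Finset.subset_union_right fun _ _ _ _ h => hle _ _ h
      refine c1.trans (Conn.trans ?_ c2)
      by_cases h : f1 u = x
      · have hn' : n (f1 u) = y := by simp [n, h]
        exact Conn.adj (by rw [hn', h]; exact hxy) c1.right c2.left
      · have hn' : n (f1 u) = f1 u := by simp [n, h]
        have := c1.right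
        exact hn'.symm ▸ (Conn.refl (by simpa [hn'] using this))
    · intro z hz hzZ
      rcases Finset.mem_union.1 hz with hz | hz
      · have hzS : z ∈ A ∩ B := Finset.mem_inter.2 ⟨a2 hz, hZB hzZ⟩
        have e := a4 z hz (Finset.mem_insert_of_mem hzS)
        have hzx : z ≠ x := fun e => hxS (e ▸ hzS)
        have e2 : n (f1 u) = z := by rw [← e]; simp [n, hzx]
        apply b4 z _ hzZ
        have := b3.left
        rwa [e2] at this ⊢
      · exact b4 z hz hzZ
  · intro u hu v hv huv
    have hd1 := h1.2 u hu v hv huv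
    have hd2 := h2.2 _ (hn u hu) _ (hn v hv) fun h => huv (hninj u hu v hv h)
    have hcross : ∀ u ∈ X, ∀ v ∈ X, u ≠ v → Disjoint (C1 u) (C2 (n (f1 v))) := by
      intro u hu v hv huv
      rw [Finset.disjoint_left]
      intro w hw1 hw2
      obtain ⟨e1, e2⟩ := hmeet u hu _ (hn v hv) w hw1 hw2
      apply huv
      apply hninj u hu v hv
      have hwS : w ∈ A ∩ B := Finset.mem_inter.2 ⟨(h1.1 u hu).2.1 hw1, (h2.1 _ (hn v hv)).2.1 hw2⟩
      have hwx : f1 u ≠ x := fun e => hxS (by rw [← e, ← e1]; exact hwS)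
      rw [← e2, e1]; simp [n, hwx]
    simp only [Finset.disjoint_union_left, Finset.disjoint_union_right]
    exact ⟨⟨hd1, (hcross v hv u hu huv.symm).symm⟩, hcross u hu v hv huv, hd2⟩

end Menger

/-! ### Linked sets and their transfer across separations. -/

section Linked
open scoped Classical
variable {V : Type*} {G H : SimpleGraph V} {W X A B T : Finset V} {M : Finset (V × V)}

/-- Distinct pairs of `M` have no vertex in common. -/
def DisjointPairs (M : Finset (V × V)) : Prop :=
  ∀ p ∈ M, ∀ q ∈ M, p ≠ q → p.1 ≠ q.1 ∧ p.1 ≠ q.2 ∧ p.2 ≠ q.1 ∧ p.2 ≠ q.2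

/-- The pairs of `M` can be joined by disjoint connections in `G[W]`. -/
def Linkable (G : SimpleGraph V) (W : Finset V) (M : Finset (V × V)) : Prop :=
  ∃ C : V × V → Finset V, (∀ p ∈ M, C p ⊆ W ∧ Conn G (C p) p.1 p.2) ∧
    ∀ p ∈ M, ∀ q ∈ M, p ≠ q → Disjoint (C p) (C q)

/-- Any disjoint pairs of vertices of `X` can be linked in `G[W]`. -/
def Linked (G : SimpleGraph V) (W X : Finset V) : Prop :=
  ∀ M : Finset (V × V), (∀ p ∈ M, p.1 ∈ X ∧ p.2 ∈ X) → DisjointPairs M → Linkable G W M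

theorem Linkable.mono (h : Linkable G W M) (hW : W ⊆ A) (hG : ∀ x ∈ W, ∀ y ∈ W, G.Adj x y → H.Adj x y) :
    Linkable H A M := by
  obtain ⟨C, h1, h2⟩ := h
  exact ⟨C, fun p hp => ⟨(h1 p hp).1.trans hW, (h1 p hp).2.mono subset_rfl
    fun x y hx hy => hG x ((h1 p hp).1 hx) y ((h1 p hp).1 hy)⟩, h2⟩

theorem Linked.mono (h : Linked G W X) (hW : W ⊆ A) (hX : T ⊆ X)
    (hG : ∀ x ∈ W, ∀ y ∈ W, G.Adj x y → H.Adj x y) : Linked H A T := fun M hM hd =>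
  (h M (fun p hp => ⟨hX (hM p hp).1, hX (hM p hp).2⟩) hd).mono hW hG

/-- Connections inside `A` ending at `T ⊆ A ∩ B` are completed inside `B`. -/
theorem Linked.glue (hB : Linked G B T)
    (D : V × V → Finset V) (hDA : ∀ p ∈ M, D p ⊆ A)
    (hD : ∀ p ∈ M, ∀ q ∈ M, p ≠ q → Disjoint (D p) (D q))
    (h : ∀ p ∈ M, (Disjoint (D p) B ∧ Conn G (D p) p.1 p.2) ∨
      ∃ q ∈ T, ∃ q' ∈ T, Conn G (D p) p.1 q ∧ Conn G (D p) p.2 q' ∧ ∀ z ∈ D p, z ∈ B → z = q ∨ z = q') :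
    Linkable G (A ∪ B) M := by
  have h' : ∀ p, ∃ q q', p ∈ M → (Disjoint (D p) B ∧ Conn G (D p) p.1 p.2) ∨
      (q ∈ T ∧ q' ∈ T ∧ Conn G (D p) p.1 q ∧ Conn G (D p) p.2 q' ∧
        ∀ z ∈ D p, z ∈ B → z = q ∨ z = q') := by
    intro p
    by_cases hp : p ∈ M
    · rcases h p hp with h | ⟨q, hq, q', hq', h⟩
      · exact ⟨p.1, p.1, fun _ => Or.inl h⟩
      · exact ⟨q, q', fun _ => Or.inr ⟨hq, hq', h⟩⟩
    · exact ⟨p.1, p.1, fun h => absurd h hp⟩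
  choose q q' hq using h'
  -- The pairs still to be joined inside `B`. It does no harm if `q p = q' p`, since `Linked` also
  -- allows trivial pairs.
  let N := M.filter fun p => ¬ (Disjoint (D p) B ∧ Conn G (D p) p.1 p.2)
  have hN : ∀ p ∈ N, q p ∈ T ∧ q' p ∈ T ∧ Conn G (D p) p.1 (q p) ∧ Conn G (D p) p.2 (q' p) ∧
        ∀ z ∈ D p, z ∈ B → z = q p ∨ z = q' p := fun p hp =>
    (hq p (Finset.mem_filter.1 hp).1).resolve_left (Finset.mem_filter.1 hp).2
  have hNM : ∀ p ∈ N, p ∈ M := fun p hp => (Finset.mem_filter.1 hp).1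
  have hne : ∀ p ∈ N, ∀ p' ∈ N, p ≠ p' → ∀ a ∈ D p, ∀ b ∈ D p', a ≠ b := by
    intro p hp p' hp' hpp a ha b hb e
    exact Finset.disjoint_left.1 (hD p (hNM p hp) p' (hNM p' hp') hpp) ha (e ▸ hb)
  obtain ⟨C, hC1, hC2⟩ := hB (N.image fun p => (q p, q' p))
    (by
      intro r hr
      obtain ⟨p, hp, rfl⟩ := Finset.mem_image.1 hr
      exact ⟨(hN p hp).1, (hN p hp).2.1⟩)
    (by
      intro r hr s hs hrs
      obtain ⟨p, hp, rfl⟩ := Finset.mem_image.1 hr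
      obtain ⟨p', hp', rfl⟩ := Finset.mem_image.1 hs
      have hpp : p ≠ p' := fun e => hrs (by rw [e])
      have h1 := hN p hp
      have h2 := hN p' hp'
      exact ⟨hne p hp p' hp' hpp _ h1.2.2.1.right _ h2.2.2.1.right,
        hne p hp p' hp' hpp _ h1.2.2.1.right _ h2.2.2.2.1.right,
        hne p hp p' hp' hpp _ h1.2.2.2.1.right _ h2.2.2.1.right,
        hne p hp p' hp' hpp _ h1.2.2.2.1.right _ h2.2.2.2.1.right⟩)
  have hNi : ∀ p ∈ N, (q p, q' p) ∈ N.image fun p => (q p, q' p) :=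
    fun p hp => Finset.mem_image_of_mem _ hp
  have hCN : ∀ p ∈ N, ∀ p' ∈ N, p ≠ p' → Disjoint (C (q p, q' p)) (C (q p', q' p')) := by
    intro p hp p' hp' hpp
    refine hC2 _ (hNi p hp) _ (hNi p' hp') fun e => ?_
    exact hne p hp p' hp' hpp _ (hN p hp).2.2.1.right _ (hN p' hp').2.2.1.right (Prod.ext_iff.1 e).1
  -- a connection in `A` meets a connection in `B` only if they belong together
  have hDC : ∀ p ∈ M, ∀ p' ∈ N, p ≠ p' → Disjoint (D p) (C (q p', q' p')) := by
    intro p hp p' hp' hpp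
    rw [Finset.disjoint_left]
    intro z hz hz'
    have hzB := (hC1 _ (hNi p' hp')).1 hz'
    by_cases hpN : p ∈ N
    · have hz2 : z ∈ C (q p, q' p) := by
        rcases (hN p hpN).2.2.2.2 z hz hzB with rfl | rfl
        · exact (hC1 _ (hNi p hpN)).2.left
        · exact (hC1 _ (hNi p hpN)).2.right
      exact Finset.disjoint_left.1 (hCN p hpN p' hp' hpp) hz2 hz'
    · have : Disjoint (D p) B := by
        by_contra hcon
        exact hpN (Finset.mem_filter.2 ⟨hp, fun h => hcon h.1⟩)
      exact Finset.disjoint_left.1 this hz hzB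
  refine ⟨fun p => if p ∈ N then D p ∪ C (q p, q' p) else D p, fun p hp => ?_, fun p hp p' hp' hpp => ?_⟩
  · by_cases hpN : p ∈ N
    · simp only [hpN, if_true]
      obtain ⟨-, -, h1, h2, -⟩ := hN p hpN
      have h3 := hC1 _ (hNi p hpN)
      refine ⟨Finset.union_subset_union (hDA p hp) h3.1, ?_⟩
      exact (h1.mono_set Finset.subset_union_left).trans
        ((h3.2.mono_set Finset.subset_union_right).trans (h2.symm.mono_set Finset.subset_union_left))
    · simp only [hpN, if_false]
      refine ⟨(hDA p hp).trans Finset.subset_union_left, ?_⟩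
      by_contra hcon
      exact hpN (Finset.mem_filter.2 ⟨hp, fun h => hcon h.2⟩)
  · by_cases hpN : p ∈ N <;> by_cases hpN' : p' ∈ N <;> simp only [hpN, hpN', if_true, if_false]
    · rw [Finset.disjoint_union_left, Finset.disjoint_union_right, Finset.disjoint_union_right]
      exact ⟨⟨hD p hp p' hp' hpp, hDC p hp p' hpN' hpp⟩, (hDC p' hp' p hpN hpp.symm).symm,
        hCN p hpN p' hpN' hpp⟩
    · rw [Finset.disjoint_union_left]
      exact ⟨hD p hp p' hp' hpp, (hDC p' hp' p hpN hpp.symm).symm⟩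
    · rw [Finset.disjoint_union_right]
      exact ⟨hD p hp p' hp' hpp, hDC p hp p' hpN' hpp⟩
    · exact hD p hp p' hp' hpp

/-- A linkage from `X` to `A ∩ B` transfers linkedness. -/
theorem Linked.compose {C : V → Finset V} {f : V → V} (hL : Linkage G A X (A ∩ B) C f)
    (hB : Linked G B (X.image f)) : Linked G (A ∪ B) X := by
  intro M hM hd
  have hdis : ∀ x ∈ X, ∀ y ∈ X, x ≠ y → Disjoint (C x) (C y) := hL.2
  refine hB.glue (fun p => C p.1 ∪ C p.2) (fun p hp => ?_) (fun p hp q hq hpq => ?_) fun p hp => Or.inr ?_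
  · exact Finset.union_subset (hL.1 _ (hM p hp).1).2.1 (hL.1 _ (hM p hp).2).2.1
  · obtain ⟨h1, h2, h3, h4⟩ := hd p hp q hq hpq
    obtain ⟨a1, a2⟩ := hM p hp
    obtain ⟨b1, b2⟩ := hM q hq
    simp only [Finset.disjoint_union_left, Finset.disjoint_union_right]
    exact ⟨⟨hdis _ a1 _ b1 h1, hdis _ a2 _ b1 h3⟩, hdis _ a1 _ b2 h2, hdis _ a2 _ b2 h4⟩
  · obtain ⟨a1, a2⟩ := hM p hp
    obtain ⟨b1, b2, b3, b4⟩ := hL.1 _ a1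
    obtain ⟨c1, c2, c3, c4⟩ := hL.1 _ a2
    refine ⟨_, Finset.mem_image_of_mem f a1, _, Finset.mem_image_of_mem f a2,
      b3.mono_set Finset.subset_union_left, c3.mono_set Finset.subset_union_right, fun z hz hzB => ?_⟩
    rcases Finset.mem_union.1 hz with hz | hz
    · exact Or.inl (b4 z hz (Finset.mem_inter.2 ⟨b2 hz, hzB⟩))
    · exact Or.inr (c4 z hz (Finset.mem_inter.2 ⟨c2 hz, hzB⟩))

/-- `G` with all edges inside `Z` added. -/
def addClique (G : SimpleGraph V) (Z : Finset V) : SimpleGraph V where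
  Adj a b := G.Adj a b ∨ (a ≠ b ∧ a ∈ Z ∧ b ∈ Z)
  symm := ⟨fun _ _ h => h.elim (fun h => Or.inl h.symm) fun h => Or.inr ⟨h.1.symm, h.2.2, h.2.1⟩⟩
  loopless := ⟨fun a h => h.elim (fun h => G.loopless.irrefl a h) fun h => h.1 rfl⟩

/-- A set with at most one vertex in `Z` contains no added edge. -/
theorem Conn.of_addClique {C Z : Finset V} {a b : V} (h : Conn (addClique G Z) C a b)
    (hZ : ∀ x ∈ C, ∀ y ∈ C, x ∈ Z → y ∈ Z → x = y) : Conn G C a b :=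
  h.mono subset_rfl fun x y hx hy hxy => hxy.elim id fun h => absurd (hZ x hx y hy h.2.1 h.2.2) h.1

/-- If `A ∩ B` is linked in `B`, it may be turned into a clique. -/
theorem Linked.lift (hB : Linked G B (A ∩ B)) (hA : Linked (addClique G (A ∩ B)) A X) :
    Linked G (A ∪ B) X := by
  intro M hM hd
  obtain ⟨C, h1, h2⟩ := hA M hM hd
  have hex : ∀ p, ∃ D ⊆ C p, p ∈ M → (Disjoint D B ∧ Conn G D p.1 p.2) ∨
      ∃ q ∈ A ∩ B, ∃ q' ∈ A ∩ B, Conn G D p.1 q ∧ Conn G D p.2 q' ∧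
        ∀ z ∈ D, z ∈ B → z = q ∨ z = q' := by
    intro p
    by_cases hp : p ∈ M
    swap
    · exact ⟨C p, subset_rfl, fun h => absurd h hp⟩
    obtain ⟨hCA, w, hw⟩ := h1 p hp
    by_cases hwB : ∃ x ∈ w.support, x ∈ B
    -- From each end the walk is cut at its first vertex in `B`. Such an initial segment has only
    -- one vertex in `A ∩ B` and so uses no added edge.
    · have key : ∀ {a b} (w : (addClique G (A ∩ B)).Walk a b), (∀ x ∈ w.support, x ∈ C p) →
          (∃ x ∈ w.support, x ∈ B) → ∃ q ∈ A ∩ B, ∃ D ⊆ C p,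
          Conn G D a q ∧ ∀ z ∈ D, z ∈ B → z = q := by
        intro _ _ w hw hwB
        obtain ⟨q, r, hq, hr, hr'⟩ := exists_first_hit (fun x => x ∈ B) w hwB
        refine ⟨q, Finset.mem_inter.2 ⟨hCA (hw _ (hr _ r.end_mem_support)), hq⟩,
          r.support.toFinset, fun x hx => hw x (hr x (by simpa using hx)), ?_, by simpa using hr'⟩
        refine Conn.of_addClique (Z := A ∩ B) ⟨r, by simp⟩ fun x hx y hy hxZ hyZ => ?_
        rw [hr' x (by simpa using hx) (Finset.mem_inter.1 hxZ).2,
          hr' y (by simpa using hy) (Finset.mem_inter.1 hyZ).2]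
      obtain ⟨q, hq, D, hD, hDc, hDB⟩ := key w hw hwB
      obtain ⟨q', hq', D', hD', hDc', hDB'⟩ := key w.reverse (by simpa using hw) (by simpa using hwB)
      refine ⟨D ∪ D', Finset.union_subset hD hD', fun _ => Or.inr ⟨q, hq, q', hq',
        hDc.mono_set Finset.subset_union_left, hDc'.mono_set Finset.subset_union_right,
        fun z hz hzB => (Finset.mem_union.1 hz).imp (hDB z · hzB) (hDB' z · hzB)⟩⟩
    · push Not at hwB
      refine ⟨w.support.toFinset, fun x hx => hw x (by simpa using hx), fun _ => Or.inl ⟨?_, ?_⟩⟩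
      · rw [Finset.disjoint_left]; intro x hx; exact hwB x (by simpa using hx)
      · refine Conn.of_addClique (Z := A ∩ B) ⟨w, by simp⟩ fun x hx _ _ hxZ _ => ?_
        exact absurd (Finset.mem_inter.1 hxZ).2 (hwB x (by simpa using hx))
  choose D hDC hD using hex
  exact hB.glue D (fun p hp => (hDC p).trans (h1 p hp).1)
    (fun p hp q hq hpq => (h2 p hp q hq hpq).mono (hDC p) (hDC q)) fun p hp => hD p hp
end Linked

/-! ### Massed pairs: separations excluded in a minimal counterexample. -/

section Massed
open scoped Classical
variable {V : Type*} {G H : SimpleGraph V} {W W' X A B S T : Finset V} {t : ℕ}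

/-- Ordered adjacent pairs of `W` that meet `S`. -/
noncomputable def incid (G : SimpleGraph V) (W S : Finset V) : Finset (V × V) :=
  (W ×ˢ W).filter fun p => G.Adj p.1 p.2 ∧ (p.1 ∈ S ∨ p.2 ∈ S)

theorem mem_incid {p : V × V} :
    p ∈ incid G W S ↔ p.1 ∈ W ∧ p.2 ∈ W ∧ G.Adj p.1 p.2 ∧ (p.1 ∈ S ∨ p.2 ∈ S) := by
  simp [incid, and_assoc]

/-- Every separation of order less than `|X|` has a sparse far side, and `G[W]` is dense
outside `X`. -/
def Massed (t : ℕ) (G : SimpleGraph V) (W X : Finset V) : Prop :=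
  X ⊆ W ∧ 12 * t * (W \ X).card < (incid G W (W \ X)).card ∧
    ∀ A B, Sep G W A B → X ⊆ A → (A ∩ B).card < X.card →
      (incid G W (B \ A)).card ≤ 12 * t * (B \ A).card

/-- Massed pairs on fewer than `n` vertices are linked. -/
def LinkedBelow (V : Type*) (t n : ℕ) : Prop :=
  ∀ (G : SimpleGraph V) (W X : Finset V), W.card < n → X.card ≤ 2 * t → Massed t G W X → Linked G W X

theorem Sep.subset_left (h : Sep G W A B) : A ⊆ W := h.1 ▸ Finset.subset_union_left
theorem Sep.subset_right (h : Sep G W A B) : B ⊆ W := h.1 ▸ Finset.subset_union_right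
theorem Sep.mem_or (h : Sep G W A B) {v : V} (hv : v ∈ W) : v ∈ A ∨ v ∈ B := by
  rw [← h.1] at hv; exact Finset.mem_union.1 hv

theorem Sep.mono (h : Sep G W A B) (hHG : ∀ x ∈ W, ∀ y ∈ W, H.Adj x y → G.Adj x y) : Sep H W A B :=
  ⟨h.1, fun a ha b hb haB hbA hab =>
    h.2 a ha b hb haB hbA (hHG a (h.subset_left ha) b (h.subset_right hb) hab)⟩

/-- Neighbours of the far side stay in the far side. -/
theorem Sep.incid_sdiff (h : Sep G W A B) (hHG : ∀ x ∈ W, ∀ y ∈ W, (x ∈ B \ A ∨ y ∈ B \ A) →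
    H.Adj x y → G.Adj x y) : incid H W (B \ A) ⊆ incid G B (B \ A) := by
  intro p hp
  rw [mem_incid] at hp ⊢
  obtain ⟨h1, h2, h3, h4⟩ := hp
  have h3' := hHG _ h1 _ h2 h4 h3
  have key : ∀ x y, y ∈ W → G.Adj x y → x ∈ B \ A → y ∈ B := by
    intro x y hy hxy hx
    by_contra hyB
    rw [Finset.mem_sdiff] at hx
    exact h.2 y ((h.mem_or hy).resolve_right hyB) x hx.1 hyB hx.2 hxy.symm
  rcases h4 with h4 | h4
  · exact ⟨(Finset.mem_sdiff.1 h4).1, key _ _ h2 h3' h4, h3', Or.inl h4⟩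
  · exact ⟨key _ _ h1 h3'.symm h4, (Finset.mem_sdiff.1 h4).1, h3', Or.inr h4⟩

theorem incid_mono (hW : W ⊆ W') (hS : S ⊆ T) (hG : ∀ x ∈ W, ∀ y ∈ W, (x ∈ S ∨ y ∈ S) →
    G.Adj x y → H.Adj x y) : incid G W S ⊆ incid H W' T := by
  intro p hp
  rw [mem_incid] at hp ⊢
  obtain ⟨h1, h2, h3, h4⟩ := hp
  exact ⟨hW h1, hW h2, hG _ h1 _ h2 h4 h3, h4.imp (hS ·) (hS ·)⟩

theorem sum_card_neighbors_le (hX : X ⊆ W) :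
    ∑ v ∈ X, (W.filter (G.Adj v)).card ≤ (incid G W X).card := by
  rw [← Finset.card_sigma]
  refine Finset.card_le_card_of_injOn (fun p => (p.1, p.2)) ?_ ?_
  · rintro ⟨v, w⟩ h
    simp only [Finset.coe_sigma, Set.mem_sigma_iff, Finset.mem_coe, Finset.mem_filter] at h
    exact Finset.mem_coe.2 (mem_incid.2 ⟨hX h.1, h.2.1, h.2.2, Or.inl h.1⟩)
  · rintro ⟨v, w⟩ _ ⟨v', w'⟩ _ h
    simp only [Prod.mk.injEq] at h
    rw [h.1, h.2]

/-- A separation of the far side extends to a separation of the whole. -/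
theorem Sep.extend_right {A' B' : Finset V} (h : Sep G W A B) (h' : Sep G B A' B') (hAB : A ∩ B ⊆ A') :
    Sep G W (A ∪ A') B' ∧ (A ∪ A') ∩ B' = A' ∩ B' ∧ B' \ (A ∪ A') = B' \ A' := by
  have key : ∀ v ∈ B', v ∈ A → v ∈ A' := fun v hv hA =>
    hAB (Finset.mem_inter.2 ⟨hA, h'.subset_right hv⟩)
  refine ⟨⟨?_, fun a ha b hb haB hbA => ?_⟩, ?_, ?_⟩
  · rw [Finset.union_assoc, h'.1, h.1]
  · simp only [Finset.mem_union, not_or] at ha hbA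
    by_cases haA' : a ∈ A'
    · exact h'.2 a haA' b hb haB hbA.2
    · have haA := ha.resolve_right haA'
      refine h.2 a haA b (h'.subset_right hb) (fun haB => haA' ?_) hbA.1
      exact hAB (Finset.mem_inter.2 ⟨haA, haB⟩)
  · ext v; simp only [Finset.mem_inter, Finset.mem_union]
    exact ⟨fun h => ⟨h.1.elim (key v h.2) id, h.2⟩, fun h => ⟨Or.inr h.1, h.2⟩⟩
  · ext v; simp only [Finset.mem_sdiff, Finset.mem_union, not_or]
    exact ⟨fun h => ⟨h.1, h.2.2⟩, fun h => ⟨h.1, fun hA => h.2 (key v h.1 hA), h.2⟩⟩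

/-- A separation of the near side extends to a separation of the whole. -/
theorem Sep.extend_left {A' B' : Finset V} (h : Sep G W A B) (h' : Sep G A A' B') (hAB : A ∩ B ⊆ B') :
    Sep G W A' (B' ∪ B) ∧ A' ∩ (B' ∪ B) = A' ∩ B' ∧ B' ∩ B = A ∩ B := by
  have := h.symm.extend_right h'.symm (by rwa [Finset.inter_comm])
  refine ⟨by simpa [Finset.union_comm] using this.1.symm, ?_, ?_⟩
  · rw [Finset.inter_comm, Finset.union_comm, this.2.1, Finset.inter_comm]
  · ext v; simp only [Finset.mem_inter]
    exact ⟨fun h => ⟨h'.subset_right h.1, h.2⟩, fun h => ⟨hAB (Finset.mem_inter.2 h), h.2⟩⟩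

/-- A violation of the separation condition of minimal size carries a massed pair. -/
theorem exists_massed_of_violation (h : ∃ A B, Sep G W A B ∧ X ⊆ A ∧ (A ∩ B).card < X.card ∧
      12 * t * (B \ A).card < (incid G W (B \ A)).card) :
    ∃ A B, Sep G W A B ∧ X ⊆ A ∧ (A ∩ B).card < X.card ∧
      12 * t * (B \ A).card < (incid G W (B \ A)).card ∧ (B \ A).Nonempty ∧
      Massed t G B (A ∩ B) := by
  have hex : ∃ n, ∃ A B, B.card = n ∧ Sep G W A B ∧ X ⊆ A ∧ (A ∩ B).card < X.card ∧
      12 * t * (B \ A).card < (incid G W (B \ A)).card := by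
    obtain ⟨A, B, h⟩ := h; exact ⟨_, A, B, rfl, h⟩
  -- Here `|B|` is minimal. A violation for `A ∩ B` inside `G[B]` would extend by `A` to a violation
  -- in `G[W]` with a smaller far side.
  obtain ⟨A, B, hn, hS, hXA, hlt, hbig⟩ := Nat.find_spec hex
  have hmin := fun m hm => Nat.find_min hex (m := m) hm
  rw [← hn] at hmin
  refine ⟨A, B, hS, hXA, hlt, hbig, ?_, ⟨Finset.inter_subset_right, ?_, ?_⟩⟩
  · obtain ⟨p, hp⟩ := Finset.card_pos.1 (lt_of_le_of_lt (Nat.zero_le _) hbig)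
    rcases (mem_incid.1 hp).2.2.2 with h | h <;> exact ⟨_, h⟩
  · have : B \ (A ∩ B) = B \ A := by ext v; simp
    rw [this]
    exact hbig.trans_le (Finset.card_le_card (hS.incid_sdiff fun _ _ _ _ _ h => h))
  · intro A2 B2 hS2 hA2 hlt2
    by_contra hcon
    push Not at hcon
    obtain ⟨e1, e2, e3⟩ := hS.extend_right hS2 hA2
    refine hmin B2.card ?_ ⟨A ∪ A2, B2, rfl, e1, hXA.trans Finset.subset_union_left, ?_, ?_⟩
    · apply Finset.card_lt_card
      refine ⟨hS2.subset_right, fun hle => ?_⟩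
      have : A2 ∩ B2 = A2 := Finset.inter_eq_left.2 (hS2.subset_left.trans hle)
      rw [this] at hlt2
      exact absurd (Finset.card_le_card hA2) (by omega)
    · rw [e2]; omega
    · rw [e3]
      exact hcon.trans_le (Finset.card_le_card (incid_mono hS.subset_right subset_rfl fun _ _ _ _ _ h => h))

/-- There is no separation of order less than `|X|` whose far side is linked. -/
theorem Massed.no_rigid (IH : LinkedBelow V t W.card) (hX : X.card ≤ 2 * t) (hm : Massed t G W X)
    (hnl : ¬ Linked G W X) : ∀ (A B : Finset V), Sep G W A B → X ⊆ A → (A ∩ B).card < X.card →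
      (B \ A).Nonempty → ¬ Linked G B (A ∩ B) := by
  intro A
  -- The last case below produces a separation of the same kind with a smaller near side.
  induction hn : A.card using Nat.strong_induction_on generalizing A with
  | _ n ih =>
  intro B hS hXA hlt hne hlink
  apply hnl
  rw [← hS.1]
  -- It remains to link `X` in `G[A]` with `A ∩ B` made a clique. This pair is smaller, so it
  -- suffices that it is massed.
  refine hlink.lift ?_
  have hAW : A.card < W.card := by
    apply Finset.card_lt_card
    refine ⟨hS.subset_left, fun hle => ?_⟩
    obtain ⟨v, hv⟩ := hne
    rw [Finset.mem_sdiff] at hv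
    exact hv.2 (hle (hS.subset_right hv.1))
  refine IH _ _ _ hAW hX ⟨hXA, ?_, ?_⟩
  · have h1 := hm.2.1
    have h2 := hm.2.2 A B hS hXA hlt
    have h3 : (incid G W (W \ X)).card ≤
        (incid (addClique G (A ∩ B)) A (A \ X)).card + (incid G W (B \ A)).card := by
      refine le_trans (Finset.card_le_card ?_) (Finset.card_union_le _ _)
      intro p hp
      rw [Finset.mem_union, mem_incid, mem_incid]
      rw [mem_incid] at hp
      obtain ⟨a1, a2, a3, a4⟩ := hp
      by_cases hb : p.1 ∈ B \ A ∨ p.2 ∈ B \ A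
      · exact Or.inr ⟨a1, a2, a3, hb⟩
      · left
        have m1 := hS.mem_or a1
        have m2 := hS.mem_or a2
        simp only [Finset.mem_sdiff, not_or, not_and, not_not] at hb
        have m1' : p.1 ∈ A := m1.elim id hb.1
        have m2' : p.2 ∈ A := m2.elim id hb.2
        simp only [Finset.mem_sdiff] at a4 ⊢
        exact ⟨m1', m2', Or.inl a3, a4.imp (fun h => ⟨m1', h.2⟩) fun h => ⟨m2', h.2⟩⟩
    have h4 : (W \ X).card = (A \ X).card + (B \ A).card := by
      rw [← Finset.card_union_of_disjoint]
      · congr 1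
        ext v
        have : v ∈ W ↔ v ∈ A ∨ v ∈ B := by rw [← hS.1, Finset.mem_union]
        simp only [Finset.mem_sdiff, Finset.mem_union, this]
        have := @hXA v
        tauto
      · rw [Finset.disjoint_left]; intro v hv hv'
        exact (Finset.mem_sdiff.1 hv').2 (Finset.mem_sdiff.1 hv).1
    rw [h4] at h1
    nlinarith
  · by_contra hcon
    push Not at hcon
    obtain ⟨A', B', hS', hXA', hlt', hbig, hne', hmas⟩ := exists_massed_of_violation hcon
    have hB'A : B' ⊆ A := hS'.subset_right
    have hGle : ∀ x ∈ A, ∀ y ∈ A, G.Adj x y → (addClique G (A ∩ B)).Adj x y := fun _ _ _ _ => Or.inl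
    by_cases hZA : A ∩ B ⊆ A'
    · have hS2 : Sep G W (B ∪ A') B' ∧ _ := hS.symm.extend_right (hS'.mono hGle)
        (by rwa [Finset.inter_comm])
      obtain ⟨e1, e2, e3⟩ := hS2
      have := hm.2.2 _ _ e1 (hXA'.trans Finset.subset_union_right) (by rw [e2]; exact hlt')
      rw [e3] at this
      refine absurd (hbig.trans_le (Finset.card_le_card ?_)) (not_lt.2 this)
      refine incid_mono hS.subset_left subset_rfl fun x _ y _ hxy h => h.elim id fun h => ?_
      rcases hxy with hx | hx
      · exact absurd (hZA h.2.1) (Finset.mem_sdiff.1 hx).2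
      · exact absurd (hZA h.2.2) (Finset.mem_sdiff.1 hx).2
    -- A separation cannot split a clique, so `A ∩ B` lies in `B'`. Then `B' ∪ B` is again a linked
    -- far side, and its near side `A'` is smaller than `A`.
    · have hZB : A ∩ B ⊆ B' := by
        intro z hz
        by_contra hzB
        obtain ⟨y, hy, hyA⟩ := Finset.not_subset.1 hZA
        have hzA : z ∈ A' := (hS'.mem_or (Finset.mem_inter.1 hz).1).resolve_right hzB
        have hyB : y ∈ B' := (hS'.mem_or (Finset.mem_inter.1 hy).1).resolve_left hyA
        exact hS'.2 z hzA y hyB hzB hyA (Or.inr ⟨fun e => hzB (e ▸ hyB), hz, hy⟩)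
      obtain ⟨e1, e2, e3⟩ := hS.extend_left (hS'.mono hGle) hZB
      have hlB : Linked (addClique G (A ∩ B)) B' (A' ∩ B') :=
        IH _ _ _ ((Finset.card_le_card hB'A).trans_lt hAW) (by omega) hmas
      have hA'A : A'.card < A.card := by
        apply Finset.card_lt_card
        refine ⟨hS'.subset_left, fun hle => ?_⟩
        obtain ⟨v, hv⟩ := hne'
        rw [Finset.mem_sdiff] at hv
        exact hv.2 (hle (hB'A hv.1))
      refine ih A'.card (hn ▸ hA'A) A' rfl (B' ∪ B) e1 hXA' (by rw [e2]; exact hlt') ?_ ?_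
      · exact hne'.mono (Finset.sdiff_subset_sdiff Finset.subset_union_left subset_rfl)
      · rw [e2]
        refine Linked.lift (by rwa [e3]) (by rwa [e3])

variable [Finite V]

/-- There is no separation of order at least `|X|` whose far side is highly linked. -/
theorem Massed.no_linked_side (IH : LinkedBelow V t W.card) (hX : X.card ≤ 2 * t) (hm : Massed t G W X)
    (hnl : ¬ Linked G W X) (hS : Sep G W A B) (hXA : X ⊆ A) (hge : X.card ≤ (A ∩ B).card)
    (hlink : ∀ T ⊆ A ∩ B, T.card ≤ X.card → Linked G B T) : False := by
  rcases menger G A X (A ∩ B) hXA Finset.inter_subset_left with ⟨C, f, hL⟩ | hfail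
  · apply hnl
    rw [← hS.1]
    refine Linked.compose hL (hlink _ ?_ Finset.card_image_le)
    intro y hy
    obtain ⟨x, hx, rfl⟩ := Finset.mem_image.1 hy
    exact (hL.1 x hx).1
  · have hex : ∃ n, ∃ A1 B1, (A1 ∩ B1).card = n ∧ Sep G A A1 B1 ∧ X ⊆ A1 ∧ A ∩ B ⊆ B1 ∧
        (A1 ∩ B1).card < X.card := by
      obtain ⟨A1, B1, h⟩ := hfail; exact ⟨_, A1, B1, rfl, h⟩
    -- A separation of least order between `X` and `A ∩ B` in `G[A]`. By Menger its separator is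
    -- joined to `A ∩ B`, so the separator is linked in the far side `B1 ∪ B`, against
    -- `Massed.no_rigid`.
    obtain ⟨A1, B1, hn, hS1, hXA1, hZ1, hlt1⟩ := Nat.find_spec hex
    have hmin := fun m hm => Nat.find_min hex (m := m) hm
    rw [← hn] at hmin
    obtain ⟨e1, e2, e3⟩ := hS.extend_left hS1 hZ1
    have hne : ((B1 ∪ B) \ A1).Nonempty := by
      by_contra hcon
      rw [Finset.not_nonempty_iff_eq_empty, Finset.sdiff_eq_empty_iff_subset] at hcon
      have : A ∩ B ⊆ A1 ∩ B1 := fun z hz => Finset.mem_inter.2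
        ⟨hcon (Finset.mem_union_right _ (Finset.mem_inter.1 hz).2), hZ1 hz⟩
      have := Finset.card_le_card this
      omega
    rcases menger G B1 (A1 ∩ B1) (A ∩ B) Finset.inter_subset_right hZ1 with ⟨C, f, hL⟩ | ⟨A2, B2, h2⟩
    · refine hm.no_rigid IH hX hnl A1 (B1 ∪ B) e1 hXA1 (by rwa [e2]) hne ?_
      rw [e2]
      rw [← e3] at hL
      refine Linked.compose hL (hlink _ ?_ (Finset.card_image_le.trans hlt1.le))
      intro y hy
      obtain ⟨x, hx, rfl⟩ := Finset.mem_image.1 hy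
      exact e3 ▸ (hL.1 x hx).1
    · obtain ⟨hS2, ha, hb, hc⟩ := h2
      obtain ⟨f1, f2, f3⟩ := hS1.extend_right hS2 ha
      exact hmin _ hc ⟨A1 ∪ A2, B2, by rw [f2], f1, hXA1.trans Finset.subset_union_left, hb,
        by rw [f2]; omega⟩

/-- There is no separation of order at most `|X|` with a dense far side. -/
theorem Massed.no_dense_side (IH : LinkedBelow V t W.card) (hX : X.card ≤ 2 * t) (hm : Massed t G W X)
    (hnl : ¬ Linked G W X) (hS : Sep G W A B) (hXA : X ⊆ A) (hle : (A ∩ B).card ≤ X.card)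
    (hne : (A \ B).Nonempty) : (incid G W (B \ A)).card ≤ 12 * t * (B \ A).card := by
  rcases hle.lt_or_eq with hlt | heq
  · exact hm.2.2 A B hS hXA hlt
  by_contra hbig
  push Not at hbig
  -- At order exactly `|X|` a dense far side is itself a smaller massed pair.
  have hlB : Linked G B (A ∩ B) := by
    refine IH _ _ _ ?_ (by omega) ⟨Finset.inter_subset_right, ?_, ?_⟩
    · apply Finset.card_lt_card
      refine ⟨hS.subset_right, fun hle => ?_⟩
      obtain ⟨v, hv⟩ := hne
      rw [Finset.mem_sdiff] at hv
      exact hv.2 (hle (hS.subset_left hv.1))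
    · have : B \ (A ∩ B) = B \ A := by ext v; simp
      rw [this]
      exact hbig.trans_le (Finset.card_le_card (hS.incid_sdiff fun _ _ _ _ _ h => h))
    · intro A2 B2 hS2 hA2 hlt2
      obtain ⟨e1, e2, e3⟩ := hS.extend_right hS2 hA2
      have := hm.2.2 _ _ e1 (hXA.trans Finset.subset_union_left) (by rw [e2]; omega)
      rw [e3] at this
      exact (Finset.card_le_card (incid_mono hS.subset_right subset_rfl fun _ _ _ _ _ h => h)).trans this
  exact hm.no_linked_side IH hX hnl hS hXA heq.ge fun T hT _ =>
    hlB.mono subset_rfl hT fun _ _ _ _ h => h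

end Massed

/-! ### Deleting and contracting edges of a minimal counterexample. -/

section Massed
open scoped Classical
variable {V : Type*} {G H : SimpleGraph V} {W W' X A B S T : Finset V} {t : ℕ}

/-- Contraction of `v` into `u`; the vertex `v` becomes isolated. -/
def contract (G : SimpleGraph V) (u v : V) : SimpleGraph V where
  Adj a b := a ≠ b ∧ a ≠ v ∧ b ≠ v ∧ (G.Adj a b ∨ (a = u ∧ G.Adj v b) ∨ (b = u ∧ G.Adj a v))
  symm := ⟨fun _ _ h => ⟨h.1.symm, h.2.2.1, h.2.1, h.2.2.2.elim (fun h => Or.inl h.symm)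
    fun h => Or.inr (h.symm.imp (fun h => ⟨h.1, h.2.symm⟩) fun h => ⟨h.1, h.2.symm⟩)⟩⟩
  loopless := ⟨fun _ h => h.1 rfl⟩

/-- An edge at `u` that stems from an edge at `v` is replaced by a detour through `uv`. -/
theorem Conn.of_contract {u v : V} (huv : G.Adj u v) {C : Finset V} {a b : V}
    (h : Conn (contract G u v) C a b) : Conn G (if u ∈ C then insert v C else C) a b := by
  obtain ⟨w, hw⟩ := h
  have hsub : C ⊆ if u ∈ C then insert v C else C := by
    split_ifs
    · exact Finset.subset_insert _ _
    · exact subset_rfl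
  induction w with
  | nil => exact Conn.refl (hsub (hw _ (by simp)))
  | @cons x y z hxy p ih =>
    simp only [SimpleGraph.Walk.support_cons, List.mem_cons, forall_eq_or_imp] at hw
    have hy := hw.2 y p.start_mem_support
    refine Conn.trans ?_ (ih hw.2)
    obtain ⟨-, -, -, h | ⟨rfl, h⟩ | ⟨rfl, h⟩⟩ := hxy
    · exact Conn.adj h (hsub hw.1) (hsub hy)
    · have hv : v ∈ if x ∈ C then insert v C else C := by simp [hw.1]
      exact (Conn.adj huv (hsub hw.1) hv).trans (Conn.adj h hv (hsub hy))
    · have hv : v ∈ if y ∈ C then insert v C else C := by simp [hy]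
      exact (Conn.adj h (hsub hw.1) hv).trans (Conn.adj huv.symm hv (hsub hy))

/-- At most one of the disjoint connections contains `u`, and only that one receives `v`. -/
theorem Linked.of_contract {u v : V} (huv : G.Adj u v) (hvW : v ∉ W)
    (h : Linked (contract G u v) W X) : Linked G (insert v W) X := by
  intro M hM hd
  obtain ⟨C, h1, h2⟩ := h M hM hd
  refine ⟨fun p => if u ∈ C p then insert v (C p) else C p, fun p hp => ⟨?_, (h1 p hp).2.of_contract huv⟩,
    fun p hp q hq hpq => ?_⟩
  · have := (h1 p hp).1
    dsimp only
    split_ifs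
    · exact Finset.insert_subset_insert _ this
    · exact this.trans (Finset.subset_insert _ _)
  · have hdis := h2 p hp q hq hpq
    have hvp : v ∉ C p := fun h => hvW ((h1 p hp).1 h)
    have hvq : v ∉ C q := fun h => hvW ((h1 q hq).1 h)
    dsimp only
    split_ifs with hp' hq' hq'
    · exact absurd hq' (Finset.disjoint_left.1 hdis hp')
    · rw [Finset.disjoint_insert_left]; exact ⟨hvq, hdis⟩
    · rw [Finset.disjoint_insert_right]; exact ⟨hvp, hdis⟩
    · exact hdis

/-- An edge `uz` of the contraction that is not in `G` is charged to `vz`; since `u ∉ S`, it was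
counted because of `z`. -/
theorem card_incid_contract_le {u v : V} (hv : v ∈ W)
    (hW : W' ⊆ W) (huS : u ∉ S) : (incid (contract G u v) W' S).card ≤ (incid G W S).card := by
  refine Finset.card_le_card_of_injOn
    (fun p => if G.Adj p.1 p.2 then p else if p.2 = u then (p.1, v) else (v, p.2)) ?_ ?_
  · intro p hp
    rw [Finset.mem_coe, mem_incid] at hp
    rw [Finset.mem_coe]
    obtain ⟨h1, h2, ⟨h3, h4, h5, h6⟩, h7⟩ := hp
    dsimp only
    split_ifs with ha hb
    · exact mem_incid.2 ⟨hW h1, hW h2, ha, h7⟩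
    · rcases h6 with h6 | ⟨h6, h6'⟩ | ⟨h6, h6'⟩
      · exact absurd h6 ha
      · exact absurd (h6.trans hb.symm) h3
      · exact mem_incid.2 ⟨hW h1, hv, h6', h7.imp_right fun h => absurd (hb ▸ h) huS⟩
    · rcases h6 with h6 | ⟨h6, h6'⟩ | ⟨h6, h6'⟩
      · exact absurd h6 ha
      · exact mem_incid.2 ⟨hv, hW h2, h6', h7.imp_left fun h => absurd (h6 ▸ h) huS⟩
      · exact absurd h6 hb
  · rintro ⟨a, b⟩ hp ⟨c, d⟩ hq h
    rw [Finset.mem_coe, mem_incid] at hp hq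
    obtain ⟨h1, h2, ⟨h3, h4, h5, h6⟩, h7⟩ := hp
    obtain ⟨k1, k2, ⟨k3, k4, k5, k6⟩, k7⟩ := hq
    dsimp only at *
    split_ifs at h <;> simp only [Prod.mk.injEq] at h ⊢ <;> grind

/-- Contracting `uv` destroys this edge, merges `vz` with `uz` for each common neighbour `z`, and,
if `u ∈ X`, turns `vz` with `z ∈ X` into an edge inside `X`, which is not counted. Ordered pairs
double each loss. -/
theorem card_incid_le_contract {u v : V} (huv : G.Adj u v) (hu : u ∈ W) (hv : v ∈ W \ X) :
    (incid G W (W \ X)).card ≤ (incid (contract G u v) (W.erase v) (W.erase v \ X)).card + 2 +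
      2 * (W.filter fun z => G.Adj v z ∧ z ≠ u ∧ (G.Adj u z ∨ (u ∈ X ∧ z ∈ X))).card := by
  set D := W.filter fun z => G.Adj v z ∧ z ≠ u ∧ (G.Adj u z ∨ (u ∈ X ∧ z ∈ X)) with hD
  rw [Finset.mem_sdiff] at hv
  have huv' : u ≠ v := huv.ne
  have hsplit : (incid G W (W \ X)) ⊆ ((incid G W (W \ X)).filter fun p =>
      ¬ (p = (u, v) ∨ p = (v, u) ∨ (p.1 = v ∧ p.2 ∈ D) ∨ (p.2 = v ∧ p.1 ∈ D))) ∪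
        ({(u, v), (v, u)} ∪ (D.image (fun z => (v, z)) ∪ D.image (fun z => (z, v)))) := by
    rintro ⟨a, b⟩ hp
    simp only [Finset.mem_union, Finset.mem_filter, hp, true_and, Finset.mem_insert,
      Finset.mem_singleton, Finset.mem_image, Prod.mk.injEq]
    by_contra hcon
    push Not at hcon
    obtain ⟨c1, c2, c3, c4⟩ := hcon
    rcases c1 with h | h | ⟨rfl, h⟩ | ⟨rfl, h⟩
    · exact c2.1 h.1 h.2
    · exact c2.2 h.1 h.2
    · exact c3 b h rfl rfl
    · exact c4 a h rfl rfl
  refine (Finset.card_le_card hsplit).trans ((Finset.card_union_le _ _).trans ?_)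
  have hcard : (({(u, v), (v, u)} : Finset (V × V)) ∪
      (D.image (fun z => (v, z)) ∪ D.image (fun z => (z, v)))).card ≤ 2 + (D.card + D.card) := by
    refine (Finset.card_union_le _ _).trans (Nat.add_le_add Finset.card_le_two ?_)
    exact (Finset.card_union_le _ _).trans (Nat.add_le_add Finset.card_image_le Finset.card_image_le)
  suffices h2 : ((incid G W (W \ X)).filter fun p =>
      ¬ (p = (u, v) ∨ p = (v, u) ∨ (p.1 = v ∧ p.2 ∈ D) ∨ (p.2 = v ∧ p.1 ∈ D))).card ≤
      (incid (contract G u v) (W.erase v) (W.erase v \ X)).card by omega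
  refine Finset.card_le_card_of_injOn
    (fun p => if p.1 = v then (u, p.2) else if p.2 = v then (p.1, u) else p) ?_ ?_
  · rintro ⟨a, b⟩ hp
    rw [Finset.mem_coe, Finset.mem_filter, mem_incid] at hp
    rw [Finset.mem_coe]
    simp only [hD, Finset.mem_filter, Prod.mk.injEq, Finset.mem_sdiff] at hp
    obtain ⟨⟨h1, h2, h3, h4⟩, h5⟩ := hp
    have hne := h3.ne
    have h3' := h3.symm
    dsimp only
    split_ifs with ha hb <;> rw [mem_incid] <;> simp only [Finset.mem_erase, Finset.mem_sdiff, contract]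
    · subst ha
      refine ⟨⟨huv', hu⟩, ⟨hne.symm, h2⟩, ⟨?_, huv', hne.symm, Or.inr (Or.inl ⟨trivial, h3⟩)⟩, ?_⟩ <;> grind
    · subst hb
      refine ⟨⟨hne, h1⟩, ⟨huv', hu⟩, ⟨?_, hne, huv', Or.inr (Or.inr ⟨trivial, h3⟩)⟩, ?_⟩ <;> grind
    · exact ⟨⟨ha, h1⟩, ⟨hb, h2⟩, ⟨hne, ha, hb, Or.inl h3⟩,
        h4.imp (fun h => ⟨⟨ha, h.1⟩, h.2⟩) fun h => ⟨⟨hb, h.1⟩, h.2⟩⟩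
  · rintro ⟨a, b⟩ hp ⟨c, d⟩ hq h
    rw [Finset.mem_coe, Finset.mem_filter, mem_incid] at hp hq
    simp only [hD, Finset.mem_filter, Prod.mk.injEq, Finset.mem_sdiff] at hp hq
    obtain ⟨⟨h1, h2, h3, h4⟩, h5⟩ := hp
    obtain ⟨⟨k1, k2, k3, k4⟩, k5⟩ := hq
    have e1 := h3.ne
    have e2 := k3.ne
    have h3' := h3.symm
    have k3' := k3.symm
    dsimp only at *
    split_ifs at h <;> simp only [Prod.mk.injEq] at h ⊢ <;> grind

variable [Finite V]

/-- A massed pair that is not linked and of minimal size has few edges. -/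
theorem Massed.card_incid_le (IH : LinkedBelow V t W.card) (hX : X.card ≤ 2 * t)
    (hm : Massed t G W X) (hnl : ¬ Linked G W X)
    (IHe : ∀ G' : SimpleGraph V, G' ≤ G → (incid G' W (W \ X)).card < (incid G W (W \ X)).card →
      Massed t G' W X → Linked G' W X) :
    (incid G W (W \ X)).card ≤ 12 * t * (W \ X).card + 2 := by
  by_contra hbig
  push Not at hbig
  obtain ⟨⟨p, q⟩, hpq⟩ := Finset.card_pos.1 (lt_of_le_of_lt (Nat.zero_le _) hbig)
  have hpq' := mem_incid.1 hpq
  dsimp only at hpq'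
  obtain ⟨hp, hq, hadj, hmem⟩ := hpq'
  set G' := G.deleteEdges {s(p, q)} with hG'
  have hle : G' ≤ G := SimpleGraph.deleteEdges_le _
  have hdel : ∀ u v, G.Adj u v → ¬ G'.Adj u v → (u = p ∧ v = q) ∨ (u = q ∧ v = p) := by
    intro u v h h'
    by_contra hne
    apply h'
    rw [hG', SimpleGraph.deleteEdges_adj]
    exact ⟨h, by simpa using hne⟩
  have hnadj : ¬ G'.Adj p q := by simp [hG', SimpleGraph.deleteEdges_adj]
  have hcard : (incid G W (W \ X)).card ≤ (incid G' W (W \ X)).card + 2 := by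
    have : incid G W (W \ X) ⊆ incid G' W (W \ X) ∪ {(p, q), (q, p)} := by
      rintro ⟨a, b⟩ hab
      rw [Finset.mem_union, mem_incid]
      obtain ⟨h1, h2, h3, h4⟩ := mem_incid.1 hab
      by_cases h : G'.Adj a b
      · exact Or.inl ⟨h1, h2, h, h4⟩
      · right; simpa using hdel a b h3 h
    exact (Finset.card_le_card this).trans ((Finset.card_union_le _ _).trans
      (Nat.add_le_add_left Finset.card_le_two _))
  have hlt : (incid G' W (W \ X)).card < (incid G W (W \ X)).card := by
    apply Finset.card_lt_card
    refine ⟨incid_mono subset_rfl subset_rfl fun x _ y _ _ h => hle h, fun h => hnadj ?_⟩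
    exact (mem_incid.1 (h hpq)).2.2.1
  apply hnl
  refine (IHe G' hle hlt ⟨hm.1, by omega, ?_⟩).mono subset_rfl subset_rfl fun _ _ _ _ h => hle h
  intro A B hS hXA hlt
  by_contra hcon
  push Not at hcon
  by_cases hSG : Sep G W A B
  · refine absurd (hcon.trans_le (Finset.card_le_card ?_)) (not_lt.2 (hm.2.2 A B hSG hXA hlt))
    exact incid_mono subset_rfl subset_rfl fun x _ y _ _ h => hle h
  obtain ⟨p, q, hpA, hqB, hpB, hqA, hdel⟩ : ∃ p q, p ∈ A ∧ q ∈ B ∧ p ∉ B ∧ q ∉ A ∧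
      ∀ u v, G.Adj u v → ¬ G'.Adj u v → (u = p ∧ v = q) ∨ (u = q ∧ v = p) := by
    have : ∃ a ∈ A, ∃ b ∈ B, a ∉ B ∧ b ∉ A ∧ G.Adj a b := by
      by_contra hcon
      push Not at hcon
      exact hSG ⟨hS.1, hcon⟩
    obtain ⟨a, ha, b, hb, haB, hbA, hab⟩ := this
    rcases hdel a b hab (hS.2 a ha b hb haB hbA) with ⟨rfl, rfl⟩ | ⟨rfl, rfl⟩
    · exact ⟨a, b, ha, hb, haB, hbA, hdel⟩
    · exact ⟨a, b, ha, hb, haB, hbA, fun u v h1 h2 => (hdel u v h1 h2).symm⟩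
  -- The deleted edge crosses. With `q` in the separator the order is at most `|X|`, so
  -- `Massed.no_dense_side` applies to what remains of the far side. Only edges from `q` to `A ∩ B`
  -- drop out of the count, which are at most `4t` ordered pairs, fewer than the `12t` allotted to
  -- `q`.
  have hS' : Sep G W (insert q A) B := by
    refine ⟨?_, fun a ha b hb haB hbA h => ?_⟩
    · rw [Finset.insert_union, hS.1, Finset.insert_eq_of_mem (hS.subset_right hqB)]
    · have haq : a ≠ q := fun e => haB (e ▸ hqB)
      have haA : a ∈ A := Finset.mem_of_mem_insert_of_ne ha haq
      have hbq : b ≠ q := fun e => hbA (e ▸ Finset.mem_insert_self _ _)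
      have hbA' : b ∉ A := fun h => hbA (Finset.mem_insert_of_mem h)
      rcases hdel a b h (hS.2 a haA b hb haB hbA') with h | h
      · exact hbq h.2
      · exact haq h.1
  have hord : ((insert q A) ∩ B).card ≤ (A ∩ B).card + 1 := by
    rw [Finset.insert_inter_of_mem hqB]; exact Finset.card_insert_le _ _
  have h1 := hm.no_dense_side IH hX hnl hS' (hXA.trans (Finset.subset_insert _ _)) (by omega)
    ⟨p, by simp [hpA, hpB]⟩
  have h2 : B \ insert q A = (B \ A).erase q := by ext v; simp; tauto
  rw [h2, Finset.card_erase_of_mem (by simp [hqB, hqA])] at h1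
  have h3 : (incid G' W (B \ A)).card ≤ (incid G W ((B \ A).erase q)).card +
      ((A ∩ B).card + (A ∩ B).card) := by
    have : incid G' W (B \ A) ⊆ incid G W ((B \ A).erase q) ∪
        ((A ∩ B).image (fun z => (q, z)) ∪ (A ∩ B).image (fun z => (z, q))) := by
      intro r hr
      have hr2 := hS.incid_sdiff (fun _ _ _ _ _ h => h) hr
      obtain ⟨a, b⟩ := r
      obtain ⟨ha, hb, h3, h4⟩ := mem_incid.1 hr
      obtain ⟨k1, k2, -, -⟩ := mem_incid.1 hr2
      have h3' := hle h3
      have hne := h3.ne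
      simp only [Finset.mem_union, Finset.mem_image, Prod.mk.injEq, mem_incid, Finset.mem_erase,
        Finset.mem_sdiff, Finset.mem_inter] at *
      by_cases haq : a = q
      · subst haq
        by_cases hbA : b ∈ A
        · exact Or.inr (Or.inl ⟨b, ⟨hbA, k2⟩, rfl, rfl⟩)
        · exact Or.inl ⟨ha, hb, h3', Or.inr ⟨hne.symm, k2, hbA⟩⟩
      · by_cases hbq : b = q
        · subst hbq
          by_cases haA : a ∈ A
          · exact Or.inr (Or.inr ⟨a, ⟨haA, k1⟩, rfl, rfl⟩)
          · exact Or.inl ⟨ha, hb, h3', Or.inl ⟨hne, k1, haA⟩⟩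
        · exact Or.inl ⟨ha, hb, h3', h4.imp (fun h => ⟨haq, h⟩) fun h => ⟨hbq, h⟩⟩
    refine (Finset.card_le_card this).trans ((Finset.card_union_le _ _).trans
      (Nat.add_le_add_left ((Finset.card_union_le _ _).trans ?_) _))
    exact Nat.add_le_add Finset.card_image_le Finset.card_image_le
  have h4 : 0 < (B \ A).card := Finset.card_pos.2 ⟨q, by simp [hqB, hqA]⟩
  obtain ⟨m, hm'⟩ : ∃ m, (B \ A).card = m + 1 := ⟨_, (Nat.succ_pred_eq_of_pos h4).symm⟩
  rw [hm'] at h1 hcon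
  simp only [Nat.add_sub_cancel] at h1
  rw [Nat.mul_add] at hcon
  omega

/-- In a massed pair that is not linked and of minimal size, every edge lies in many triangles. -/
theorem Massed.le_card_common (IH : LinkedBelow V t W.card) (hX : X.card ≤ 2 * t)
    (hm : Massed t G W X) (hnl : ¬ Linked G W X) {u v : V} (hu : u ∈ W) (hv : v ∈ W \ X)
    (huv : G.Adj u v) :
    6 * t ≤ (W.filter fun z => G.Adj v z ∧ z ≠ u ∧ (G.Adj u z ∨ (u ∈ X ∧ z ∈ X))).card := by
  have hvW := (Finset.mem_sdiff.1 hv).1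
  have hvX := (Finset.mem_sdiff.1 hv).2
  have hXe : X ⊆ W.erase v := fun x hx => Finset.mem_erase.2 ⟨fun e => hvX (e ▸ hx), hm.1 hx⟩
  have hins : insert v (W.erase v) = W := Finset.insert_erase hvW
  have hnl' : ¬ Linked (contract G u v) (W.erase v) X := fun h =>
    hnl (hins ▸ h.of_contract huv (by simp))
  have hWlt : (W.erase v).card < W.card := Finset.card_erase_lt_of_mem hvW
  have hnm : ¬ Massed t (contract G u v) (W.erase v) X := fun h => hnl' (IH _ _ _ hWlt hX h)
  -- The contraction inherits the separation condition. In a violation, `v` is put back next to `u`: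
  -- on both sides this contradicts `Massed.no_dense_side`, on the near side `hm`, on the far side
  -- `Massed.no_rigid`.
  have hM2 : ∀ A B, Sep (contract G u v) (W.erase v) A B → X ⊆ A → (A ∩ B).card < X.card →
      (incid (contract G u v) (W.erase v) (B \ A)).card ≤ 12 * t * (B \ A).card := by
    by_contra hcon
    push Not at hcon
    obtain ⟨A, B, hS, hXA, hlt, hbig, hne, hmas⟩ := exists_massed_of_violation hcon
    have hvA : v ∉ A := fun h => by simpa using hS.subset_left h
    have hvB : v ∉ B := fun h => by simpa using hS.subset_right h
    have hun : A ∪ B = W.erase v := hS.1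
    have hadj : ∀ a ∈ A, ∀ b ∈ B, a ∉ B → b ∉ A → ¬ G.Adj a b := fun a ha b hb haB hbA h =>
      hS.2 a ha b hb haB hbA ⟨h.ne, fun e => hvA (e ▸ ha), fun e => hvB (e ▸ hb), Or.inl h⟩
    have hinc : u ∉ B \ A → 12 * t * (B \ A).card < (incid G W (B \ A)).card := fun h =>
      hbig.trans_le (card_incid_contract_le hvW (Finset.erase_subset _ _) h)
    have huvne : u ≠ v := huv.ne
    by_cases huA : u ∈ A
    · by_cases huB : u ∈ B
      · have hS' : Sep G W (insert v A) (insert v B) := by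
          refine ⟨by rw [← Finset.insert_union_distrib, hun, hins], fun a ha b hb haB hbA => ?_⟩
          simp only [Finset.mem_insert, not_or] at ha hb haB hbA
          exact hadj a (ha.resolve_left haB.1) b (hb.resolve_left hbA.1) haB.2 hbA.2
        have e : insert v B \ insert v A = B \ A := by
          ext z; simp only [Finset.mem_sdiff, Finset.mem_insert, not_or]
          constructor
          · rintro ⟨h1, h2, h3⟩; exact ⟨h1.resolve_left h2, h3⟩
          · rintro ⟨h1, h2⟩; exact ⟨Or.inr h1, fun e => hvB (e ▸ h1), h2⟩
        have := hm.no_dense_side IH hX hnl hS' (hXA.trans (Finset.subset_insert _ _)) ?_ ?_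
        · rw [e] at this
          exact absurd (hinc (by simp [huA])) (not_lt.2 this)
        · rw [← Finset.insert_inter_distrib]
          exact (Finset.card_insert_le _ _).trans hlt
        · by_contra hcon
          rw [Finset.not_nonempty_iff_eq_empty, Finset.sdiff_eq_empty_iff_subset] at hcon
          have : A ⊆ A ∩ B := fun z hz => Finset.mem_inter.2 ⟨hz, (Finset.mem_insert.1
            (hcon (Finset.mem_insert_of_mem hz))).resolve_left fun e => hvA (e ▸ hz)⟩
          have h1 := Finset.card_le_card (hXA.trans this)
          omega
      · have hS' : Sep G W (insert v A) B := by
          refine ⟨by rw [Finset.insert_union, hun, hins], fun a ha b hb haB hbA h => ?_⟩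
          simp only [Finset.mem_insert, not_or] at ha hbA
          rcases ha with rfl | ha
          · exact hS.2 u huA b hb huB hbA.2 ⟨fun e => huB (e ▸ hb), huvne, hbA.1,
              Or.inr (Or.inl ⟨rfl, h⟩)⟩
          · exact hadj a ha b hb haB hbA.2 h
        have e : B \ insert v A = B \ A := by
          ext z; simp only [Finset.mem_sdiff, Finset.mem_insert, not_or]
          exact ⟨fun h => ⟨h.1, h.2.2⟩, fun h => ⟨h.1, fun e => hvB (e ▸ h.1), h.2⟩⟩
        have := hm.2.2 _ _ hS' (hXA.trans (Finset.subset_insert _ _))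
          (by rwa [Finset.insert_inter_of_notMem hvB])
        rw [e] at this
        exact absurd (hinc (by simp [huA])) (not_lt.2 this)
    · have huB : u ∈ B := (hS.mem_or (Finset.mem_erase.2 ⟨huvne, hu⟩)).resolve_left huA
      have hlB : Linked (contract G u v) B (A ∩ B) :=
        IH _ _ _ ((Finset.card_le_card hS.subset_right).trans_lt hWlt) (by omega) hmas
      have hS' : Sep G W A (insert v B) := by
        refine ⟨by rw [Finset.union_insert, hun, hins], fun a ha b hb haB hbA h => ?_⟩
        simp only [Finset.mem_insert, not_or] at hb haB
        rcases hb with rfl | hb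
        · exact hS.2 a ha u huB haB.2 huA ⟨fun e => haB.2 (e ▸ huB), haB.1, huvne,
            Or.inr (Or.inr ⟨rfl, h⟩)⟩
        · exact hadj a ha b hb haB.2 hbA h
      have e : A ∩ insert v B = A ∩ B := Finset.inter_insert_of_notMem hvA
      refine hm.no_rigid IH hX hnl A (insert v B) hS' hXA (by rwa [e]) ⟨v, by simp [hvA]⟩ ?_
      rw [e]
      exact hlB.of_contract huv hvB
  -- So the contraction must fail the density condition. At least `12t + 1` ordered pairs were lost,
  -- two of them at `uv` and two for each `z`.
  have h1 := card_incid_le_contract huv hu hv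
  have h2 : ¬ 12 * t * (W.erase v \ X).card <
      (incid (contract G u v) (W.erase v) (W.erase v \ X)).card := fun h => hnm ⟨hXe, h, hM2⟩
  have h3 : W.erase v \ X = (W \ X).erase v := by ext z; simp; tauto
  rw [h3, Finset.card_erase_of_mem hv] at h2
  have h4 := hm.2.1
  have h5 : 0 < (W \ X).card := Finset.card_pos.2 ⟨v, hv⟩
  obtain ⟨m, hm'⟩ : ∃ m, (W \ X).card = m + 1 := ⟨_, (Nat.succ_pred_eq_of_pos h5).symm⟩
  rw [hm'] at h2 h4
  simp only [Nat.add_sub_cancel] at h2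
  rw [← h3] at h2
  rw [Nat.mul_add] at h4
  omega

end Massed

/-! ### The linkage theorem, given linked sets in small dense sets. -/

section Massed
open scoped Classical
variable {V : Type*} {G H : SimpleGraph V} {W W' X A B S T : Finset V} {t : ℕ}

/-- Small sets with a large minimum degree contain a highly linked set. -/
def DenseSetsContainLinked (V : Type*) (t : ℕ) : Prop :=
  ∀ (G : SimpleGraph V) (U : Finset V), U.Nonempty → U.card ≤ 12 * t + 1 →
    (∀ v ∈ U, 6 * t ≤ (U.filter (G.Adj v)).card) →
    ∃ K ⊆ U, 2 * t ≤ K.card ∧ ∀ T ⊆ K, T.card ≤ 2 * t → Linked G K T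

/-- If all these degrees were larger, averaging would give `|W \ X| ≤ 2`, and then `W` would be too
small to have such degrees. -/
theorem exists_card_neighbors_le (ht : 1 ≤ t) (hX : X.card ≤ 2 * t) (hXW : X ⊆ W)
    (hne : (W \ X).Nonempty) (h : (incid G W (W \ X)).card ≤ 12 * t * (W \ X).card + 2) :
    ∃ v ∈ W \ X, (W.filter (G.Adj v)).card ≤ 12 * t := by
  by_contra hcon
  push Not at hcon
  have h1 := sum_card_neighbors_le (G := G) (Finset.sdiff_subset (s := W) (t := X))
  have h2 : (W \ X).card * (12 * t + 1) ≤ ∑ v ∈ W \ X, (W.filter (G.Adj v)).card := by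
    rw [← smul_eq_mul]
    exact Finset.card_nsmul_le_sum _ _ _ fun v hv => hcon v hv
  obtain ⟨v, hv⟩ := hne
  have h3 := hcon v hv
  have h4 : (W.filter (G.Adj v)).card < W.card := by
    apply Finset.card_lt_card
    refine ⟨Finset.filter_subset _ _, fun h => ?_⟩
    exact G.loopless.irrefl v (Finset.mem_filter.1 (h (Finset.mem_sdiff.1 hv).1)).2
  have h5 : (W \ X).card + X.card = W.card := Finset.card_sdiff_add_card_eq_card hXW
  have h6 : (W \ X).card ≤ 2 := by nlinarith
  omega

/-- The graph obtained from `G` by joining all vertices of `X` that are not paired by `M`. -/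
def joinUnpaired (G : SimpleGraph V) (X : Finset V) (M : Finset (V × V)) : SimpleGraph V where
  Adj a b := G.Adj a b ∨ (a ≠ b ∧ a ∈ X ∧ b ∈ X ∧ (a, b) ∉ M ∧ (b, a) ∉ M)
  symm := ⟨fun _ _ h => h.elim (fun h => Or.inl h.symm)
    fun h => Or.inr ⟨h.1.symm, h.2.2.1, h.2.1, h.2.2.2.2, h.2.2.2.1⟩⟩
  loopless := ⟨fun a h => h.elim (fun h => G.loopless.irrefl a h) fun h => h.1 rfl⟩

/-- Every vertex of `X` belongs to the connection of its own pair, so a connection meets `X` only in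
its two ends and cannot use an added edge. -/
theorem Linkable.of_joinUnpaired {M : Finset (V × V)}
    (hfull : ∀ x ∈ X, ∃ p ∈ M, x = p.1 ∨ x = p.2) (h : Linkable (joinUnpaired G X M) W M) :
    Linkable G W M := by
  obtain ⟨C, h1, h2⟩ := h
  refine ⟨C, fun p hp => ⟨(h1 p hp).1, (h1 p hp).2.mono subset_rfl fun x y hx hy hxy => ?_⟩, h2⟩
  refine hxy.elim id fun ⟨hne, hxX, hyX, hn1, hn2⟩ => ?_
  have key : ∀ z ∈ X, z ∈ C p → z = p.1 ∨ z = p.2 := by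
    intro z hzX hzC
    obtain ⟨q, hq, hzq⟩ := hfull z hzX
    have hzq' : z ∈ C q := by
      rcases hzq with rfl | rfl
      exacts [(h1 q hq).2.left, (h1 q hq).2.right]
    have : p = q := by
      by_contra hpq
      exact Finset.disjoint_left.1 (h2 p hp q hq hpq) hzC hzq'
    rwa [this]
  rcases key x hxX hx with rfl | rfl <;> rcases key y hyX hy with rfl | rfl
  · exact absurd rfl hne
  · exact absurd hp hn1
  · exact absurd hp hn2
  · exact absurd rfl hne

/-- A separation of the larger graph is one of `G`, and edges inside `X` are never counted. -/
theorem Massed.join_unpaired {M : Finset (V × V)} (h : Massed t G W X) :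
    Massed t (joinUnpaired G X M) W X := by
  have hle : ∀ x ∈ W, ∀ y ∈ W, G.Adj x y → (joinUnpaired G X M).Adj x y :=
    fun _ _ _ _ h => Or.inl h
  refine ⟨h.1, h.2.1.trans_le (Finset.card_le_card (incid_mono subset_rfl subset_rfl
    fun x hx y hy _ => hle x hx y hy)), fun A B hS hXA hlt => ?_⟩
  refine le_trans (Finset.card_le_card ?_) (h.2.2 A B (hS.mono hle) hXA hlt)
  refine incid_mono subset_rfl subset_rfl fun x _ y _ hxy hadj => hadj.elim id fun h => ?_
  rcases hxy with hx | hx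
  · exact absurd (hXA h.2.1) (Finset.mem_sdiff.1 hx).2
  · exact absurd (hXA h.2.2.1) (Finset.mem_sdiff.1 hx).2

variable [Finite V]

/-- Core of the induction: a minimal counterexample in which `X` induces almost a clique. -/
theorem Massed.false_of_minimal (hD : DenseSetsContainLinked V t) (ht : 1 ≤ t)
    (IH : LinkedBelow V t W.card) (hX : X.card ≤ 2 * t)
    (hm : Massed t G W X) (hnl : ¬ Linked G W X)
    (IHe : ∀ G' : SimpleGraph V, G' ≤ G → (incid G' W (W \ X)).card < (incid G W (W \ X)).card →
      Massed t G' W X → Linked G' W X)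
    (hcl : ∀ u ∈ X, ∃ u', ∀ z ∈ X, z ≠ u → z ≠ u' → G.Adj u z) : False := by
  have hr := hm.card_incid_le IH hX hnl IHe
  have hne : (W \ X).Nonempty := by
    obtain ⟨p, hp⟩ := Finset.card_pos.1 (lt_of_le_of_lt (Nat.zero_le _) hm.2.1)
    rcases (mem_incid.1 hp).2.2.2 with h | h <;> exact ⟨_, h⟩
  -- The closed neighbourhood of `v` has at most `12t + 1` vertices, and the many triangles at each
  -- edge of `v` give it minimum degree at least `6t`.
  obtain ⟨v, hv, hdeg⟩ := exists_card_neighbors_le ht hX hm.1 hne hr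
  have hvW := (Finset.mem_sdiff.1 hv).1
  have hvX := (Finset.mem_sdiff.1 hv).2
  have hXe : X ⊆ W.erase v := fun x hx => Finset.mem_erase.2 ⟨fun e => hvX (e ▸ hx), hm.1 hx⟩
  -- `v` is not isolated
  have hpos : 0 < (W.filter (G.Adj v)).card := by
    by_contra hcon
    have h0 : ∀ z ∈ W, ¬ G.Adj v z := by
      simpa [Finset.filter_eq_empty_iff] using hcon
    apply hnl
    have hmas : Massed t G (W.erase v) X := by
      refine ⟨hXe, ?_, fun A B hS hXA hlt => ?_⟩
      · have h1 : incid G W (W \ X) ⊆ incid G (W.erase v) (W.erase v \ X) := by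
          intro p hp
          rw [mem_incid] at hp ⊢
          obtain ⟨h1, h2, h3, h4⟩ := hp
          have e1 : p.1 ≠ v := fun e => h0 _ h2 (e ▸ h3)
          have e2 : p.2 ≠ v := fun e => h0 _ h1 (e ▸ h3.symm)
          simp only [Finset.mem_sdiff, Finset.mem_erase] at h4 ⊢
          tauto
        refine lt_of_le_of_lt ?_ (hm.2.1.trans_le (Finset.card_le_card h1))
        exact Nat.mul_le_mul_left _ (Finset.card_le_card
          (Finset.sdiff_subset_sdiff (Finset.erase_subset _ _) subset_rfl))
      · have hvB : v ∉ B := fun h => by simpa using hS.subset_right h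
        have hS' : Sep G W (insert v A) B := by
          refine ⟨by rw [Finset.insert_union, hS.1, Finset.insert_erase hvW],
            fun a ha b hb haB hbA h => ?_⟩
          simp only [Finset.mem_insert, not_or] at ha hbA
          rcases ha with rfl | ha
          · exact h0 b (Finset.mem_of_mem_erase (hS.subset_right hb)) h
          · exact hS.2 a ha b hb haB hbA.2 h
        have e : B \ insert v A = B \ A := by
          ext z; simp only [Finset.mem_sdiff, Finset.mem_insert, not_or]
          exact ⟨fun h => ⟨h.1, h.2.2⟩, fun h => ⟨h.1, fun e => hvB (e ▸ h.1), h.2⟩⟩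
        have := hm.2.2 _ _ hS' (hXA.trans (Finset.subset_insert _ _))
          (by rwa [Finset.insert_inter_of_notMem hvB])
        rw [e] at this
        exact (Finset.card_le_card (incid_mono (Finset.erase_subset _ _) subset_rfl
          fun _ _ _ _ _ h => h)).trans this
    exact (IH G _ X (Finset.card_erase_lt_of_mem hvW) hX hmas).mono (Finset.erase_subset _ _)
      subset_rfl fun _ _ _ _ h => h
  set U := insert v (W.filter (G.Adj v)) with hU
  have hUW : U ⊆ W := Finset.insert_subset hvW (Finset.filter_subset _ _)
  have hdegU : ∀ u ∈ W.filter (G.Adj v), 6 * t ≤ (U.filter (G.Adj u)).card := by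
    intro u hu
    obtain ⟨huW, huv⟩ := Finset.mem_filter.1 hu
    have h1 := hm.le_card_common IH hX hnl huW hv huv.symm
    set D := W.filter fun z => G.Adj v z ∧ z ≠ u ∧ (G.Adj u z ∨ (u ∈ X ∧ z ∈ X)) with hDdef
    have hvD : v ∉ D := fun h => G.loopless.irrefl v (Finset.mem_filter.1 h).2.1
    have hvU : v ∈ U.filter (G.Adj u) := Finset.mem_filter.2 ⟨Finset.mem_insert_self _ _, huv.symm⟩
    by_cases huX : u ∈ X
    -- For `u ∈ X` the set `D` may contain vertices of `X` not adjacent to `u`, but by `hcl` only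
    -- `u'`; this loss is made up by `v`.
    · obtain ⟨u', hu'⟩ := hcl u huX
      have : insert v (D.erase u') ⊆ U.filter (G.Adj u) := by
        refine Finset.insert_subset hvU fun z hz => ?_
        obtain ⟨hzu', hz⟩ := Finset.mem_erase.1 hz
        obtain ⟨hzW, hvz, hzu, hz⟩ := Finset.mem_filter.1 hz
        refine Finset.mem_filter.2 ⟨Finset.mem_insert_of_mem (Finset.mem_filter.2 ⟨hzW, hvz⟩), ?_⟩
        exact hz.elim id fun h => hu' z h.2 hzu hzu'
      have h2 := Finset.card_le_card this
      rw [Finset.card_insert_of_notMem fun h => hvD (Finset.mem_of_mem_erase h)] at h2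
      have h3 := Finset.pred_card_le_card_erase (s := D) (a := u')
      omega
    · refine h1.trans (Finset.card_le_card fun z hz => ?_)
      obtain ⟨hzW, hvz, hzu, hz⟩ := Finset.mem_filter.1 hz
      exact Finset.mem_filter.2 ⟨Finset.mem_insert_of_mem (Finset.mem_filter.2 ⟨hzW, hvz⟩),
        hz.elim id fun h => absurd h.1 huX⟩
  obtain ⟨K, hKU, hK, hlink⟩ := hD G U ⟨v, Finset.mem_insert_self _ _⟩
    ((Finset.card_insert_le _ _).trans (by omega)) (by
      intro w hw
      rcases Finset.mem_insert.1 hw with rfl | hw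
      · obtain ⟨u, hu⟩ := Finset.card_pos.1 hpos
        have h1 := hdegU u hu
        have h2 : (U.filter (G.Adj u)).erase w ⊆ (W.filter (G.Adj w)).erase u := by
          intro z hz
          simp only [hU, Finset.mem_erase, Finset.mem_filter, Finset.mem_insert] at hz ⊢
          exact ⟨fun e => G.loopless.irrefl u (e ▸ hz.2.2), hz.2.1.resolve_left hz.1⟩
        have h3 := Finset.card_le_card h2
        rw [Finset.card_erase_of_mem hu] at h3
        have h4 := Finset.pred_card_le_card_erase (s := U.filter (G.Adj u)) (a := w)
        refine le_trans ?_ (Finset.card_le_card (s := W.filter (G.Adj w)) fun z hz => ?_)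
        · omega
        · obtain ⟨a, b⟩ := Finset.mem_filter.1 hz
          exact Finset.mem_filter.2 ⟨Finset.mem_insert_of_mem hz, b⟩
      · exact hdegU w hw)
  have hKW := hKU.trans hUW
  have hWK : W ∩ K = K := Finset.inter_eq_right.2 hKW
  -- The separator of the separation `(W, K)` is all of `K`.
  refine hm.no_linked_side IH hX hnl (A := W) (B := K) ⟨Finset.union_eq_left.2 hKW,
    fun a _ b hb _ hbW => absurd (hKW hb) hbW⟩ hm.1 (by rw [hWK]; omega) fun T hT hTc =>
      hlink T (hWK ▸ hT) (by omega)

/-- Massed pairs are linked. -/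
theorem Massed.linked (hD : DenseSetsContainLinked V t) (ht : 1 ≤ t) :
    ∀ (n : ℕ) (G : SimpleGraph V) (W X : Finset V), W.card = n → X.card ≤ 2 * t → Massed t G W X →
      Linked G W X := by
  intro n
  induction n using Nat.strong_induction_on with
  | _ n IHn =>
  intro G W X hn hX hm
  have IH : LinkedBelow V t W.card := fun G' W' X' h => IHn W'.card (hn ▸ h) G' W' X' rfl
  clear IHn
  -- After `|W|`, the number of counted pairs is minimised; this is what bounds the density from
  -- above.
  induction hr : (incid G W (W \ X)).card using Nat.strong_induction_on generalizing G with
  | _ r IHr =>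
  intro M hM hd
  by_contra hcon
  -- add singletons so that every vertex of `X` is covered
  set N := M ∪ (X.filter fun x => ∀ p ∈ M, x ≠ p.1 ∧ x ≠ p.2).image fun x => (x, x) with hN
  have hMN : M ⊆ N := Finset.subset_union_left
  have hmemN : ∀ p, p ∈ N ↔ p ∈ M ∨ (p.1 ∈ X ∧ p.1 = p.2 ∧ ∀ q ∈ M, p.1 ≠ q.1 ∧ p.1 ≠ q.2) := by
    rintro ⟨a, b⟩
    simp only [hN, Finset.mem_union, Finset.mem_image, Finset.mem_filter, Prod.mk.injEq]
    refine or_congr_right ⟨?_, ?_⟩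
    · rintro ⟨x, ⟨h1, h2⟩, rfl, rfl⟩; exact ⟨h1, rfl, h2⟩
    · rintro ⟨h1, rfl, h2⟩; exact ⟨a, ⟨h1, h2⟩, rfl, rfl⟩
  have hNX : ∀ p ∈ N, p.1 ∈ X ∧ p.2 ∈ X := by
    intro p hp
    rcases (hmemN p).1 hp with h | ⟨h1, h2, -⟩
    · exact hM p h
    · exact ⟨h1, h2 ▸ h1⟩
  have hNd : DisjointPairs N := by
    intro p hp q hq hpq
    rcases (hmemN p).1 hp with h | ⟨h1, h2, h3⟩ <;> rcases (hmemN q).1 hq with k | ⟨k1, k2, k3⟩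
    · exact hd p h q k hpq
    · have := k3 p h
      rw [← k2]
      exact ⟨this.1.symm, this.1.symm, this.2.symm, this.2.symm⟩
    · have := h3 q k
      rw [← h2]
      exact ⟨this.1, this.2, this.1, this.2⟩
    · have : p.1 ≠ q.1 := fun e => hpq (Prod.ext e (by rw [← h2, ← k2, e]))
      rw [← h2, ← k2]
      exact ⟨this, this, this, this⟩
  have hfull : ∀ x ∈ X, ∃ p ∈ N, x = p.1 ∨ x = p.2 := by
    intro x hx
    by_cases h : ∀ p ∈ M, x ≠ p.1 ∧ x ≠ p.2
    · exact ⟨(x, x), (hmemN _).2 (Or.inr ⟨hx, rfl, h⟩), Or.inl rfl⟩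
    · push Not at h
      obtain ⟨p, hp, h⟩ := h
      refine ⟨p, hMN hp, ?_⟩
      by_cases e : x = p.1
      · exact Or.inl e
      · exact Or.inr (h e)
  have hnN : ¬ Linkable G W N := fun ⟨C, h1, h2⟩ =>
    hcon ⟨C, fun p hp => h1 p (hMN hp), fun p hp q hq => h2 p (hMN hp) q (hMN hq)⟩
  have hnl : ¬ Linked (joinUnpaired G X N) W X := fun h =>
    hnN ((h N hNX hNd).of_joinUnpaired hfull)
  have hr' : (incid (joinUnpaired G X N) W (W \ X)).card = r := by
    rw [← hr]
    congr 1
    refine subset_antisymm (incid_mono subset_rfl subset_rfl fun x _ y _ hxy h => ?_)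
      (incid_mono subset_rfl subset_rfl fun x _ y _ _ h => Or.inl h)
    refine h.elim id fun h => ?_
    rcases hxy with hx | hx
    · exact absurd h.2.1 (Finset.mem_sdiff.1 hx).2
    · exact absurd h.2.2.1 (Finset.mem_sdiff.1 hx).2
  refine hm.join_unpaired.false_of_minimal hD ht IH hX hnl (fun G' _ hlt hm' => ?_) fun u hu => ?_
  · rw [hr'] at hlt
    exact IHr _ hlt G' hm' rfl
  · obtain ⟨p, hp, hup⟩ := hfull u hu
    refine ⟨if u = p.1 then p.2 else p.1, fun z hz hzu hzu' => Or.inr ⟨hzu.symm, hu, hz, ?_, ?_⟩⟩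
    · intro hmem
      by_cases e : (u, z) = p
      · rw [← e] at hzu'; simp at hzu'
      · have := hNd _ hmem p hp e
        exact hup.elim this.1 this.2.1
    · intro hmem
      by_cases e : (z, u) = p
      · rw [← e] at hzu'
        by_cases e' : u = z
        · exact hzu e'.symm
        · simp [e'] at hzu'
      · have := hNd _ hmem p hp e
        exact hup.elim this.2.2.1 this.2.2.2

end Massed

/-! ### Linking by paths of length two; unlinkable systems of pairs. -/

section Dense
open scoped Classical
variable {V : Type*} {G : SimpleGraph V} {K T U : Finset V} {t : ℕ}

theorem card_nonadj_le {δ : ℕ} {v : V} (hv : v ∈ K) (h : δ ≤ (K.filter (G.Adj v)).card) :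
    (K.filter fun z => z ≠ v ∧ ¬ G.Adj v z).card + δ + 1 ≤ K.card := by
  have h1 : (K.filter fun z => z ≠ v ∧ ¬ G.Adj v z) ∪ K.filter (G.Adj v) ⊆ K.erase v := by
    intro z hz
    simp only [Finset.mem_union, Finset.mem_filter, Finset.mem_erase] at hz ⊢
    rcases hz with hz | hz
    · exact ⟨hz.2.1, hz.1⟩
    · exact ⟨hz.2.ne', hz.1⟩
  have h2 := Finset.card_le_card h1
  rw [Finset.card_union_of_disjoint (Finset.disjoint_filter.2 fun z _ h => h.2),
    Finset.card_erase_of_mem hv] at h2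
  have := Finset.card_pos.2 ⟨v, hv⟩
  omega

theorem DisjointPairs.two_mul_card_le {M : Finset (V × V)} (hd : DisjointPairs M)
    (hM : ∀ p ∈ M, p.1 ∈ T ∧ p.2 ∈ T) (hne : ∀ p ∈ M, p.1 ≠ p.2) : 2 * M.card ≤ T.card := by
  have h1 : (M.image Prod.fst).card = M.card := Finset.card_image_of_injOn fun p hp q hq h => by
    by_contra hpq; exact (hd p hp q hq hpq).1 h
  have h2 : (M.image Prod.snd).card = M.card := Finset.card_image_of_injOn fun p hp q hq h => by
    by_contra hpq; exact (hd p hp q hq hpq).2.2.2 h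
  have h3 : Disjoint (M.image Prod.fst) (M.image Prod.snd) := by
    rw [Finset.disjoint_left]
    intro z hz hz'
    obtain ⟨p, hp, rfl⟩ := Finset.mem_image.1 hz
    obtain ⟨q, hq, hpq⟩ := Finset.mem_image.1 hz'
    by_cases e : p = q
    · subst e; exact hne p hp hpq.symm
    · exact (hd p hp q hq e).2.1 hpq.symm
  have h4 : M.image Prod.fst ∪ M.image Prod.snd ⊆ T := by
    intro z hz
    rcases Finset.mem_union.1 hz with hz | hz <;> obtain ⟨p, hp, rfl⟩ := Finset.mem_image.1 hz
    exacts [(hM p hp).1, (hM p hp).2]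
  have h5 := Finset.card_le_card h4
  rw [Finset.card_union_of_disjoint h3, h1, h2] at h5
  omega

/-- A set with large minimum degree is linked, by paths of length two. -/
theorem linked_of_minDegree {δ : ℕ} (hK : 3 * t ≤ K.card) (hdeg : ∀ v ∈ K, δ ≤ (K.filter (G.Adj v)).card)
    (hδ : 2 * K.card + 2 * t ≤ 3 * δ + 3) (hTK : T ⊆ K) (hT : T.card ≤ 2 * t) : Linked G K T := by
  intro M hM hd
  let N : {p // p ∈ M ∧ p.1 ≠ p.2} → Finset V := fun p =>
    (K \ T).filter fun z => G.Adj p.1.1 z ∧ G.Adj p.1.2 z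
  have hW : (K \ T).card + T.card = K.card := Finset.card_sdiff_add_card_eq_card hTK
  -- Hall's condition for distinct middle vertices. A vertex of `K \ T` useless for all of `s`
  -- misses an end of each pair, so `|s| ≤ |K| - δ - 1`, while a single pair has at least `|K| - 2t
  -- - 2(|K| - δ - 1)` common neighbours outside `T`. The hypothesis `hδ` compares the two.
  have hall : ∀ s : Finset {p // p ∈ M ∧ p.1 ≠ p.2}, s.card ≤ (s.biUnion N).card := by
    intro s
    rcases s.eq_empty_or_nonempty with rfl | ⟨p, hp⟩
    · simp
    have hs : 2 * s.card ≤ T.card := by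
      have := DisjointPairs.two_mul_card_le (T := T) (M := s.image Subtype.val)
        (by
          intro p hp q hq hpq
          obtain ⟨p, -, rfl⟩ := Finset.mem_image.1 hp
          obtain ⟨q, -, rfl⟩ := Finset.mem_image.1 hq
          exact hd _ p.2.1 _ q.2.1 hpq)
        (by intro p hp; obtain ⟨p, -, rfl⟩ := Finset.mem_image.1 hp; exact hM _ p.2.1)
        (by intro p hp; obtain ⟨p, -, rfl⟩ := Finset.mem_image.1 hp; exact p.2.2)
      rwa [Finset.card_image_of_injective _ Subtype.val_injective] at this
    by_cases hcov : K \ T ⊆ s.biUnion N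
    · have := Finset.card_le_card hcov
      omega
    · obtain ⟨w, hw, hwN⟩ := Finset.not_subset.1 hcov
      have hwK := (Finset.mem_sdiff.1 hw).1
      have hwT := (Finset.mem_sdiff.1 hw).2
      have hsm : s.card ≤ (K.filter fun z => z ≠ w ∧ ¬ G.Adj w z).card := by
        refine Finset.card_le_card_of_injOn
          (fun p => if G.Adj p.1.1 w then p.1.2 else p.1.1) ?_ ?_
        · intro q hq
          have h1 : ¬ (G.Adj q.1.1 w ∧ G.Adj q.1.2 w) := fun h =>
            hwN (Finset.mem_biUnion.2 ⟨q, hq, Finset.mem_filter.2 ⟨hw, h⟩⟩)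
          obtain ⟨m1, m2⟩ := hM _ q.2.1
          rw [Finset.mem_coe, Finset.mem_filter]
          dsimp only
          split_ifs with h
          · exact ⟨hTK m2, fun e => hwT (e ▸ m2), fun h' => h1 ⟨h, h'.symm⟩⟩
          · exact ⟨hTK m1, fun e => hwT (e ▸ m1), fun h' => h h'.symm⟩
        · intro q _ r _ h
          by_contra hqr
          have := hd _ q.2.1 _ r.2.1 fun e => hqr (Subtype.ext e)
          dsimp only at h
          split_ifs at h
          exacts [this.2.2.2 h, this.2.2.1 h, this.2.1 h, this.1 h]
      have h1 := card_nonadj_le hwK (hdeg w hwK)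
      have hp1 := hM _ p.2.1
      have h2 := card_nonadj_le (hTK hp1.1) (hdeg _ (hTK hp1.1))
      have h3 := card_nonadj_le (hTK hp1.2) (hdeg _ (hTK hp1.2))
      have h4 : K \ T ⊆ N p ∪ ((K.filter fun z => z ≠ p.1.1 ∧ ¬ G.Adj p.1.1 z) ∪
          (K.filter fun z => z ≠ p.1.2 ∧ ¬ G.Adj p.1.2 z)) := by
        intro z hz
        obtain ⟨hzK, hzT⟩ := Finset.mem_sdiff.1 hz
        simp only [N, Finset.mem_union, Finset.mem_filter, hz, hzK, true_and]
        have e1 : z ≠ p.1.1 := fun e => hzT (e ▸ hp1.1)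
        have e2 : z ≠ p.1.2 := fun e => hzT (e ▸ hp1.2)
        tauto
      have h5 := (Finset.card_le_card h4).trans ((Finset.card_union_le _ _).trans
        (Nat.add_le_add_left (Finset.card_union_le _ _) _))
      have h6 : (N p).card ≤ (s.biUnion N).card :=
        Finset.card_le_card (Finset.subset_biUnion_of_mem N hp)
      omega
  obtain ⟨f, hf, hfN⟩ := (Finset.all_card_le_biUnion_card_iff_exists_injective N).1 hall
  have hf' : ∀ p, f p ∈ K ∧ f p ∉ T ∧ G.Adj p.1.1 (f p) ∧ G.Adj p.1.2 (f p) := fun p => by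
    have := hfN p
    simp only [N, Finset.mem_filter, Finset.mem_sdiff] at this
    exact ⟨this.1.1, this.1.2, this.2⟩
  refine ⟨fun p => if h : p ∈ M ∧ p.1 ≠ p.2 then {p.1, f ⟨p, h⟩, p.2} else {p.1}, fun p hp => ?_,
    fun p hp q hq hpq => ?_⟩
  · obtain ⟨m1, m2⟩ := hM p hp
    by_cases h : p.1 ≠ p.2
    · dsimp only
      rw [dif_pos (show p ∈ M ∧ p.1 ≠ p.2 from ⟨hp, h⟩)]
      obtain ⟨h1, -, h2, h3⟩ := hf' ⟨p, hp, h⟩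
      refine ⟨?_, (Conn.adj h2 (by simp) (by simp)).trans (Conn.adj h3.symm (by simp) (by simp))⟩
      simp only [Finset.insert_subset_iff, Finset.singleton_subset_iff]
      exact ⟨hTK m1, h1, hTK m2⟩
    · dsimp only
      rw [dif_neg (show ¬ (p ∈ M ∧ p.1 ≠ p.2) from fun h' => h h'.2)]
      push Not at h
      rw [← h]
      exact ⟨by simpa using hTK m1, Conn.refl (by simp)⟩
  · obtain ⟨m1, m2⟩ := hM p hp
    obtain ⟨n1, n2⟩ := hM q hq
    obtain ⟨d1, d2, d3, d4⟩ := hd p hp q hq hpq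
    have hpT : ∀ h, f ⟨p, h⟩ ≠ q.1 ∧ f ⟨p, h⟩ ≠ q.2 := fun h =>
      ⟨fun e => (hf' ⟨p, h⟩).2.1 (e ▸ n1), fun e => (hf' ⟨p, h⟩).2.1 (e ▸ n2)⟩
    have hqT : ∀ h, p.1 ≠ f ⟨q, h⟩ ∧ p.2 ≠ f ⟨q, h⟩ := fun h =>
      ⟨fun e => (hf' ⟨q, h⟩).2.1 (e ▸ m1), fun e => (hf' ⟨q, h⟩).2.1 (e ▸ m2)⟩
    have hff : ∀ h h', f ⟨p, h⟩ ≠ f ⟨q, h'⟩ := fun h h' e => hpq (Subtype.ext_iff.1 (hf e))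
    rw [Finset.disjoint_left]
    intro z
    dsimp only
    split_ifs <;> simp only [Finset.mem_insert, Finset.mem_singleton] <;> grind

/-- If not every set of at most `2 * t` vertices of `U` is linked in `U`, then some system of
exactly `t` disjoint pairs cannot be linked. -/
theorem exists_pairs_of_not_linked (hU : 2 * t ≤ U.card) (h : ∃ T ⊆ U, T.card ≤ 2 * t ∧ ¬ Linked G U T) :
    ∃ x y : Fin t → V, (∀ i, x i ∈ U ∧ y i ∈ U) ∧ (∀ i j, x i ≠ y j) ∧
      Function.Injective x ∧ Function.Injective y ∧
      ¬ ∃ C : Fin t → Finset V, (∀ i, C i ⊆ U ∧ Conn G (C i) (x i) (y i)) ∧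
        ∀ i j, i ≠ j → Disjoint (C i) (C j) := by
  obtain ⟨T, hTU, hT, hnl⟩ := h
  simp only [Linked] at hnl
  push Not at hnl
  obtain ⟨M, hM, hd, hnM⟩ := hnl
  set P := M.filter fun p => p.1 ≠ p.2 with hP
  have hPM : ∀ p ∈ P, p ∈ M := fun p hp => (Finset.mem_filter.1 hp).1
  have hdP : DisjointPairs P := fun p hp q hq => hd p (hPM p hp) q (hPM q hq)
  -- Trivial pairs are dissolved: their vertices, with others filling up to `2t`, are paired
  -- arbitrarily. A linkage of the new system still covers these vertices, so the connections of the
  -- proper pairs avoid them.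
  obtain ⟨T', hTT', hT'U, hT'⟩ := Finset.exists_subsuperset_card_eq hTU hT hU
  have hPle := hdP.two_mul_card_le (T := T') (fun p hp => ⟨hTT' (hM p (hPM p hp)).1,
    hTT' (hM p (hPM p hp)).2⟩) fun p hp => (Finset.mem_filter.1 hp).2
  set E := P.image Prod.fst ∪ P.image Prod.snd with hE
  have hE1 : E ⊆ T' := by
    intro z hz
    rcases Finset.mem_union.1 hz with hz | hz <;> obtain ⟨p, hp, rfl⟩ := Finset.mem_image.1 hz
    exacts [hTT' (hM p (hPM p hp)).1, hTT' (hM p (hPM p hp)).2]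
  have hE2 : 2 * P.card ≤ E.card := hdP.two_mul_card_le (fun p hp =>
    ⟨Finset.mem_union_left _ (Finset.mem_image_of_mem _ hp),
      Finset.mem_union_right _ (Finset.mem_image_of_mem _ hp)⟩) fun p hp => (Finset.mem_filter.1 hp).2
  have hE3 : E.card ≤ 2 * P.card := by
    refine (Finset.card_union_le _ _).trans ?_
    have h1 := Finset.card_image_le (s := P) (f := Prod.fst)
    have h2 := Finset.card_image_le (s := P) (f := Prod.snd)
    omega
  have hcard : 2 * (t - P.card) = (T' \ E).card := by
    have := Finset.card_sdiff_add_card_eq_card hE1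
    omega
  -- the left-over vertices are enumerated in pairs
  obtain ⟨e⟩ : Nonempty (Fin (t - P.card) × Bool ≃ {z // z ∈ T' \ E}) := by
    refine ⟨Fintype.equivOfCardEq ?_⟩
    simp only [Fintype.card_prod, Fintype.card_fin, Fintype.card_bool, Fintype.card_coe]
    omega
  have hι : Fintype.card ({p // p ∈ P} ⊕ Fin (t - P.card)) = t := by
    simp only [Fintype.card_sum, Fintype.card_fin, Fintype.card_coe]
    omega
  let g := (Fintype.equivFinOfCardEq hι).symm
  let x' : {p // p ∈ P} ⊕ Fin (t - P.card) → V := Sum.elim (fun p => p.1.1) fun i => e (i, true)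
  let y' : {p // p ∈ P} ⊕ Fin (t - P.card) → V := Sum.elim (fun p => p.1.2) fun i => e (i, false)
  have he : ∀ q, (e q : V) ∈ T' ∧ (e q : V) ∉ E := fun q => Finset.mem_sdiff.1 (e q).2
  have hp1 : ∀ p : {p // p ∈ P}, p.1.1 ∈ E := fun p =>
    Finset.mem_union_left _ (Finset.mem_image_of_mem _ p.2)
  have hp2 : ∀ p : {p // p ∈ P}, p.1.2 ∈ E := fun p =>
    Finset.mem_union_right _ (Finset.mem_image_of_mem _ p.2)
  have hee : ∀ q r, (e q : V) = e r → q = r := fun q r h => e.injective (Subtype.ext h)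
  have hx'y' : ∀ i j, x' i ≠ y' j := by
    rintro (p | i) (q | j) h
    · by_cases hpq : p = q
      · subst hpq; exact (Finset.mem_filter.1 p.2).2 h
      · exact (hdP _ p.2 _ q.2 fun h => hpq (Subtype.ext h)).2.1 h
    · exact (he (j, false)).2 (by rw [show (e (j, false) : V) = p.1.1 from h.symm]; exact hp1 p)
    · exact (he (i, true)).2 (by rw [show (e (i, true) : V) = q.1.2 from h]; exact hp2 q)
    · have := hee _ _ h; simp at this
  have hx' : Function.Injective x' := by
    rintro (p | i) (q | j) h
    · by_contra hpq
      exact (hdP _ p.2 _ q.2 fun h => hpq (congrArg _ (Subtype.ext h))).1 h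
    · exact absurd (by rw [show (e (j, true) : V) = p.1.1 from h.symm]; exact hp1 p) (he (j, true)).2
    · exact absurd (by rw [show (e (i, true) : V) = q.1.1 from h]; exact hp1 q) (he (i, true)).2
    · have := hee _ _ h; simp at this; rw [this]
  have hy' : Function.Injective y' := by
    rintro (p | i) (q | j) h
    · by_contra hpq
      exact (hdP _ p.2 _ q.2 fun h => hpq (congrArg _ (Subtype.ext h))).2.2.2 h
    · exact absurd (by rw [show (e (j, false) : V) = p.1.2 from h.symm]; exact hp2 p) (he (j, false)).2
    · exact absurd (by rw [show (e (i, false) : V) = q.1.2 from h]; exact hp2 q) (he (i, false)).2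
    · have := hee _ _ h; simp at this; rw [this]
  have hsing : ∀ p ∈ M, p ∉ P → p.1 = p.2 ∧ p.1 ∈ T' ∧ p.1 ∉ E := by
    intro p hp hpP
    have hpp : p.1 = p.2 := by
      by_contra hne; exact hpP (Finset.mem_filter.2 ⟨hp, hne⟩)
    refine ⟨hpp, hTT' (hM p hp).1, fun hpE => ?_⟩
    rcases Finset.mem_union.1 hpE with h | h <;> obtain ⟨q, hq, hqp⟩ := Finset.mem_image.1 h
    · exact (hd q (hPM q hq) p hp fun e => hpP (e ▸ hq)).1 hqp
    · exact (hd q (hPM q hq) p hp fun e => hpP (e ▸ hq)).2.2.1 hqp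
  have hmemU : ∀ i, x' i ∈ U ∧ y' i ∈ U := by
    rintro (p | i)
    · exact ⟨hT'U (hE1 (hp1 p)), hT'U (hE1 (hp2 p))⟩
    · exact ⟨hT'U (he _).1, hT'U (he _).1⟩
  refine ⟨fun i => x' (g i), fun i => y' (g i), fun i => hmemU _, fun i j => hx'y' _ _,
    hx'.comp g.injective, hy'.comp g.injective, ?_⟩
  rintro ⟨C, hC1, hC2⟩
  set C' : {p // p ∈ P} ⊕ Fin (t - P.card) → Finset V := fun i => C (g.symm i) with hC'
  have hC1' : ∀ i, C' i ⊆ U ∧ Conn G (C' i) (x' i) (y' i) := fun i => by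
    have := hC1 (g.symm i)
    simpa using this
  have hC2' : ∀ i j, i ≠ j → Disjoint (C' i) (C' j) := fun i j hij =>
    hC2 _ _ fun h => hij (g.symm.injective h)
  have hmeet : ∀ p ∈ M, p ∉ P → ∀ q : {p // p ∈ P}, p.1 ∉ C' (Sum.inl q) := by
    intro p hp hpP q hpq
    obtain ⟨-, h1, h2⟩ := hsing p hp hpP
    obtain ⟨⟨i, b⟩, hi⟩ := e.surjective ⟨p.1, Finset.mem_sdiff.2 ⟨h1, h2⟩⟩
    have : p.1 ∈ C' (Sum.inr i) := by
      have hi' : (e (i, b) : V) = p.1 := by rw [hi]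
      cases b
      · exact hi' ▸ (hC1' (Sum.inr i)).2.right
      · exact hi' ▸ (hC1' (Sum.inr i)).2.left
    exact Finset.disjoint_left.1 (hC2' (Sum.inl q) (Sum.inr i) (by simp)) hpq this
  refine hnM ⟨fun p => if h : p ∈ P then C' (Sum.inl ⟨p, h⟩) else {p.1}, fun p hp => ?_,
    fun p hp q hq hpq => ?_⟩
  · by_cases h : p ∈ P
    · simp only [h, dif_pos]
      exact hC1' (Sum.inl ⟨p, h⟩)
    · simp only [h, dif_neg, not_false_eq_true]
      obtain ⟨h1, h2, h3⟩ := hsing p hp h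
      rw [← h1]
      exact ⟨by simpa using hT'U h2, Conn.refl (by simp)⟩
  · by_cases hpP : p ∈ P <;> by_cases hqP : q ∈ P <;> simp only [hpP, hqP, dif_pos, dif_neg, not_false_eq_true]
    · exact hC2' _ _ fun h => hpq (by simpa using h)
    · rw [Finset.disjoint_singleton_right]; exact hmeet q hq hqP _
    · rw [Finset.disjoint_singleton_left]; exact hmeet p hp hpP _
    · rw [Finset.disjoint_singleton]; exact (hd p hp q hq hpq).1

end Dense

/-! ### Minimal linkages and the two sides of what they leave over. -/

section Tight
open scoped Classical
variable {V : Type*} {G : SimpleGraph V} {U : Finset V} {t : ℕ} {x y : Fin t → V} {J : Finset (Fin t)}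
  {o : Fin t} {f₀ : ℕ} {C : Fin t → Finset V}

/-- Disjoint sets `C i ⊆ U` containing `x i` and `y i`, which connect them for `i ∈ J` and are
trivial for `i ∉ J`. -/
structure IsLk (G : SimpleGraph V) (U : Finset V) (x y : Fin t → V) (J : Finset (Fin t))
    (C : Fin t → Finset V) : Prop where
  sub : ∀ i, C i ⊆ U
  left : ∀ i, x i ∈ C i
  right : ∀ i, y i ∈ C i
  conn : ∀ i ∈ J, Conn G (C i) (x i) (y i)
  triv : ∀ i, i ∉ J → C i = {x i, y i}
  disj : ∀ i j, i ≠ j → Disjoint (C i) (C j)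

/-- The vertices outside the linkage, together with the two ends of the pair `o`. -/
noncomputable def rest (U : Finset V) (o : Fin t) (C : Fin t → Finset V) : Finset V :=
  U \ (Finset.univ.erase o).biUnion C

/-- The two ends of the pair `o`. -/
def endp (x y : Fin t → V) (o : Fin t) (b : Bool) : V := cond b (x o) (y o)

/-- A system of pairs in a set of large minimum degree, with a small minimal linkage of `J`. -/
structure PreTight (G : SimpleGraph V) (U : Finset V) (x y : Fin t → V) (J : Finset (Fin t))
    (o : Fin t) (f₀ : ℕ) : Prop where
  card_le : U.card ≤ 12 * t + 1
  deg : ∀ v ∈ U, 6 * t ≤ (U.filter (G.Adj v)).card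
  ne : ∀ i, x i ≠ y i
  notMem : o ∉ J
  min : ∀ C, IsLk G U x y J C → f₀ ≤ ∑ i, (C i).card
  bound : f₀ ≤ 6 * t

/-- A system of pairs for which minimal linkages of `J` leave the ends of `o` far apart. -/
structure Tight (G : SimpleGraph V) (U : Finset V) (x y : Fin t → V) (J : Finset (Fin t))
    (o : Fin t) (f₀ : ℕ) : Prop extends PreTight G U x y J o f₀ where
  far : ∀ C, IsLk G U x y J C → ∑ i, (C i).card = f₀ → ∀ D ⊆ rest U o C,
    Conn G D (x o) (y o) → 8 ≤ D.card

/-- A linkage of minimal size. -/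
def MinLk (G : SimpleGraph V) (U : Finset V) (x y : Fin t → V) (J : Finset (Fin t)) (f₀ : ℕ)
    (C : Fin t → Finset V) : Prop := IsLk G U x y J C ∧ ∑ i, (C i).card = f₀

/-- The vertices of the rest near the end `b` of the pair `o`. -/
noncomputable def side (G : SimpleGraph V) (U : Finset V) (x y : Fin t → V) (o : Fin t)
    (C : Fin t → Finset V) (b : Bool) : Finset V :=
  (rest U o C).filter fun v => ∃ a ∈ rest U o C, G.Adj (endp x y o b) a ∧ (a = v ∨ G.Adj a v)

/-- A vertex of the rest that is not an end of the pair `o`. -/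
def Generic (U : Finset V) (x y : Fin t → V) (o : Fin t) (C : Fin t → Finset V) (v : V) : Prop :=
  v ∈ rest U o C ∧ ∀ b, v ≠ endp x y o b

theorem mem_rest {v : V} : v ∈ rest U o C ↔ v ∈ U ∧ ∀ i, i ≠ o → v ∉ C i := by
  simp [rest]

theorem mem_side {v : V} {b : Bool} : v ∈ side G U x y o C b ↔ v ∈ rest U o C ∧
    ∃ a ∈ rest U o C, G.Adj (endp x y o b) a ∧ (a = v ∨ G.Adj a v) := by
  simp [side]

theorem Conn.step {D : Finset V} {a b : V} (h : a = b ∨ G.Adj a b) (ha : a ∈ D) (hb : b ∈ D) :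
    Conn G D a b := by
  rcases h with rfl | h
  · exact Conn.refl ha
  · exact Conn.adj h ha hb

/-- A vertex with many neighbours in a connection gives a shortcut. -/
theorem Conn.shortcut {D : Finset V} {a b v : V} (h : Conn G D a b) :
    ∃ E ⊆ insert v D, Conn G E a b ∧ E.card + (D.filter (G.Adj v)).card ≤ D.card + 3 ∧
      (v ∈ E ∨ E.card + (D.filter (G.Adj v)).card ≤ D.card) := by
  obtain ⟨w, hw⟩ := h
  by_cases hhit : ∃ z ∈ w.support, G.Adj v z
  · obtain ⟨q, r, hq, hr, hr'⟩ := exists_first_hit (fun z => G.Adj v z) w hhit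
    obtain ⟨q', r', hq', hs, hs'⟩ := exists_first_hit (fun z => G.Adj v z) w.reverse (by simpa using hhit)
    set E := insert v (r.support.toFinset ∪ r'.support.toFinset) with hE
    have hsub : ∀ z ∈ E, z = v ∨ (z ∈ D ∧ (G.Adj v z → z = q ∨ z = q')) := by
      intro z hz
      rcases Finset.mem_insert.1 hz with rfl | hz
      · exact Or.inl rfl
      right
      rcases Finset.mem_union.1 hz with hz | hz
      · have hz := List.mem_toFinset.1 hz
        exact ⟨hw z (hr z hz), fun h => Or.inl (hr' z hz h)⟩
      · have hz := List.mem_toFinset.1 hz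
        exact ⟨hw z (by simpa using hs z hz), fun h => Or.inr (hs' z hz h)⟩
    have c1 : Conn G E a q := ⟨r, fun z hz => by simp [hE, hz]⟩
    have c2 : Conn G E b q' := ⟨r', fun z hz => by simp [hE, hz]⟩
    have hvE : v ∈ E := Finset.mem_insert_self _ _
    refine ⟨E, fun z hz => ?_, c1.trans ((Conn.adj hq.symm c1.right hvE).trans
      ((Conn.adj hq' hvE c2.right).trans c2.symm)), ?_, Or.inl hvE⟩
    · rcases hsub z hz with rfl | h
      · exact Finset.mem_insert_self _ _
      · exact Finset.mem_insert_of_mem h.1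
    · have h1 : E ⊆ insert v ((D.filter fun z => ¬ G.Adj v z) ∪ {q, q'}) := by
        intro z hz
        simp only [Finset.mem_insert, Finset.mem_union, Finset.mem_filter, Finset.mem_singleton]
        rcases hsub z hz with h | ⟨h, h'⟩
        · exact Or.inl h
        · by_cases hadj : G.Adj v z
          · exact Or.inr (Or.inr (h' hadj))
          · exact Or.inr (Or.inl ⟨h, hadj⟩)
      have h2 := (Finset.card_le_card h1).trans ((Finset.card_insert_le _ _).trans
        (Nat.succ_le_succ ((Finset.card_union_le _ _).trans
          (Nat.add_le_add_left Finset.card_le_two _))))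
      have h3 := Finset.card_filter_add_card_filter_not (s := D) (G.Adj v)
      omega
  · push Not at hhit
    have h1 : w.support.toFinset ⊆ D.filter fun z => ¬ G.Adj v z := fun z hz =>
      Finset.mem_filter.2 ⟨hw z (List.mem_toFinset.1 hz), hhit z (List.mem_toFinset.1 hz)⟩
    have h2 := Finset.card_le_card h1
    have h3 := Finset.card_filter_add_card_filter_not (s := D) (G.Adj v)
    exact ⟨w.support.toFinset, fun z hz => Finset.mem_insert_of_mem (hw z (List.mem_toFinset.1 hz)),
      ⟨w, by simp⟩, by omega, by omega⟩

theorem IsLk.endp_mem (h : IsLk G U x y J C) (b : Bool) : endp x y o b ∈ rest U o C := by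
  rw [mem_rest]
  cases b
  · exact ⟨h.sub _ (h.right o), fun i hi hm => Finset.disjoint_left.1 (h.disj i o hi) hm (h.right o)⟩
  · exact ⟨h.sub _ (h.left o), fun i hi hm => Finset.disjoint_left.1 (h.disj i o hi) hm (h.left o)⟩

theorem IsLk.sum_erase (h : IsLk G U x y J C) (ho : o ∉ J) (hne : x o ≠ y o) :
    ∑ i ∈ Finset.univ.erase o, (C i).card + 2 = ∑ i, (C i).card := by
  rw [← Finset.sum_erase_add _ _ (Finset.mem_univ o), h.triv o ho, Finset.card_pair hne]

theorem IsLk.card_rest (h : IsLk G U x y J C) (ho : o ∉ J) (hne : x o ≠ y o) :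
    (rest U o C).card + ∑ i, (C i).card = U.card + 2 := by
  have h1 : (Finset.univ.erase o).biUnion C ⊆ U := Finset.biUnion_subset.2 fun i _ => h.sub i
  have h2 : ((Finset.univ.erase o).biUnion C).card = ∑ i ∈ Finset.univ.erase o, (C i).card :=
    Finset.card_biUnion fun i _ j _ hij => h.disj i j hij
  have h3 := Finset.card_sdiff_add_card_eq_card h1
  have h4 := h.sum_erase ho hne
  rw [rest]
  omega

theorem Tight.far' (hT : Tight G U x y J o f₀) (hC : MinLk G U x y J f₀ C) {D : Finset V} {b : Bool}
    (hD : D ⊆ rest U o C) (h : Conn G D (endp x y o b) (endp x y o (!b))) : 8 ≤ D.card := by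
  cases b
  · exact hT.far C hC.1 hC.2 D hD h.symm
  · exact hT.far C hC.1 hC.2 D hD h

/-- Rerouting one connection of a linkage through generic vertices. -/
theorem IsLk.update (hC : IsLk G U x y J C) (ho : o ∉ J) {j : Fin t} (hj : j ∈ J) {v : V}
    (hv : Generic U x y o C v) {D : Finset V} (hD : D ⊆ insert v (C j)) (hc : Conn G D (x j) (y j)) :
    IsLk G U x y J (Function.update C j D) := by
  have hvU := (mem_rest.1 hv.1).1
  have hvC : ∀ i, v ∉ C i := by
    intro i
    by_cases hi : i = o
    · rw [hi, hC.triv o ho]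
      have h1 := hv.2 true
      have h2 := hv.2 false
      simp only [endp, cond_true, cond_false] at h1 h2
      simp [h1, h2]
    · exact (mem_rest.1 hv.1).2 i hi
  have hdis : ∀ i, i ≠ j → Disjoint D (C i) := by
    intro i hi
    refine Disjoint.mono_left hD ?_
    rw [Finset.disjoint_insert_left]
    exact ⟨hvC i, hC.disj j i hi.symm⟩
  refine ⟨fun i => ?_, fun i => ?_, fun i => ?_, fun i hi => ?_, fun i hi => ?_, fun i k hik => ?_⟩
  · by_cases h : i = j
    · subst h; simpa using hD.trans (Finset.insert_subset hvU (hC.sub i))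
    · simpa [h] using hC.sub i
  · by_cases h : i = j
    · subst h; simpa using hc.left
    · simpa [h] using hC.left i
  · by_cases h : i = j
    · subst h; simpa using hc.right
    · simpa [h] using hC.right i
  · by_cases h : i = j
    · subst h; simpa using hc
    · simpa [h] using hC.conn i hi
  · have h : i ≠ j := fun e => hi (e ▸ hj)
    simpa [h] using hC.triv i hi
  · by_cases h : i = j
    · subst h
      simpa [hik.symm] using hdis k hik.symm
    · by_cases h' : k = j
      · subst h'
        simpa [h] using (hdis i h).symm
      · simpa [h, h'] using hC.disj i k hik

theorem sum_card_update (j : Fin t) (D : Finset V) :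
    ∑ i, (Function.update C j D i).card + (C j).card = ∑ i, (C i).card + D.card := by
  rw [← Finset.sum_erase_add _ _ (Finset.mem_univ j), ← Finset.sum_erase_add _ (fun i => (C i).card)
    (Finset.mem_univ j)]
  have : ∑ i ∈ Finset.univ.erase j, (Function.update C j D i).card =
      ∑ i ∈ Finset.univ.erase j, (C i).card := Finset.sum_congr rfl fun i hi => by
    rw [Function.update_of_ne (Finset.ne_of_mem_erase hi)]
  rw [this]
  simp only [Function.update_self]
  omega

theorem PreTight.card_le_of_conn (hT : PreTight G U x y J o f₀) (hC : MinLk G U x y J f₀ C) {j : Fin t}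
    (hj : j ∈ J) {v : V} (hv : Generic U x y o C v) {D : Finset V} (hD : D ⊆ insert v (C j))
    (hc : Conn G D (x j) (y j)) : (C j).card ≤ D.card := by
  have h1 := hT.min _ (hC.1.update hT.notMem hj hv hD hc)
  have h2 := sum_card_update (C := C) j D
  have h3 := hC.2
  omega

/-- A fourth neighbour on the connection would allow a shorter route through `v`. -/
theorem PreTight.card_nbr_le (hT : PreTight G U x y J o f₀) (hC : MinLk G U x y J f₀ C) {j : Fin t}
    {v : V} (hv : Generic U x y o C v) : ((C j).filter (G.Adj v)).card ≤ 3 := by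
  by_cases hj : j ∈ J
  · obtain ⟨E, hE, hc, h1, -⟩ := (hC.1.conn j hj).shortcut (v := v)
    have := hT.card_le_of_conn hC hj hv hE hc
    omega
  · refine (Finset.card_filter_le _ _).trans ?_
    rw [hC.1.triv j hj]
    exact Finset.card_le_two.trans (by omega)

theorem MinLk.mem_of_card_eq (hC : MinLk G U x y J f₀ C) {j : Fin t}
    (h4 : 4 ≤ (C j).card) : j ∈ J := by
  by_contra hj
  have := Finset.card_le_two (a := x j) (b := y j)
  rw [hC.1.triv j hj] at h4
  omega

/-- Otherwise `x j`, `v`, `y j` would be a shorter connection. -/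
theorem PreTight.not_adj_both (hT : PreTight G U x y J o f₀) (hC : MinLk G U x y J f₀ C) {j : Fin t}
    {v : V} (hv : Generic U x y o C v) (h4 : 4 ≤ (C j).card) : ¬ (G.Adj v (x j) ∧ G.Adj v (y j)) := by
  rintro ⟨h1, h2⟩
  have h3 := hT.card_le_of_conn hC (hC.mem_of_card_eq h4) hv (D := {x j, v, y j}) (by
      intro z hz
      simp only [Finset.mem_insert, Finset.mem_singleton] at hz ⊢
      rcases hz with rfl | rfl | rfl
      exacts [Or.inr (hC.1.left j), Or.inl rfl, Or.inr (hC.1.right j)])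
    ((Conn.adj h1.symm (by simp) (by simp)).trans (Conn.adj h2 (by simp) (by simp)))
  have := Finset.card_le_three (a := x j) (b := v) (c := y j)
  omega

theorem PreTight.one_le (_ : PreTight G U x y J o f₀) : 1 ≤ t := Nat.one_le_of_lt o.2

theorem card_filter_le_rest (C : Fin t → Finset V) (v : V) : (U.filter (G.Adj v)).card ≤
    ((rest U o C).filter (G.Adj v)).card + ∑ i ∈ Finset.univ.erase o, ((C i).filter (G.Adj v)).card := by
  have : U.filter (G.Adj v) ⊆ (rest U o C).filter (G.Adj v) ∪
      (Finset.univ.erase o).biUnion fun i => (C i).filter (G.Adj v) := by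
    intro z hz
    obtain ⟨hzU, hz⟩ := Finset.mem_filter.1 hz
    by_cases h : z ∈ rest U o C
    · exact Finset.mem_union_left _ (Finset.mem_filter.2 ⟨h, hz⟩)
    · rw [mem_rest] at h
      push Not at h
      obtain ⟨i, hi, hzi⟩ := h hzU
      exact Finset.mem_union_right _ (Finset.mem_biUnion.2 ⟨i, by simpa using hi,
        Finset.mem_filter.2 ⟨hzi, hz⟩⟩)
  exact (Finset.card_le_card this).trans ((Finset.card_union_le _ _).trans
    (Nat.add_le_add_left Finset.card_biUnion_le _))

/-- Of the `6t` neighbours in `U`, at most three lie on each of the other `t - 1` connections. -/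
theorem PreTight.le_card_nbr (hT : PreTight G U x y J o f₀) (hC : MinLk G U x y J f₀ C)
    {v : V} (hv : Generic U x y o C v) : 3 * t + 3 ≤ ((rest U o C).filter (G.Adj v)).card := by
  have h1 := hT.deg v (mem_rest.1 hv.1).1
  have h2 := card_filter_le_rest (G := G) (U := U) (o := o) C v
  have h3 : ∑ i ∈ Finset.univ.erase o, ((C i).filter (G.Adj v)).card ≤ (t - 1) * 3 := by
    refine (Finset.sum_le_card_nsmul _ _ 3 fun i _ => hT.card_nbr_le hC hv).trans ?_
    simp [Finset.card_erase_of_mem]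
  have := hT.one_le
  omega

/-- The other connections have `f₀ - 2` vertices in total. -/
theorem PreTight.le_card_nbr_endp (hT : PreTight G U x y J o f₀) (hC : MinLk G U x y J f₀ C) (b : Bool) :
    6 * t + 2 ≤ ((rest U o C).filter (G.Adj (endp x y o b))).card + f₀ := by
  have h1 := hT.deg _ (mem_rest.1 (hC.1.endp_mem (o := o) b)).1
  have h2 := card_filter_le_rest (G := G) (U := U) (o := o) C (endp x y o b)
  have h3 : ∑ i ∈ Finset.univ.erase o, ((C i).filter (G.Adj (endp x y o b))).card ≤
      ∑ i ∈ Finset.univ.erase o, (C i).card := Finset.sum_le_sum fun i _ => Finset.card_filter_le _ _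
  have h4 := hC.1.sum_erase hT.notMem (hT.ne o)
  have h5 := hC.2
  omega

theorem PreTight.exists_nbr (hT : PreTight G U x y J o f₀) (hC : MinLk G U x y J f₀ C) (b : Bool) :
    ∃ a ∈ rest U o C, G.Adj (endp x y o b) a := by
  have h1 := hT.le_card_nbr_endp hC b
  have h2 := hT.bound
  obtain ⟨a, ha⟩ : ((rest U o C).filter (G.Adj (endp x y o b))).Nonempty := by
    rw [← Finset.card_pos]; omega
  exact ⟨a, (Finset.mem_filter.1 ha).1, (Finset.mem_filter.1 ha).2⟩

theorem Tight.endp_mem_side (hT : Tight G U x y J o f₀) (hC : MinLk G U x y J f₀ C) (b : Bool) :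
    endp x y o b ∈ side G U x y o C b := by
  obtain ⟨a, ha, h⟩ := hT.exists_nbr hC b
  exact mem_side.2 ⟨hC.1.endp_mem b, a, ha, h, Or.inr h.symm⟩

/-- There are no short chains between the two ends of the pair `o`. -/
theorem Tight.no_chain (hT : Tight G U x y J o f₀) (hC : MinLk G U x y J f₀ C) {b : Bool}
    {z₁ z₂ z₃ z₄ z₅ : V} (h₁ : z₁ ∈ rest U o C) (h₂ : z₂ ∈ rest U o C) (h₃ : z₃ ∈ rest U o C)
    (h₄ : z₄ ∈ rest U o C) (h₅ : z₅ ∈ rest U o C) (e₀ : G.Adj (endp x y o b) z₁)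
    (e₁ : z₁ = z₂ ∨ G.Adj z₁ z₂) (e₂ : z₂ = z₃ ∨ G.Adj z₂ z₃) (e₃ : z₃ = z₄ ∨ G.Adj z₃ z₄)
    (e₄ : z₄ = z₅ ∨ G.Adj z₄ z₅) (e₅ : G.Adj z₅ (endp x y o (!b))) : False := by
  have h := hT.far' hC (b := b) (D := {endp x y o b, z₁, z₂, z₃, z₄, z₅, endp x y o (!b)}) (by
      intro z hz
      simp only [Finset.mem_insert, Finset.mem_singleton] at hz
      rcases hz with rfl | rfl | rfl | rfl | rfl | rfl | rfl
      exacts [hC.1.endp_mem b, h₁, h₂, h₃, h₄, h₅, hC.1.endp_mem (!b)])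
    ((Conn.adj e₀ (by simp) (by simp)).trans <| (Conn.step e₁ (by simp) (by simp)).trans <|
      (Conn.step e₂ (by simp) (by simp)).trans <| (Conn.step e₃ (by simp) (by simp)).trans <|
      (Conn.step e₄ (by simp) (by simp)).trans <| Conn.adj e₅ (by simp) (by simp))
  have := (Finset.card_insert_le (endp x y o b) {z₁, z₂, z₃, z₄, z₅, endp x y o (!b)}).trans
    (Nat.succ_le_succ Finset.card_le_six)
  omega

theorem eq_or_adj_symm {a b : V} (h : a = b ∨ G.Adj a b) : b = a ∨ G.Adj b a :=
  h.imp Eq.symm fun h => h.symm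

/-- Each side lies within distance two of its end, and the ends are at distance at least seven in
the rest. -/
theorem Tight.disjoint_side (hT : Tight G U x y J o f₀) (hC : MinLk G U x y J f₀ C) (b : Bool) {v : V}
    (h : v ∈ side G U x y o C b) (h' : v ∈ side G U x y o C (!b)) : False := by
  obtain ⟨hv, a, ha, h1, h2⟩ := mem_side.1 h
  obtain ⟨-, c, hc, h3, h4⟩ := mem_side.1 h'
  exact hT.no_chain hC ha hv hc hc hc h1 h2 (eq_or_adj_symm h4) (Or.inl rfl) (Or.inl rfl) h3.symm

theorem Tight.not_adj_side (hT : Tight G U x y J o f₀) (hC : MinLk G U x y J f₀ C) (b : Bool) {v w : V}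
    (h : v ∈ side G U x y o C b) (h' : w ∈ side G U x y o C (!b)) : ¬ G.Adj v w := by
  intro hadj
  obtain ⟨hv, a, ha, h1, h2⟩ := mem_side.1 h
  obtain ⟨hw, c, hc, h3, h4⟩ := mem_side.1 h'
  exact hT.no_chain hC ha hv hw hc hc h1 h2 (Or.inr hadj) (eq_or_adj_symm h4) (Or.inl rfl) h3.symm

theorem Tight.generic_of_adj (hT : Tight G U x y J o f₀) (hC : MinLk G U x y J f₀ C) {b : Bool} {a : V}
    (ha : a ∈ rest U o C) (h : G.Adj (endp x y o b) a) : Generic U x y o C a := by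
  refine ⟨ha, fun c hc => ?_⟩
  by_cases hcb : c = b
  · rw [hc, hcb] at h; exact G.loopless.irrefl _ h
  · have hcb : c = !b := by cases b <;> cases c <;> simp_all
    have hbm := hC.1.endp_mem (o := o) b
    refine hT.disjoint_side hC b (v := a) (mem_side.2 ⟨ha, a, ha, h, Or.inl rfl⟩) ?_
    rw [hc, hcb]
    exact hT.endp_mem_side hC _

/-- A generic vertex near one end is within bounded distance of it. -/
theorem Tight.exists_near (hT : Tight G U x y J o f₀) (hC : MinLk G U x y J f₀ C) {v : V}
    (hv : Generic U x y o C v) (b : Bool) (h : v ∉ side G U x y o C b) :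
    ∃ z ∈ rest U o C, ∃ c ∈ rest U o C, (v = z ∨ G.Adj v z) ∧ (z = c ∨ G.Adj z c) ∧
      G.Adj c (endp x y o (!b)) := by
  obtain ⟨c, hc, hcadj⟩ := hT.exists_nbr hC (!b)
  have hcg := hT.generic_of_adj hC hc hcadj
  by_contra hcon
  push Not at hcon
  set R := rest U o C with hR
  -- Otherwise the closed neighbourhoods of `v` and `c` and the neighbourhood of the end `b` are
  -- disjoint in `R`. Together they have at least `2(3t + 4) + 6t + 2 - f₀` vertices, but `|R| ≤ 12t
  -- + 3 - f₀`.
  have h1 : (insert v (R.filter (G.Adj v))).card = (R.filter (G.Adj v)).card + 1 :=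
    Finset.card_insert_of_notMem (by simp)
  have h2 : (insert c (R.filter (G.Adj c))).card = (R.filter (G.Adj c)).card + 1 :=
    Finset.card_insert_of_notMem (by simp)
  have d1 : Disjoint (insert v (R.filter (G.Adj v))) (insert c (R.filter (G.Adj c))) := by
    rw [Finset.disjoint_left]
    intro z hz hz'
    simp only [Finset.mem_insert, Finset.mem_filter] at hz hz'
    have hzR : z ∈ R := hz.elim (fun e => e ▸ hv.1) fun h => h.1
    exact hcon z hzR c hc (hz.imp Eq.symm fun h => h.2) (hz'.imp id fun h => h.2.symm) hcadj.symm
  have d2 : Disjoint (R.filter (G.Adj (endp x y o b)))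
      (insert v (R.filter (G.Adj v)) ∪ insert c (R.filter (G.Adj c))) := by
    rw [Finset.disjoint_left]
    intro z hz hz'
    obtain ⟨hzR, hz⟩ := Finset.mem_filter.1 hz
    simp only [Finset.mem_union, Finset.mem_insert, Finset.mem_filter] at hz'
    rcases hz' with hz' | hz'
    · exact h (mem_side.2 ⟨hv.1, z, hzR, hz, hz'.imp id fun h => h.2.symm⟩)
    · exact hT.no_chain hC hzR hc hc hc hc hz (hz'.imp id fun h => h.2.symm) (Or.inl rfl) (Or.inl rfl)
        (Or.inl rfl) hcadj.symm
  have hsub : R.filter (G.Adj (endp x y o b)) ∪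
      (insert v (R.filter (G.Adj v)) ∪ insert c (R.filter (G.Adj c))) ⊆ R :=
    Finset.union_subset (Finset.filter_subset _ _) (Finset.union_subset
      (Finset.insert_subset hv.1 (Finset.filter_subset _ _))
      (Finset.insert_subset hc (Finset.filter_subset _ _)))
  have h3 := Finset.card_le_card hsub
  rw [Finset.card_union_of_disjoint d2, Finset.card_union_of_disjoint d1, h1, h2] at h3
  have h4 := hT.le_card_nbr hC hv
  have h5 := hT.le_card_nbr hC hcg
  have h6 := hT.le_card_nbr_endp hC b
  have h7 := hC.1.card_rest hT.notMem (hT.ne o)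
  have h8 := hT.card_le
  have h9 := hC.2
  rw [← hR] at h4 h5 h6 h7
  omega

/-- A vertex on neither side would be within distance three of both ends, which are too far apart
for that. -/
theorem Tight.mem_side_or (hT : Tight G U x y J o f₀) (hC : MinLk G U x y J f₀ C) {v : V}
    (hv : v ∈ rest U o C) (b : Bool) : v ∈ side G U x y o C b ∨ v ∈ side G U x y o C (!b) := by
  by_contra hcon
  push Not at hcon
  have hg : Generic U x y o C v := by
    refine ⟨hv, fun c hc => ?_⟩
    have := hT.endp_mem_side hC c
    rw [← hc] at this
    cases b <;> cases c <;> simp_all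
  obtain ⟨z, hz, c, hc, e1, e2, e3⟩ := hT.exists_near hC hg b hcon.1
  obtain ⟨z', hz', c', hc', e1', e2', e3'⟩ := hT.exists_near hC hg (!b) hcon.2
  rw [Bool.not_not] at e3'
  exact hT.no_chain hC hc' hz' hv hz hc e3'.symm (eq_or_adj_symm e2') (eq_or_adj_symm e1') e1 e2 e3

/-- A generic vertex has several neighbours that are neighbours of the end on its side. -/
theorem Tight.le_card_common (hT : Tight G U x y J o f₀) (hC : MinLk G U x y J f₀ C) {v : V} {b : Bool}
    (hv : Generic U x y o C v) (h : v ∈ side G U x y o C b) :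
    6 ≤ ((rest U o C).filter fun z => G.Adj v z ∧ G.Adj (endp x y o b) z).card := by
  obtain ⟨c, hc, hcadj⟩ := hT.exists_nbr hC (!b)
  have hcg := hT.generic_of_adj hC hc hcadj
  set R := rest U o C with hR
  have h2 : (insert c (R.filter (G.Adj c))).card = (R.filter (G.Adj c)).card + 1 :=
    Finset.card_insert_of_notMem (by simp)
  set X := R.filter (G.Adj (endp x y o b)) with hX
  have hcside : ∀ z ∈ insert c (R.filter (G.Adj c)), z ∈ side G U x y o C (!b) := by
    intro z hz
    simp only [Finset.mem_insert, Finset.mem_filter] at hz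
    rcases hz with rfl | ⟨h1, h2⟩
    · exact mem_side.2 ⟨hc, z, hc, hcadj, Or.inl rfl⟩
    · exact mem_side.2 ⟨h1, c, hc, hcadj, Or.inr h2⟩
  have hvside : ∀ z ∈ R.filter (G.Adj v), z ∉ side G U x y o C (!b) := by
    intro z hz hz'
    exact hT.not_adj_side hC b h hz' (Finset.mem_filter.1 hz).2
  have hXside : ∀ z ∈ X, z ∈ side G U x y o C b := fun z hz =>
    mem_side.2 ⟨(Finset.mem_filter.1 hz).1, z, (Finset.mem_filter.1 hz).1, (Finset.mem_filter.1 hz).2,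
      Or.inl rfl⟩
  -- The neighbourhoods of `v` and of its end have sizes adding up to at least `9t + 5 - f₀`, and
  -- both avoid the `3t + 4` or more vertices in the closed neighbourhood of `c`. At most `9t - 1 -
  -- f₀` vertices remain, so they overlap in six.
  have d : Disjoint (R.filter (G.Adj v) ∪ X) (insert c (R.filter (G.Adj c))) := by
    rw [Finset.disjoint_left]
    intro z hz hz'
    rcases Finset.mem_union.1 hz with hz | hz
    · exact hvside z hz (hcside z hz')
    · exact hT.disjoint_side hC b (hXside z hz) (hcside z hz')
  have hsub : (R.filter (G.Adj v) ∪ X) ∪ insert c (R.filter (G.Adj c)) ⊆ R :=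
    Finset.union_subset (Finset.union_subset (Finset.filter_subset _ _) (Finset.filter_subset _ _))
      (Finset.insert_subset hc (Finset.filter_subset _ _))
  have h3 := Finset.card_le_card hsub
  rw [Finset.card_union_of_disjoint d, h2] at h3
  have h4 := hT.le_card_nbr hC hv
  have h5 := hT.le_card_nbr hC hcg
  have h6 := hT.le_card_nbr_endp hC b
  have h7 := hC.1.card_rest hT.notMem (hT.ne o)
  have h8 := hT.card_le
  have h9 := hC.2
  have h10 := Finset.card_union_add_card_inter (R.filter (G.Adj v)) X
  have h11 : R.filter (G.Adj v) ∩ X = R.filter fun z => G.Adj v z ∧ G.Adj (endp x y o b) z := by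
    rw [hX, ← Finset.filter_and]
  rw [← h11]
  rw [← hR] at h4 h5 h6 h7
  rw [← hX] at h6
  omega

/-- Exchanging a vertex of a minimal linkage for a generic vertex. -/
theorem Tight.swap (hT : Tight G U x y J o f₀) (hC : MinLk G U x y J f₀ C) {j : Fin t} (hj : j ∈ J)
    {v z : V} (hv : Generic U x y o C v) (hz : z ∈ C j) (hzx : z ≠ x j) (hzy : z ≠ y j)
    (hc : Conn G (insert v ((C j).erase z)) (x j) (y j)) :
    ∃ C', MinLk G U x y J f₀ C' ∧ (∀ i, i ≠ j → C' i = C i) ∧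
      (∀ w, w ∈ rest U o C' ↔ (w = z ∨ (w ∈ rest U o C ∧ w ≠ v))) ∧
      ∀ b, ∀ w ∈ side G U x y o C b, w ≠ v → w ∈ side G U x y o C' b := by
  have hjo : j ≠ o := fun e => hT.notMem (e ▸ hj)
  have hvj : v ∉ C j := (mem_rest.1 hv.1).2 j hjo
  set D := insert v ((C j).erase z) with hD
  have hDsub : D ⊆ insert v (C j) := Finset.insert_subset_insert _ (Finset.erase_subset _ _)
  have hcard : D.card = (C j).card := by
    rw [hD, Finset.card_insert_of_notMem fun h => hvj (Finset.mem_of_mem_erase h),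
      Finset.card_erase_add_one hz]
  have hC' : MinLk G U x y J f₀ (Function.update C j D) := by
    refine ⟨hC.1.update hT.notMem hj hv hDsub hc, ?_⟩
    have := sum_card_update (C := C) j D
    have h2 := hC.2
    omega
  have hrest : ∀ w, w ∈ rest U o (Function.update C j D) ↔ (w = z ∨ (w ∈ rest U o C ∧ w ≠ v)) := by
    intro w
    rw [mem_rest, mem_rest]
    constructor
    · rintro ⟨hwU, hw⟩
      have h1 := hw j hjo
      rw [Function.update_self, hD, Finset.mem_insert, Finset.mem_erase, not_or, not_and'] at h1
      by_cases hwz : w = z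
      · exact Or.inl hwz
      · refine Or.inr ⟨⟨hwU, fun i hi hwi => ?_⟩, h1.1⟩
        by_cases hij : i = j
        · subst hij; exact h1.2 hwi hwz
        · have := hw i hi
          rw [Function.update_of_ne hij] at this
          exact this hwi
    · rintro (rfl | ⟨⟨hwU, hw⟩, hwv⟩)
      · refine ⟨hC.1.sub j hz, fun i hi hwi => ?_⟩
        by_cases hij : i = j
        · subst hij
          rw [Function.update_self, hD, Finset.mem_insert] at hwi
          rcases hwi with e | e
          · exact hvj (e ▸ hz)
          · simp at e
        · rw [Function.update_of_ne hij] at hwi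
          exact Finset.disjoint_left.1 (hC.1.disj i j hij) hwi hz
      · refine ⟨hwU, fun i hi hwi => ?_⟩
        by_cases hij : i = j
        · subst hij
          rw [Function.update_self, hD, Finset.mem_insert] at hwi
          rcases hwi with e | e
          · exact hwv e
          · exact hw i hi (Finset.mem_of_mem_erase e)
        · rw [Function.update_of_ne hij] at hwi
          exact hw i hi hwi
  refine ⟨_, hC', fun i hi => Function.update_of_ne hi _ _, hrest, fun b w hw hwv => ?_⟩
  have hwR := (mem_side.1 hw).1
  by_cases hg : ∀ c, w ≠ endp x y o c
  -- `w` has six common neighbours with its end, so it remains on its side when `v` is used up.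
  · have h6 := hT.le_card_common hC ⟨hwR, hg⟩ hw
    obtain ⟨a, ha, hav⟩ := Finset.exists_mem_ne (lt_of_lt_of_le (by norm_num) h6) v
    obtain ⟨haR, h1, h2⟩ := Finset.mem_filter.1 ha
    exact mem_side.2 ⟨(hrest w).2 (Or.inr ⟨hwR, hwv⟩), a, (hrest a).2 (Or.inr ⟨haR, hav⟩), h2,
      Or.inr h1.symm⟩
  · push Not at hg
    obtain ⟨c, rfl⟩ := hg
    have hcb : c = b := by
      by_contra hne
      have hne : c = !b := by cases b <;> cases c <;> simp_all
      subst hne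
      exact hT.disjoint_side hC b hw (hT.endp_mem_side hC _)
    rw [hcb]
    exact hT.endp_mem_side hC' b

end Tight

/-! ### Adding middle vertices of short connections to the two sides. -/

section Absorption
open scoped Classical
variable {V : Type*} {G : SimpleGraph V} {U : Finset V} {t : ℕ} {x y : Fin t → V} {J I : Finset (Fin t)}
  {o : Fin t} {f₀ : ℕ} {C C₀ : Fin t → Finset V} {z : Fin t → V} {P : Bool → Finset V}

/-- The two sides of the rest of `C₀`, enlarged by the middle vertices of some short connections. -/
structure Abs (G : SimpleGraph V) (U : Finset V) (x y : Fin t → V) (J : Finset (Fin t)) (o : Fin t)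
    (f₀ : ℕ) (C₀ : Fin t → Finset V) (z : Fin t → V) (I : Finset (Fin t)) (P : Bool → Finset V) :
    Prop where
  ne : ∀ i ∈ I, i ≠ o
  mid : ∀ i ∈ I, (C₀ i).card = 3 ∧ z i ∈ C₀ i
  mem : ∀ v, (∃ b, v ∈ P b) ↔ Generic U x y o C₀ v ∨ ∃ i ∈ I, v = z i
  disj : ∀ b v, v ∈ P b → v ∉ P (!b)
  subset : ∀ b, ∀ v ∈ side G U x y o C₀ b, v ≠ endp x y o b → v ∈ P b
  nadj : ∀ b, ∀ v ∈ P b, ∀ w ∈ P (!b), ¬ G.Adj v w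
  free : ∀ T : Finset V, (∀ v ∈ T, ∃ b, v ∈ P b) → T.card ≤ 3 →
    ∃ C, MinLk G U x y J f₀ C ∧ (∀ i, i ∉ I → C i = C₀ i) ∧ (∀ v ∈ T, v ∈ rest U o C) ∧
      ∀ b, ∀ v ∈ side G U x y o C b, v ≠ endp x y o b → v ∈ P b

theorem Abs.base (hT : Tight G U x y J o f₀) (hC : MinLk G U x y J f₀ C₀) :
    Abs G U x y J o f₀ C₀ z ∅ fun b => (side G U x y o C₀ b).erase (endp x y o b) := by
  have hgen : ∀ b, ∀ v ∈ (side G U x y o C₀ b).erase (endp x y o b), Generic U x y o C₀ v := by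
    intro b v hv
    obtain ⟨h1, h2⟩ := Finset.mem_erase.1 hv
    refine ⟨(mem_side.1 h2).1, fun c hc => ?_⟩
    by_cases hcb : c = b
    · exact h1 (hcb ▸ hc)
    · have hcb : c = !b := by cases b <;> cases c <;> simp_all
      have := hT.endp_mem_side hC c
      rw [← hc, hcb] at this
      exact hT.disjoint_side hC b h2 this
  have hmem : ∀ v, (∃ b, v ∈ (side G U x y o C₀ b).erase (endp x y o b)) ↔ Generic U x y o C₀ v := by
    refine fun v => ⟨fun ⟨b, hv⟩ => hgen b v hv, fun hv => ?_⟩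
    rcases hT.mem_side_or hC hv.1 true with h | h
    · exact ⟨true, Finset.mem_erase.2 ⟨hv.2 _, h⟩⟩
    · exact ⟨false, Finset.mem_erase.2 ⟨hv.2 _, h⟩⟩
  refine ⟨by simp, by simp, fun v => by rw [hmem]; simp, fun b v hv hv' => ?_,
    fun b v hv hne => Finset.mem_erase.2 ⟨hne, hv⟩, fun b v hv w hw => ?_, fun T hT' _ =>
      ⟨C₀, hC, fun _ _ => rfl, fun v hv => ((hmem v).1 (hT' v hv)).1,
        fun b v hv hne => Finset.mem_erase.2 ⟨hne, hv⟩⟩⟩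
  · exact hT.disjoint_side hC b (Finset.mem_of_mem_erase hv) (Finset.mem_of_mem_erase hv')
  · exact hT.not_adj_side hC b (Finset.mem_of_mem_erase hv) (Finset.mem_of_mem_erase hw)

theorem MinLk.endp_mem (hC : MinLk G U x y J f₀ C₀) (b : Bool) : endp x y o b ∈ C₀ o := by
  cases b
  exacts [hC.1.right o, hC.1.left o]

theorem Abs.ne_endp (hA : Abs G U x y J o f₀ C₀ z I P) (hC : MinLk G U x y J f₀ C₀) {b : Bool} {v : V}
    (hv : v ∈ P b) (c : Bool) : v ≠ endp x y o c := by
  rcases (hA.mem v).1 ⟨b, hv⟩ with h | ⟨i, hi, rfl⟩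
  · exact h.2 c
  · intro e
    have := hC.endp_mem (o := o) c
    rw [← e] at this
    exact Finset.disjoint_left.1 (hC.1.disj i o (hA.ne i hi)) (hA.mid i hi).2 this

theorem Abs.mem_side_of_mem (hT : Tight G U x y J o f₀) (hC : MinLk G U x y J f₀ C)
    (hA : Abs G U x y J o f₀ C₀ z I P) (hC₀ : MinLk G U x y J f₀ C₀)
    (hCP : ∀ b, ∀ v ∈ side G U x y o C b, v ≠ endp x y o b → v ∈ P b) {b : Bool} {v : V}
    (hv : v ∈ P b) (hvR : v ∈ rest U o C) : v ∈ side G U x y o C b := by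
  refine (hT.mem_side_or hC hvR b).resolve_right fun h => ?_
  exact hA.disj b v hv (hCP _ v h (hA.ne_endp hC₀ hv _))

theorem Abs.notMem_of_notMem (hA : Abs G U x y J o f₀ C₀ z I P) (hC₀ : MinLk G U x y J f₀ C₀)
    {j : Fin t} (hj : j ∉ I) (hjo : j ≠ o) {v : V} (hv : v ∈ C₀ j) (b : Bool) : v ∉ P b := by
  intro h
  rcases (hA.mem v).1 ⟨b, h⟩ with h | ⟨i, hi, rfl⟩
  · exact (mem_rest.1 h.1).2 j hjo hv
  · have hij : i ≠ j := fun e => hj (e ▸ hi)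
    exact Finset.disjoint_left.1 (hC₀.1.disj i j hij) (hA.mid i hi).2 hv

/-- A replaceable vertex cannot have further neighbours on both sides. -/
theorem Abs.not_adj_both_sides (hT : Tight G U x y J o f₀) (hC₀ : MinLk G U x y J f₀ C₀)
    (hA : Abs G U x y J o f₀ C₀ z I P) {j : Fin t} (hj : j ∉ I) (hjJ : j ∈ J) {v u : V} {c : Bool}
    (hv : v ∈ P c) (hu : u ∈ C₀ j) (hux : u ≠ x j) (huy : u ≠ y j)
    (hc : Conn G (insert v ((C₀ j).erase u)) (x j) (y j)) {b : Bool} {w w' : V} (hw : w ∈ P b)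
    (hwv : w ≠ v) (hw' : w' ∈ P (!b)) (hwv' : w' ≠ v) (h : G.Adj u w) (h' : G.Adj u w') : False := by
  obtain ⟨C, hC, hCI, hCT, hCP⟩ := hA.free {v, w, w'} (by
    intro a ha
    simp only [Finset.mem_insert, Finset.mem_singleton] at ha
    rcases ha with rfl | rfl | rfl
    exacts [⟨_, hv⟩, ⟨_, hw⟩, ⟨_, hw'⟩]) Finset.card_le_three
  have hvg : Generic U x y o C v := ⟨hCT v (by simp), hA.ne_endp hC₀ hv⟩
  rw [← hCI j hj] at hu hc
  -- After the exchange `u` lies in the rest, hence on one side, but it has a neighbour on the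
  -- other.
  obtain ⟨C', hC', -, hR, hside⟩ := hT.swap hC hjJ hvg hu hux huy hc
  have h1 := hside b w (hA.mem_side_of_mem hT hC hC₀ hCP hw (hCT w (by simp))) hwv
  have h2 := hside (!b) w' (hA.mem_side_of_mem hT hC hC₀ hCP hw' (hCT w' (by simp))) hwv'
  rcases hT.mem_side_or hC' ((hR u).2 (Or.inl rfl)) b with h3 | h3
  · exact hT.not_adj_side hC' b h3 h2 h'
  · exact hT.not_adj_side hC' b h1 h3 h.symm

/-- The middle vertex of a short connection can be absorbed if it has many substitutes and no
neighbours on one side. -/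
theorem Abs.extend (hT : Tight G U x y J o f₀) (hC₀ : MinLk G U x y J f₀ C₀)
    (hA : Abs G U x y J o f₀ C₀ z I P) {j : Fin t} (hj : j ∉ I) (hjJ : j ∈ J) (hcard : (C₀ j).card = 3)
    (hz : C₀ j = {x j, z j, y j}) (hzx : z j ≠ x j) (hzy : z j ≠ y j)
    (hN : 3 ≤ ((P true ∪ P false).filter fun v => G.Adj v (x j) ∧ G.Adj v (y j)).card)
    (b : Bool) (hb : ∀ p ∈ P b, ¬ G.Adj (z j) p) : ∃ P', Abs G U x y J o f₀ C₀ z (insert j I) P' := by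
  have hjo : j ≠ o := fun e => hT.notMem (e ▸ hjJ)
  have hzj : z j ∈ C₀ j := by rw [hz]; simp
  have hzP : ∀ c, z j ∉ P c := hA.notMem_of_notMem hC₀ hj hjo hzj
  -- `z j` joins the side on which it may have neighbours.
  let P' : Bool → Finset V := fun c => if c = b then P c else insert (z j) (P c)
  have hP'b : P' b = P b := by simp [P']
  have hP'nb : P' (!b) = insert (z j) (P (!b)) := by simp [P']
  have hsub : ∀ c, P c ⊆ P' c := by
    intro c
    by_cases h : c = b
    · simp [P', h]
    · simp [P', h]
  have hmem : ∀ v, (∃ c, v ∈ P' c) ↔ (∃ c, v ∈ P c) ∨ v = z j := by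
    intro v
    constructor
    · rintro ⟨c, hc⟩
      by_cases h : c = b
      · simp only [P', h, if_true] at hc; exact Or.inl ⟨_, hc⟩
      · simp only [P', h, if_false, Finset.mem_insert] at hc
        exact hc.elim Or.inr fun h => Or.inl ⟨_, h⟩
    · rintro (⟨c, hc⟩ | rfl)
      · exact ⟨c, hsub c hc⟩
      · exact ⟨!b, by rw [hP'nb]; simp⟩
  have hbb : ∀ c, c = b ∨ c = !b := fun c => by cases c <;> cases b <;> simp
  refine ⟨P', ⟨fun i hi => ?_, fun i hi => ?_, fun v => ?_, fun c v hv hv' => ?_,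
    fun c v hv hne => hsub c (hA.subset c v hv hne), fun c v hv w hw => ?_, fun T hTP hT3 => ?_⟩⟩
  · rcases Finset.mem_insert.1 hi with rfl | hi
    exacts [hjo, hA.ne i hi]
  · rcases Finset.mem_insert.1 hi with rfl | hi
    exacts [⟨hcard, hzj⟩, hA.mid i hi]
  · rw [hmem, hA.mem]
    simp only [Finset.mem_insert, exists_eq_or_imp]
    rw [or_assoc, or_comm (b := v = z j)]
  · rcases hbb c with rfl | rfl
    · rw [hP'b] at hv; rw [hP'nb, Finset.mem_insert] at hv'
      rcases hv' with rfl | h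
      exacts [hzP _ hv, hA.disj _ v hv h]
    · rw [Bool.not_not, hP'b] at hv'; rw [hP'nb, Finset.mem_insert] at hv
      rcases hv with rfl | h
      exacts [hzP _ hv', hA.disj _ v hv' h]
  · rcases hbb c with rfl | rfl
    · rw [hP'b] at hv; rw [hP'nb, Finset.mem_insert] at hw
      rcases hw with rfl | h
      exacts [fun h => hb v hv h.symm, hA.nadj _ v hv w h]
    · rw [Bool.not_not, hP'b] at hw; rw [hP'nb, Finset.mem_insert] at hv
      rcases hv with rfl | h
      exacts [hb w hw, fun h' => hA.nadj _ w hw v h h'.symm]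
  · by_cases hzT : z j ∈ T
    swap
    · obtain ⟨C, h1, h2, h3, h4⟩ := hA.free T (fun v hv => ((hmem v).1 (hTP v hv)).resolve_right
        fun e => hzT (e ▸ hv)) hT3
      exact ⟨C, h1, fun i hi => h2 i fun h => hi (Finset.mem_insert_of_mem h), h3,
        fun c v hv hne => hsub c (h4 c v hv hne)⟩
    · have hTe := Finset.card_erase_add_one hzT
      -- To free `z j` together with at most two other vertices, a substitute `v` different from
      -- these is freed with them and then exchanged for `z j`. This is why three substitutes are
      -- required.
      obtain ⟨v, hvN, hvT⟩ := Finset.exists_mem_notMem_of_card_lt_card (s := T.erase (z j))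
        (lt_of_lt_of_le (by omega) hN)
      obtain ⟨hvP, hvx, hvy⟩ := Finset.mem_filter.1 hvN
      have hvP' : ∃ c, v ∈ P c := by
        rcases Finset.mem_union.1 hvP with h | h <;> exact ⟨_, h⟩
      obtain ⟨C, hC, hCI, hCT, hCP⟩ := hA.free (insert v (T.erase (z j))) (by
        intro w hw
        rcases Finset.mem_insert.1 hw with rfl | hw
        · exact hvP'
        · obtain ⟨h1, h2⟩ := Finset.mem_erase.1 hw
          exact ((hmem w).1 (hTP w h2)).resolve_right h1)
        ((Finset.card_insert_le _ _).trans (by omega))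
      obtain ⟨c, hvc⟩ := hvP'
      have hvg : Generic U x y o C v := ⟨hCT v (by simp), hA.ne_endp hC₀ hvc⟩
      have hCj := hCI j hj
      obtain ⟨C', hC', hC'C, hR, hside⟩ := hT.swap hC hjJ hvg (hCj ▸ hzj) hzx hzy (by
        have hx : x j ∈ insert v ((C j).erase (z j)) := by
          rw [hCj, hz]; simp [hzx.symm]
        have hy : y j ∈ insert v ((C j).erase (z j)) := by
          rw [hCj, hz]; simp [hzy.symm]
        exact (Conn.adj hvx.symm hx (by simp)).trans (Conn.adj hvy (by simp) hy))
      have hbase : ∀ d, ∀ w ∈ side G U x y o C' d, w ≠ endp x y o d → w ≠ z j →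
          w ∈ P d := by
        intro d w hw hwe hwz
        have hwR := ((hR w).1 (mem_side.1 hw).1).resolve_left hwz
        rcases hT.mem_side_or hC hwR.1 d with h | h
        · exact hCP d w h hwe
        · exact absurd (hside _ w h hwR.2) fun h => hT.disjoint_side hC' d hw h
      refine ⟨C', hC', fun i hi => ?_, fun w hw => ?_, fun d w hw hwe => ?_⟩
      · rw [Finset.mem_insert, not_or] at hi
        rw [hC'C i hi.1, hCI i hi.2]
      · rw [hR]
        by_cases hwz : w = z j
        · exact Or.inl hwz
        · refine Or.inr ⟨hCT w (Finset.mem_insert_of_mem (Finset.mem_erase.2 ⟨hwz, hw⟩)), fun e => ?_⟩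
          exact hvT (e ▸ Finset.mem_erase.2 ⟨hwz, hw⟩)
      · by_cases hwz : w = z j
        · subst hwz
          rcases hbb d with rfl | rfl
          · exfalso
            have hzg : Generic U x y o C' (z j) := by
              refine ⟨(mem_side.1 hw).1, fun c e => ?_⟩
              have := hC₀.endp_mem (o := o) c
              rw [← e] at this
              exact Finset.disjoint_left.1 (hC₀.1.disj j o hjo) hzj this
            have h6 := hT.le_card_common hC' hzg hw
            obtain ⟨a, ha⟩ := Finset.card_pos.1 (lt_of_lt_of_le (by norm_num) h6)
            obtain ⟨haR, h1, h2⟩ := Finset.mem_filter.1 ha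
            have hag := hT.generic_of_adj hC' haR h2
            refine hb a (hbase _ a (mem_side.2 ⟨haR, a, haR, h2, Or.inl rfl⟩)
              (hag.2 _) h1.ne') h1
          · rw [hP'nb]; exact Finset.mem_insert_self _ _
        · exact hsub d (hbase d w hw hwe hwz)

/-- Neighbour counts of the two sides into one connection. -/
theorem Abs.bundle (hT : Tight G U x y J o f₀) (hC₀ : MinLk G U x y J f₀ C₀)
    (hA : Abs G U x y J o f₀ C₀ z I P)
    (hz : ∀ j, (C₀ j).card = 3 → C₀ j = {x j, z j, y j} ∧ z j ≠ x j ∧ z j ≠ y j) (j : Fin t)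
    (hmax : j ∉ I → ∀ P', ¬ Abs G U x y J o f₀ C₀ z (insert j I) P') (F : Finset V)
    (hF : F = if j ∈ I then {x j, y j} else C₀ j) :
    ∃ (α : Bool → ℕ) (E : Bool → Finset V), (∀ b, E b ⊆ P b) ∧
      (∀ b, ∀ v ∈ P b, v ∉ E b → (F.filter (G.Adj v)).card ≤ α b) ∧
      3 * (α true + α false) + (E true).card + (E false).card ≤ 8 + 2 * F.card ∧
      ∀ b, α b + (E b).card ≤ 3 := by
  -- The bound `8 + 2|F|` is what the final count can afford per connection. For `|F| = 2` take `α =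
  -- (2, 2)`; for three vertices `(1, 3)` with two exceptions, or `(2, 2)` with one on each side;
  -- for four `(2, 3)` with at most one exception; beyond that `(3, 3)`.
  have hxy := hT.ne j
  by_cases hF2 : F.card ≤ 2
  · have hF2' : F.card = 2 := by
      refine le_antisymm hF2 ?_
      rw [← Finset.card_pair hxy]
      apply Finset.card_le_card
      rw [hF]
      split_ifs
      · exact subset_rfl
      · intro a ha
        rcases Finset.mem_insert.1 ha with rfl | ha
        · exact hC₀.1.left j
        · rw [Finset.mem_singleton] at ha
          exact ha ▸ hC₀.1.right j
    exact ⟨fun _ => 2, fun _ => ∅, by simp, fun b v _ _ => (Finset.card_filter_le _ _).trans hF2,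
      by simp [hF2'], by simp⟩
  have hjI : j ∉ I := fun h => hF2 (by rw [hF, if_pos h]; exact Finset.card_le_two)
  rw [if_neg hjI] at hF
  subst hF
  have hjJ : j ∈ J := by
    by_contra h
    exact hF2 (by rw [hC₀.1.triv j h]; exact Finset.card_le_two)
  have hgen : ∀ b, ∀ v ∈ P b, ∃ C, MinLk G U x y J f₀ C ∧ C j = C₀ j ∧ Generic U x y o C v := by
    intro b v hv
    obtain ⟨C, hC, hCI, hCT, -⟩ := hA.free {v} (fun w hw => ⟨b, by rwa [Finset.mem_singleton.1 hw]⟩) (by simp)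
    exact ⟨C, hC, hCI j hjI, hCT v (by simp), hA.ne_endp hC₀ hv⟩
  have h3 : ∀ b, ∀ v ∈ P b, ((C₀ j).filter (G.Adj v)).card ≤ 3 := by
    intro b v hv
    obtain ⟨C, hC, hCj, hvg⟩ := hgen b v hv
    rw [← hCj]
    exact hT.card_nbr_le hC hvg
  have hmiss : ∀ (v u : V) (S : Finset V), u ∈ S → ¬ G.Adj v u →
      (S.filter (G.Adj v)).card + 1 ≤ S.card := by
    intro v u S hu hvu
    rw [← Finset.card_erase_add_one hu]
    refine Nat.succ_le_succ (Finset.card_le_card fun w hw => ?_)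
    obtain ⟨h1, h2⟩ := Finset.mem_filter.1 hw
    exact Finset.mem_erase.2 ⟨fun e => hvu (e ▸ h2), h1⟩
  rcases Nat.lt_or_ge (C₀ j).card 4 with h4 | h4
  · -- three vertices
    have hc3 : (C₀ j).card = 3 := by omega
    obtain ⟨hzj, hzx, hzy⟩ := hz j hc3
    have hxm := hC₀.1.left j
    have hym := hC₀.1.right j
    have hzm : z j ∈ C₀ j := by rw [hzj]; simp
    by_cases hside : ∃ b, ∀ p ∈ P b, ¬ G.Adj (z j) p
    · obtain ⟨b, hb⟩ := hside
      -- `z j` has no neighbour on side `b`, so it was left unabsorbed only for lack of substitutes.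
      have hN : ((P true ∪ P false).filter fun v => G.Adj v (x j) ∧ G.Adj v (y j)).card ≤ 2 := by
        by_contra hcon
        obtain ⟨P', hP'⟩ := hA.extend hT hC₀ hjI hjJ hc3 hzj hzx hzy (by omega) b hb
        exact hmax hjI P' hP'
      have hNb : ((P b).filter fun v => G.Adj v (x j) ∧ G.Adj v (y j)).card ≤ 2 := by
        refine le_trans (Finset.card_le_card (Finset.filter_subset_filter _ ?_)) hN
        cases b
        exacts [Finset.subset_union_right, Finset.subset_union_left]
      refine ⟨fun c => if c = b then 1 else 3,
        fun c => if c = b then (P b).filter fun v => G.Adj v (x j) ∧ G.Adj v (y j) else ∅, ?_, ?_, ?_, ?_⟩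
      · intro c
        by_cases h : c = b
        · simp only [h, if_true]; exact Finset.filter_subset _ _
        · simp [h]
      · intro c v hv hvE
        by_cases h : c = b
        · subst h
          simp only [if_true, Finset.mem_filter, not_and] at hvE ⊢
          have hvz : ¬ G.Adj v (z j) := fun h => hb v hv h.symm
          have hsub : (C₀ j).filter (G.Adj v) ⊆ ({x j, y j} : Finset V).filter (G.Adj v) := by
            intro w hw
            obtain ⟨h1, h2⟩ := Finset.mem_filter.1 hw
            rw [hzj] at h1
            simp only [Finset.mem_insert, Finset.mem_singleton] at h1
            rcases h1 with rfl | rfl | rfl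
            · simp [h2]
            · exact absurd h2 hvz
            · simp [h2]
          have hle := Finset.card_le_card hsub
          have h2 := Finset.card_pair hxy
          by_cases hvx : G.Adj v (x j)
          · have := hmiss v (y j) {x j, y j} (by simp) (hvE hv hvx)
            omega
          · have := hmiss v (x j) {x j, y j} (by simp) hvx
            omega
        · simp only [h, if_false]
          exact h3 c v hv
      · cases b <;> simp [hc3] <;> omega
      · intro c
        by_cases h : c = b
        · simp only [h, if_true]; omega
        · simp [h]
    · push Not at hside
      -- Given two such vertices on one side, one could replace `z j`, which would still see the
      -- other one and a vertex of the opposite side.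
      have hcE : ∀ b, ((P b).filter fun v => G.Adj v (x j) ∧ G.Adj v (y j) ∧ G.Adj v (z j)).card ≤ 1 := by
        intro b
        rw [Finset.card_le_one]
        intro v hv v' hv'
        by_contra hne
        obtain ⟨hvP, hvx, hvy, hvz⟩ := Finset.mem_filter.1 hv
        obtain ⟨hvP', -, -, hvz'⟩ := Finset.mem_filter.1 hv'
        obtain ⟨w, hwP, hzw⟩ := hside (!b)
        refine hA.not_adj_both_sides hT hC₀ hjI hjJ hvP hzm hzx hzy ?_ hvP' (Ne.symm hne) hwP
          (fun e => hA.disj b v hvP (e ▸ hwP)) hvz'.symm hzw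
        exact (Conn.adj hvx.symm (Finset.mem_insert_of_mem (Finset.mem_erase.2 ⟨hzx.symm, hxm⟩))
          (by simp)).trans (Conn.adj hvy (by simp)
          (Finset.mem_insert_of_mem (Finset.mem_erase.2 ⟨hzy.symm, hym⟩)))
      refine ⟨fun _ => 2, fun b => (P b).filter fun v => G.Adj v (x j) ∧ G.Adj v (y j) ∧ G.Adj v (z j),
        fun b => Finset.filter_subset _ _, fun b v hv hvE => ?_, ?_, fun b => ?_⟩
      · simp only [Finset.mem_filter, hv, true_and] at hvE
        show _ ≤ 2
        by_cases hvx : G.Adj v (x j)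
        · by_cases hvy : G.Adj v (y j)
          · have := hmiss v (z j) _ hzm fun h => hvE ⟨hvx, hvy, h⟩
            omega
          · have := hmiss v (y j) _ hym hvy
            omega
        · have := hmiss v (x j) _ hxm hvx
          omega
      · have := hcE true
        have := hcE false
        dsimp only
        rw [hc3]; omega
      · have := hcE b
        dsimp only; omega
  · by_cases h5 : 5 ≤ (C₀ j).card
    · exact ⟨fun _ => 3, fun _ => ∅, by simp, fun b v hv _ => h3 b v hv, by simp; omega, by simp⟩
    have hc4 : (C₀ j).card = 4 := by omega
    by_cases hside : ∃ b, ∀ v ∈ P b, ((C₀ j).filter (G.Adj v)).card ≤ 2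
    · obtain ⟨b, hb⟩ := hside
      refine ⟨fun c => if c = b then 2 else 3, fun _ => ∅, by simp, fun c v hv _ => ?_, ?_, fun c => ?_⟩
      · by_cases h : c = b
        · subst h; simpa using hb v hv
        · simpa [h] using h3 c v hv
      · cases b <;> simp [hc4]
      · by_cases h : c = b <;> simp [h]
    push Not at hside
    obtain ⟨a, ha, ha3⟩ := hside true
    obtain ⟨a', ha', ha3'⟩ := hside false
    have hnb : ∀ b, ∀ v ∈ P b, ¬ (G.Adj v (x j) ∧ G.Adj v (y j)) := by
      intro b v hv
      obtain ⟨C, hC, hCj, hvg⟩ := hgen b v hv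
      exact hT.not_adj_both hC hvg (hCj ▸ h4)
    -- A vertex with three neighbours among the four misses one end of the connection and hence
    -- nothing else.
    have hint : ∀ b, ∀ v ∈ P b, 2 < ((C₀ j).filter (G.Adj v)).card → ∀ u ∈ C₀ j, u ≠ x j → u ≠ y j →
        G.Adj v u := by
      intro b v hv hv3 u hu hux huy
      by_contra hvu
      have key : ∀ q ∈ C₀ j, q ≠ u → ¬ G.Adj v q → False := by
        intro q hq hqu hvq
        have h1 := hmiss v q ((C₀ j).erase u) (Finset.mem_erase.2 ⟨hqu, hq⟩) hvq
        rw [Finset.card_erase_of_mem hu, hc4] at h1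
        have h2 : (C₀ j).filter (G.Adj v) ⊆ ((C₀ j).erase u).filter (G.Adj v) := fun w hw => by
          obtain ⟨h1, h2⟩ := Finset.mem_filter.1 hw
          exact Finset.mem_filter.2 ⟨Finset.mem_erase.2 ⟨fun e => hvu (e ▸ h2), h1⟩, h2⟩
        have h3 := Finset.card_le_card h2
        omega
      by_cases hvx : G.Adj v (x j)
      · exact key _ (hC₀.1.right j) huy.symm fun h => hnb b v hv ⟨hvx, h⟩
      · exact key _ (hC₀.1.left j) hux.symm hvx
    -- `a` can replace an inner vertex `u`
    obtain ⟨u, hu, hux, huy, hcu⟩ : ∃ u ∈ C₀ j, u ≠ x j ∧ u ≠ y j ∧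
        Conn G (insert a ((C₀ j).erase u)) (x j) (y j) := by
      obtain ⟨C, hC, hCj, hvg⟩ := hgen true a ha
      obtain ⟨D, hD, hc, h1, h2⟩ := (hC.1.conn j hjJ).shortcut (v := a)
      have h5 := hT.card_le_of_conn hC hjJ hvg hD hc
      rw [hCj] at hD h1 h2 h5
      have haj : a ∉ C₀ j := by rw [← hCj]; exact (mem_rest.1 hvg.1).2 j fun e => hT.notMem (e ▸ hjJ)
      have haD : a ∈ D := h2.resolve_right (by omega)
      have hlt : D.card < (insert a (C₀ j)).card := by
        rw [Finset.card_insert_of_notMem haj]; omega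
      obtain ⟨u, hu, huD⟩ := Finset.exists_mem_notMem_of_card_lt_card hlt
      have hua : u ≠ a := fun e => huD (e ▸ haD)
      refine ⟨u, (Finset.mem_insert.1 hu).resolve_left hua, fun e => huD (e ▸ hc.left),
        fun e => huD (e ▸ hc.right), hc.mono_set fun w hw => ?_⟩
      rcases Finset.mem_insert.1 (hD hw) with rfl | h
      · exact Finset.mem_insert_self _ _
      · exact Finset.mem_insert_of_mem (Finset.mem_erase.2 ⟨fun e => huD (e ▸ hw), h⟩)
    refine ⟨fun c => if c = true then 2 else 3, fun c => if c = true then {a} else ∅, ?_, ?_, ?_, ?_⟩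
    · intro c; cases c <;> simp [ha]
    · intro c v hv hvE
      cases c
      · simpa using h3 false v hv
      · simp only [if_true, Finset.mem_singleton] at hvE ⊢
        by_contra hcon
        have hvu := hint true v hv (by omega) u hu hux huy
        have hau := hint false a' ha' ha3' u hu hux huy
        exact hA.not_adj_both_sides hT hC₀ hjI hjJ ha hu hux huy hcu (b := true) hv hvE ha'
          (fun e => hA.disj true a ha (e ▸ ha')) hvu.symm hau.symm
    · simp [hc4]
    · intro c; cases c <;> simp

end Absorption

/-! ### Small sets of large minimum degree contain linked sets. -/

section DenseLinked
open scoped Classical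
variable {V : Type*} {G : SimpleGraph V} {U : Finset V} {t : ℕ} {x y : Fin t → V} {J I : Finset (Fin t)}
  {o : Fin t} {f₀ : ℕ} {C C₀ : Fin t → Finset V}

/-- Absorb as many middle vertices as possible. No edges join the two sides, so a vertex of a side
has most of its `6t` neighbours on that side, and the budget of `Abs.bundle` makes one side, without
its exceptions, dense enough for `linked_of_minDegree`. -/
theorem Tight.exists_linked (hT : Tight G U x y J o f₀) (hC₀ : MinLk G U x y J f₀ C₀) :
    ∃ K ⊆ U, 2 * t ≤ K.card ∧ ∀ T ⊆ K, T.card ≤ 2 * t → Linked G K T := by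
  have hzex : ∀ j, ∃ z, (C₀ j).card = 3 → C₀ j = {x j, z, y j} ∧ z ≠ x j ∧ z ≠ y j := by
    intro j
    by_cases h : (C₀ j).card = 3
    · have h1 : 0 < (((C₀ j).erase (x j)).erase (y j)).card := by
        rw [Finset.card_erase_of_mem (Finset.mem_erase.2 ⟨(hT.ne j).symm, hC₀.1.right j⟩),
          Finset.card_erase_of_mem (hC₀.1.left j), h]; norm_num
      obtain ⟨z, hz⟩ := Finset.card_pos.1 h1
      simp only [Finset.mem_erase] at hz
      refine ⟨z, fun _ => ⟨?_, hz.2.1, hz.1⟩⟩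
      symm
      apply Finset.eq_of_subset_of_card_le
      · intro w hw
        simp only [Finset.mem_insert, Finset.mem_singleton] at hw
        rcases hw with rfl | rfl | rfl
        exacts [hC₀.1.left j, hz.2.2, hC₀.1.right j]
      · rw [h, Finset.card_insert_of_notMem, Finset.card_pair hz.1]
        simp [hz.2.1.symm, hT.ne j]
    · exact ⟨x j, fun h' => absurd h' h⟩
  choose z hz using hzex
  obtain ⟨I, hI, hImax⟩ := Finset.exists_max_image
    (Finset.univ.filter fun I => ∃ P, Abs G U x y J o f₀ C₀ z I P) Finset.card
    ⟨∅, by simpa using ⟨_, Abs.base hT hC₀⟩⟩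
  obtain ⟨P, hA⟩ := (Finset.mem_filter.1 hI).2
  have hmax : ∀ j, j ∉ I → ∀ P', ¬ Abs G U x y J o f₀ C₀ z (insert j I) P' := by
    intro j hj P' hP'
    have := hImax (insert j I) (Finset.mem_filter.2 ⟨Finset.mem_univ _, P', hP'⟩)
    rw [Finset.card_insert_of_notMem hj] at this
    omega
  let F : Fin t → Finset V := fun j => if j ∈ I then {x j, y j} else C₀ j
  have hFC : ∀ j, F j ⊆ C₀ j := by
    intro j
    simp only [F]
    split_ifs
    · intro a ha
      simp only [Finset.mem_insert, Finset.mem_singleton] at ha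
      rcases ha with rfl | rfl
      exacts [hC₀.1.left j, hC₀.1.right j]
    · exact subset_rfl
  choose α E hEP hdeg hsum hαE using fun j => hA.bundle hT hC₀ hz j (hmax j) (F j) rfl
  set S := Finset.univ.erase o with hS
  have hSo : ∀ j ∈ S, j ≠ o := fun j hj => Finset.ne_of_mem_erase hj
  set FU := S.biUnion F with hFU
  have hFUcard : FU.card = ∑ j ∈ S, (F j).card := Finset.card_biUnion fun i _ j _ hij =>
    (hC₀.1.disj i j hij).mono (hFC i) (hFC j)
  have hPF : ∀ b, ∀ v ∈ P b, v ∉ FU := by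
    intro b v hv hvF
    obtain ⟨j, hj, hvj⟩ := Finset.mem_biUnion.1 hvF
    rcases (hA.mem v).1 ⟨b, hv⟩ with h | ⟨i, hi, rfl⟩
    · exact (mem_rest.1 h.1).2 j (hSo j hj) (hFC j hvj)
    · by_cases hij : i = j
      · subst hij
        have := hz i (hA.mid i hi).1
        simp only [F, hi, if_true, Finset.mem_insert, Finset.mem_singleton] at hvj
        exact hvj.elim this.2.1 this.2.2
      · exact Finset.disjoint_left.1 (hC₀.1.disj i j hij) (hA.mid i hi).2 (hFC j hvj)
  have hPU : ∀ b, P b ⊆ U := by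
    intro b v hv
    rcases (hA.mem v).1 ⟨b, hv⟩ with h | ⟨i, hi, rfl⟩
    · exact (mem_rest.1 h.1).1
    · exact hC₀.1.sub i (hA.mid i hi).2
  have hcount : (P true).card + (P false).card + FU.card + 2 ≤ U.card := by
    have d1 : Disjoint (P true) (P false) := Finset.disjoint_left.2 fun v hv hv' => hA.disj true v hv hv'
    have d2 : Disjoint (P true ∪ P false) FU := by
      rw [Finset.disjoint_union_left]
      exact ⟨Finset.disjoint_left.2 (hPF _), Finset.disjoint_left.2 (hPF _)⟩
    have d3 : Disjoint (P true ∪ P false ∪ FU) (C₀ o) := by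
      rw [Finset.disjoint_left]
      intro v hv hvo
      have hvo' : ∃ c, v = endp x y o c := by
        rw [hC₀.1.triv o hT.notMem] at hvo
        simp only [Finset.mem_insert, Finset.mem_singleton] at hvo
        exact hvo.elim (fun h => ⟨true, h⟩) fun h => ⟨false, h⟩
      obtain ⟨c, hc⟩ := hvo'
      simp only [Finset.mem_union] at hv
      rcases hv with (hv | hv) | hv
      · exact hA.ne_endp hC₀ hv c hc
      · exact hA.ne_endp hC₀ hv c hc
      · obtain ⟨j, hj, hvj⟩ := Finset.mem_biUnion.1 hv
        exact Finset.disjoint_left.1 (hC₀.1.disj j o (hSo j hj)) (hFC j hvj) hvo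
    have hsub : P true ∪ P false ∪ FU ∪ C₀ o ⊆ U :=
      Finset.union_subset (Finset.union_subset (Finset.union_subset (hPU _) (hPU _))
        (Finset.biUnion_subset.2 fun j _ => (hFC j).trans (hC₀.1.sub j))) (hC₀.1.sub o)
    have := Finset.card_le_card hsub
    rw [Finset.card_union_of_disjoint d3, Finset.card_union_of_disjoint d2,
      Finset.card_union_of_disjoint d1, hC₀.1.triv o hT.notMem, Finset.card_pair (hT.ne o)] at this
    exact this
  have hcov : ∀ u ∈ U, (∃ b, u ∈ P b) ∨ u ∈ FU ∨ u ∈ ({x o, y o} : Finset V) := by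
    intro u hu
    by_cases hur : u ∈ rest U o C₀
    · by_cases hg : ∀ c, u ≠ endp x y o c
      · exact Or.inl ((hA.mem u).2 (Or.inl ⟨hur, hg⟩))
      · push Not at hg
        obtain ⟨c, rfl⟩ := hg
        refine Or.inr (Or.inr ?_)
        cases c <;> simp [endp]
    · rw [mem_rest] at hur
      push Not at hur
      obtain ⟨j, hj, huj⟩ := hur hu
      have hjS : j ∈ S := by simp [hS, hj]
      by_cases hjI : j ∈ I
      · have huj' := huj
        rw [(hz j (hA.mid j hjI).1).1] at huj'
        simp only [Finset.mem_insert, Finset.mem_singleton] at huj'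
        have hFj : F j = {x j, y j} := by simp [F, hjI]
        rcases huj' with rfl | rfl | rfl
        · exact Or.inr (Or.inl (Finset.mem_biUnion.2 ⟨j, hjS, by simp [hFj]⟩))
        · exact Or.inl ((hA.mem _).2 (Or.inr ⟨j, hjI, rfl⟩))
        · exact Or.inr (Or.inl (Finset.mem_biUnion.2 ⟨j, hjS, by simp [hFj]⟩))
      · exact Or.inr (Or.inl (Finset.mem_biUnion.2 ⟨j, hjS, by simpa [F, hjI] using huj⟩))
  let EA : Bool → Finset V := fun b => S.biUnion fun j => E j b
  let K : Bool → Finset V := fun b => P b \ EA b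
  have hEA : ∀ b, (EA b).card ≤ ∑ j ∈ S, (E j b).card := fun b => Finset.card_biUnion_le
  have hEAP : ∀ b, EA b ⊆ P b := fun b => Finset.biUnion_subset.2 fun j _ => hEP j b
  have hKcard : ∀ b, (K b).card + (EA b).card = (P b).card := fun b =>
    Finset.card_sdiff_add_card_eq_card (hEAP b)
  have hScard : S.card = t - 1 := by simp [hS]
  have ht := hT.one_le
  have hKdeg : ∀ b, ∀ v ∈ K b,
      6 * t ≤ ((K b).filter (G.Adj v)).card + ((EA b).card + (2 + ∑ j ∈ S, α j b)) := by
    intro b v hv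
    obtain ⟨hvP, hvE⟩ := Finset.mem_sdiff.1 hv
    refine (hT.deg v (hPU b hvP)).trans ?_
    have hsub : U.filter (G.Adj v) ⊆ (K b).filter (G.Adj v) ∪ (EA b ∪
        (({x o, y o} : Finset V) ∪ S.biUnion fun j => (F j).filter (G.Adj v))) := by
      intro u hu
      obtain ⟨huU, huv⟩ := Finset.mem_filter.1 hu
      simp only [Finset.mem_union]
      rcases hcov u huU with ⟨c, hc⟩ | h | h
      · have hcb : c = b := by
          by_contra hne
          have hne : c = !b := by cases b <;> cases c <;> simp_all
          exact hA.nadj b v hvP u (hne ▸ hc) huv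
        subst hcb
        by_cases huE : u ∈ EA c
        · exact Or.inr (Or.inl huE)
        · exact Or.inl (Finset.mem_filter.2 ⟨Finset.mem_sdiff.2 ⟨hc, huE⟩, huv⟩)
      · obtain ⟨j, hj, huj⟩ := Finset.mem_biUnion.1 h
        exact Or.inr (Or.inr (Or.inr (Finset.mem_biUnion.2 ⟨j, hj, Finset.mem_filter.2 ⟨huj, huv⟩⟩)))
      · exact Or.inr (Or.inr (Or.inl h))
    refine (Finset.card_le_card hsub).trans ((Finset.card_union_le _ _).trans (Nat.add_le_add_left
      ((Finset.card_union_le _ _).trans (Nat.add_le_add_left ((Finset.card_union_le _ _).trans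
        (Nat.add_le_add Finset.card_le_two (Finset.card_biUnion_le.trans ?_))) _)) _))
    refine Finset.sum_le_sum fun j hj => hdeg j b v hvP fun h => hvE ?_
    exact Finset.mem_biUnion.2 ⟨j, hj, h⟩
  have hαsum : ∀ b, ∑ j ∈ S, α j b + ∑ j ∈ S, (E j b).card ≤ (t - 1) * 3 := by
    intro b
    rw [← Finset.sum_add_distrib, ← hScard, ← smul_eq_mul]
    exact Finset.sum_le_card_nsmul _ _ _ fun j _ => hαE j b
  have htot : 3 * (∑ j ∈ S, α j true + ∑ j ∈ S, α j false) + ∑ j ∈ S, (E j true).card +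
      ∑ j ∈ S, (E j false).card ≤ (t - 1) * 8 + 2 * ∑ j ∈ S, (F j).card := by
    have h1 : ∑ j ∈ S, (3 * (α j true + α j false) + (E j true).card + (E j false).card) ≤
        ∑ j ∈ S, (8 + 2 * (F j).card) := Finset.sum_le_sum fun j _ => hsum j
    simp only [Finset.sum_add_distrib, ← Finset.mul_sum, Finset.sum_const, hScard, smul_eq_mul] at h1
    linarith
  have hP3 : ∀ b, 3 * t + 3 ≤ (P b).card := by
    intro b
    obtain ⟨a, ha, hadj⟩ := hT.exists_nbr hC₀ b
    have hag := hT.generic_of_adj hC₀ ha hadj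
    have h1 := hT.le_card_nbr hC₀ hag
    have h2 : (insert a (((rest U o C₀).filter (G.Adj a)).erase (endp x y o b))) ⊆ P b := by
      intro u hu
      rcases Finset.mem_insert.1 hu with rfl | hu
      · exact hA.subset b _ (mem_side.2 ⟨ha, _, ha, hadj, Or.inl rfl⟩) (hag.2 b)
      · obtain ⟨hne, hu⟩ := Finset.mem_erase.1 hu
        obtain ⟨huR, hu⟩ := Finset.mem_filter.1 hu
        exact hA.subset b _ (mem_side.2 ⟨huR, _, ha, hadj, Or.inr hu⟩) hne
    have h3 := Finset.card_le_card h2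
    rw [Finset.card_insert_of_notMem (by simp)] at h3
    have h4 := Finset.pred_card_le_card_erase (s := (rest U o C₀).filter (G.Adj a)) (a := endp x y o b)
    omega
  have hK3 : ∀ b, 3 * t ≤ (K b).card := by
    intro b
    have h1 := hP3 b
    have h2 := hKcard b
    have h3 := hEA b
    have h4 := hαsum b
    obtain ⟨v, hv⟩ := Finset.card_pos.1 (show 0 < (K b).card by omega)
    have h5 := hKdeg b v hv
    have h6 := Finset.card_filter_le (K b) (G.Adj v)
    omega
  -- If both sides failed, adding the two inequalities would make `2 Σ|P| + Σ|E| + 3 Σα` larger than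
  -- `32t - 6`. By `htot` and `hcount` it is at most `8(t - 1) + 2(12t - 1) = 32t - 10`.
  have key : ∃ b, 2 * (K b).card + 2 * t ≤
      3 * (6 * t - ((EA b).card + (2 + ∑ j ∈ S, α j b))) + 3 := by
    by_contra hcon
    push Not at hcon
    have k1 := hcon true
    have k2 := hcon false
    have a1 := hαsum true
    have a2 := hαsum false
    have b1 := hEA true
    have b2 := hEA false
    have c1 := hKcard true
    have c2 := hKcard false
    have := hT.card_le
    rw [hFUcard] at hcount
    omega
  obtain ⟨b, hb⟩ := key
  refine ⟨K b, Finset.sdiff_subset.trans (hPU b), by have := hK3 b; omega, fun T hTK hT2 =>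
    linked_of_minDegree (hK3 b) (fun v hv => ?_) hb hTK hT2⟩
  have := hKdeg b v hv
  omega

/-- By `hfar`, neighbours of the two ends have disjoint closed neighbourhoods in the rest, each with
at least `3t + 4` vertices. So the rest is large, which means `f₀ ≤ 6t - 5`, and then `hbig` raises
the bound from six vertices to eight. -/
theorem PreTight.tight (hT : PreTight G U x y J o f₀) (hex : ∃ C, MinLk G U x y J f₀ C)
    (hfar : ∀ C, MinLk G U x y J f₀ C → ∀ D ⊆ rest U o C, Conn G D (x o) (y o) → 6 ≤ D.card)
    (hbig : ∀ C, MinLk G U x y J f₀ C → ∀ D ⊆ rest U o C, Conn G D (x o) (y o) →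
      6 * t + 3 ≤ f₀ + D.card) : Tight G U x y J o f₀ := by
  suffices h : f₀ + 5 ≤ 6 * t by
    refine ⟨hT, fun C hC hCf D hD hc => ?_⟩
    have := hbig C ⟨hC, hCf⟩ D hD hc
    omega
  obtain ⟨C, hC⟩ := hex
  obtain ⟨a, ha, hadj⟩ := hT.exists_nbr hC true
  obtain ⟨c, hc, hcadj⟩ := hT.exists_nbr hC false
  have hxR := hC.1.endp_mem (o := o) true
  have hyR := hC.1.endp_mem (o := o) false
  simp only [endp, cond_true, cond_false] at hadj hcadj hxR hyR
  set R := rest U o C with hR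
  have hno : ∀ p q r, p ∈ R → q ∈ R → r ∈ R → (x o = p ∨ G.Adj (x o) p) → (p = q ∨ G.Adj p q) →
      (q = r ∨ G.Adj q r) → (r = y o ∨ G.Adj r (y o)) → False := by
    intro p q r hp hq hr e1 e2 e3 e4
    have := hfar C hC {x o, p, q, r, y o} (by
        intro w hw
        simp only [Finset.mem_insert, Finset.mem_singleton] at hw
        rcases hw with rfl | rfl | rfl | rfl | rfl
        exacts [hxR, hp, hq, hr, hyR])
      ((Conn.step e1 (by simp) (by simp)).trans <| (Conn.step e2 (by simp) (by simp)).trans <|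
        (Conn.step e3 (by simp) (by simp)).trans <| Conn.step e4 (by simp) (by simp))
    have h5 := Finset.card_le_five (a := x o) (b := p) (c := q) (d := r) (e := y o)
    omega
  have hag : Generic U x y o C a := by
    refine ⟨ha, fun b hb => ?_⟩
    cases b
    · simp only [endp, cond_false] at hb
      exact hno a a a ha ha ha (Or.inr hadj) (Or.inl rfl) (Or.inl rfl) (Or.inl hb)
    · exact hadj.ne' hb
  have hcg : Generic U x y o C c := by
    refine ⟨hc, fun b hb => ?_⟩
    cases b
    · exact hcadj.ne' hb
    · simp only [endp, cond_true] at hb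
      exact hno c c c hc hc hc (Or.inl hb.symm) (Or.inl rfl) (Or.inl rfl) (Or.inr hcadj.symm)
  have d : Disjoint (insert a (R.filter (G.Adj a))) (insert c (R.filter (G.Adj c))) := by
    rw [Finset.disjoint_left]
    intro z hz hz'
    simp only [Finset.mem_insert, Finset.mem_filter] at hz hz'
    have hzR : z ∈ R := hz.elim (fun e => e ▸ ha) fun h => h.1
    exact hno a z c ha hzR hc (Or.inr hadj) (hz.imp Eq.symm fun h => h.2)
      (hz'.imp id fun h => h.2.symm) (Or.inr hcadj.symm)
  have h3 := Finset.card_le_card (Finset.union_subset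
      (Finset.insert_subset ha (Finset.filter_subset (G.Adj a) R))
      (Finset.insert_subset hc (Finset.filter_subset (G.Adj c) R)))
  rw [Finset.card_union_of_disjoint d, Finset.card_insert_of_notMem (by simp),
    Finset.card_insert_of_notMem (by simp)] at h3
  have h4 := hT.le_card_nbr hC hag
  have h5 := hT.le_card_nbr hC hcg
  have h7 := hC.1.card_rest hT.notMem (hT.ne o)
  have h8 := hT.card_le
  have h9 := hC.2
  rw [← hR] at h4 h5 h7
  omega

/-- Connecting the ends of the pair `o` outside of a linkage. -/
theorem IsLk.add (hC : IsLk G U x y J C) {D : Finset V} (hD : D ⊆ rest U o C)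
    (hc : Conn G D (x o) (y o)) : IsLk G U x y (insert o J) (Function.update C o D) := by
  have hdis : ∀ i, i ≠ o → Disjoint D (C i) := fun i hi =>
    Finset.disjoint_left.2 fun z hz hz' => (mem_rest.1 (hD hz)).2 i hi hz'
  refine ⟨fun i => ?_, fun i => ?_, fun i => ?_, fun i hi => ?_, fun i hi => ?_, fun i k hik => ?_⟩
  · by_cases h : i = o
    · subst h; simpa using hD.trans Finset.sdiff_subset
    · simpa [h] using hC.sub i
  · by_cases h : i = o
    · subst h; simpa using hc.left
    · simpa [h] using hC.left i
  · by_cases h : i = o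
    · subst h; simpa using hc.right
    · simpa [h] using hC.right i
  · by_cases h : i = o
    · subst h; simpa using hc
    · simpa [h] using hC.conn i (Finset.mem_of_mem_insert_of_ne hi h)
  · rw [Finset.mem_insert, not_or] at hi
    simpa [hi.1] using hC.triv i hi.2
  · by_cases h : i = o
    · subst h
      simpa [hik.symm] using hdis k hik.symm
    · by_cases h' : k = o
      · subst h'
        simpa [h] using (hdis i h).symm
      · simpa [h, h'] using hC.disj i k hik

/-- Forgetting one connection of a linkage. -/
theorem IsLk.remove (hC : IsLk G U x y J C) (o : Fin t) :
    IsLk G U x y (J.erase o) (Function.update C o {x o, y o}) := by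
  have hsub : ({x o, y o} : Finset V) ⊆ C o := by
    intro z hz
    simp only [Finset.mem_insert, Finset.mem_singleton] at hz
    rcases hz with rfl | rfl
    exacts [hC.left o, hC.right o]
  have hsub' : ∀ i, Function.update C o {x o, y o} i ⊆ C i := by
    intro i
    by_cases h : i = o
    · subst h; simpa using hsub
    · simp [h]
  refine ⟨fun i => (hsub' i).trans (hC.sub i), fun i => ?_, fun i => ?_, fun i hi => ?_, fun i hi => ?_,
    fun i k hik => (hC.disj i k hik).mono (hsub' i) (hsub' k)⟩
  · by_cases h : i = o
    · subst h; simp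
    · simpa [h] using hC.left i
  · by_cases h : i = o
    · subst h; simp
    · simpa [h] using hC.right i
  · obtain ⟨h1, h2⟩ := Finset.mem_erase.1 hi
    simpa [h1] using hC.conn i h2
  · by_cases h : i = o
    · subst h; simp
    · simpa [h] using hC.triv i fun hJ => hi (Finset.mem_erase.2 ⟨h, hJ⟩)

/-- If `U` itself does not serve, take an unlinkable system of `t` pairs and a minimal `J'` without
a linkage of total size at most `6t`. Leaving out a suitable pair `o` of `J'` gives a `Tight`
system, one of whose sides contains the linked set. -/
theorem denseSetsContainLinked (V : Type*) (ht : 1 ≤ t) : DenseSetsContainLinked V t := by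
  intro G U hne hU hdeg
  obtain ⟨v, hv⟩ := hne
  have h2U : 2 * t ≤ U.card := by
    have h1 := hdeg v hv
    have h2 := Finset.card_filter_le U (G.Adj v)
    omega
  by_cases hall : ∀ T ⊆ U, T.card ≤ 2 * t → Linked G U T
  · exact ⟨U, subset_rfl, h2U, hall⟩
  push Not at hall
  obtain ⟨x, y, hxyU, hxy, hx, hy, hnl⟩ := exists_pairs_of_not_linked h2U hall
  let Good : Finset (Fin t) → Prop := fun J => ∃ C, IsLk G U x y J C ∧ ∑ i, (C i).card ≤ 6 * t
  have hempty : Good ∅ := by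
    refine ⟨fun i => {x i, y i}, ⟨fun i => ?_, by simp, by simp, by simp, by simp, fun i j hij => ?_⟩, ?_⟩
    · intro z hz
      simp only [Finset.mem_insert, Finset.mem_singleton] at hz
      rcases hz with rfl | rfl
      exacts [(hxyU i).1, (hxyU i).2]
    · rw [Finset.disjoint_left]
      intro z hz hz'
      simp only [Finset.mem_insert, Finset.mem_singleton] at hz hz'
      rcases hz with rfl | rfl <;> rcases hz' with h | h
      exacts [hij (hx h), hxy _ _ h, hxy _ _ h.symm, hij (hy h)]
    · refine (Finset.sum_le_card_nsmul _ _ 2 fun i _ => Finset.card_le_two).trans ?_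
      simp only [Finset.card_univ, Fintype.card_fin, smul_eq_mul]
      omega
  have huniv : ¬ Good Finset.univ := fun ⟨C, hC, _⟩ =>
    hnl ⟨C, fun i => ⟨hC.sub i, hC.conn i (Finset.mem_univ _)⟩, hC.disj⟩
  obtain ⟨J', hJ', hJmin⟩ := Finset.exists_min_image (Finset.univ.filter fun J => ¬ Good J) Finset.card
    ⟨Finset.univ, by simpa using huniv⟩
  have hbad : ¬ Good J' := (Finset.mem_filter.1 hJ').2
  have hgood : ∀ o ∈ J', Good (J'.erase o) := by
    intro o ho
    by_contra h
    have h1 := hJmin _ (Finset.mem_filter.2 ⟨Finset.mem_univ _, h⟩)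
    have h2 := Finset.card_erase_lt_of_mem ho
    omega
  -- the choice of the pair `o`
  obtain ⟨o, ho, hsmall⟩ : ∃ o ∈ J', ∀ C, IsLk G U x y J' C → ∃ L, IsLk G U x y J' L ∧
      7 ≤ (L o).card ∧ ∑ i, (L i).card ≤ ∑ i, (C i).card := by
    by_cases hL : ∃ L, IsLk G U x y J' L
    · have hex : ∃ n, ∃ L, IsLk G U x y J' L ∧ ∑ i, (L i).card = n := by
        obtain ⟨L, hL⟩ := hL; exact ⟨_, L, hL, rfl⟩
      -- A smallest linkage of `J'` has more than `6t` vertices, so one of the `t` connections has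
      -- at least seven; this pair is `o`. If `J'` has no linkage at all, any pair will do.
      obtain ⟨L, hL, hLn⟩ := Nat.find_spec hex
      have hbig : 6 * t < ∑ i, (L i).card := by
        by_contra h
        exact hbad ⟨L, hL, not_lt.1 h⟩
      have : ∃ o, 7 ≤ (L o).card := by
        by_contra h
        push Not at h
        have := Finset.sum_le_card_nsmul Finset.univ (fun i => (L i).card) 6
          fun i _ => Nat.le_of_lt_succ (h i)
        simp only [Finset.card_univ, Fintype.card_fin, smul_eq_mul] at this
        omega
      obtain ⟨o, ho⟩ := this
      refine ⟨o, ?_, fun C hC => ⟨L, hL, ho, ?_⟩⟩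
      · by_contra h
        rw [hL.triv o h] at ho
        have := Finset.card_le_two (a := x o) (b := y o)
        omega
      · rw [hLn]
        exact Nat.find_min' hex ⟨C, hC, rfl⟩
    · push Not at hL
      obtain ⟨o, ho⟩ : J'.Nonempty := by
        rw [Finset.nonempty_iff_ne_empty]
        rintro rfl
        exact hbad hempty
      exact ⟨o, ho, fun C hC => absurd hC (hL C)⟩
  obtain ⟨C₁, hC₁, hC₁6⟩ := hgood o ho
  have hex : ∃ n, ∃ C, IsLk G U x y (J'.erase o) C ∧ ∑ i, (C i).card = n := ⟨_, C₁, hC₁, rfl⟩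
  set f₀ := Nat.find hex with hf₀
  have hmin : ∀ C, IsLk G U x y (J'.erase o) C → f₀ ≤ ∑ i, (C i).card := fun C hC =>
    Nat.find_min' hex ⟨C, hC, rfl⟩
  have hadd : ∀ C, MinLk G U x y (J'.erase o) f₀ C → ∀ D ⊆ rest U o C, Conn G D (x o) (y o) →
      IsLk G U x y J' (Function.update C o D) ∧
        ∑ i, (Function.update C o D i).card + 2 = f₀ + D.card := by
    intro C hC D hD hc
    have h1 := hC.1.add hD hc
    rw [Finset.insert_erase ho] at h1
    refine ⟨h1, ?_⟩
    have h2 := sum_card_update (C := C) o D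
    rw [hC.1.triv o (by simp), Finset.card_pair (hxy o o), hC.2] at h2
    exact h2
  have hpre : PreTight G U x y (J'.erase o) o f₀ :=
    ⟨hU, hdeg, fun i => hxy i i, by simp, hmin, (hmin C₁ hC₁).trans hC₁6⟩
  have hT := hpre.tight (Nat.find_spec hex) (fun C hC D hD hc => ?_) fun C hC D hD hc => ?_
  · obtain ⟨C, hC⟩ := Nat.find_spec hex
    exact hT.exists_linked hC
  -- `L` has at most `f₀ + |D| - 2` vertices, and at least `f₀` remain when the connection of `o`
  -- shrinks to its two ends. Hence `|D| ≥ |L o| ≥ 7`.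
  · obtain ⟨h1, h2⟩ := hadd C hC D hD hc
    obtain ⟨L, hL, h7, hle⟩ := hsmall _ h1
    have h3 := hmin _ (hL.remove o)
    have h4 := sum_card_update (C := L) o {x o, y o}
    rw [Finset.card_pair (hxy o o)] at h4
    omega
  · obtain ⟨h1, h2⟩ := hadd C hC D hD hc
    by_contra h
    exact hbad ⟨_, h1, by omega⟩

end DenseLinked

/-! ### Odd `A`-paths and the double cover. -/

section OddPaths
open scoped Classical
variable {V : Type*} {G : SimpleGraph V} {A : Finset V} {φ : V → Bool}

/-- A path between distinct vertices of `A` and otherwise outside `A` that uses an odd number of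
edges with ends of the same colour. -/
def IsOddAPath (A : Finset V) (φ : V → Bool) {c d : V} (p : G.Walk c d) : Prop :=
  p.IsPath ∧ c ∈ A ∧ d ∈ A ∧ c ≠ d ∧ (∀ x ∈ p.support, x ∈ A → x = c ∨ x = d) ∧
    (Odd p.length ↔ φ c = φ d)

/-- Two copies of each vertex, and only the copy given by the colour for vertices of `A`. -/
abbrev Cover (A : Finset V) (φ : V → Bool) := {x : V × Bool // x.1 ∈ A → x.2 = φ x.1}

/-- Two copies of the graph, with corresponding vertices adjacent, and `d` universal vertices. -/
def coverGraph (G : SimpleGraph V) (A : Finset V) (φ : V → Bool) (d : ℕ) :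
    SimpleGraph (Cover A φ ⊕ Fin d) where
  Adj p q := p ≠ q ∧ ∀ x y, p = .inl x → q = .inl y →
    (x.1.2 = y.1.2 ∧ G.Adj x.1.1 y.1.1) ∨ x.1.1 = y.1.1
  symm := ⟨fun _ _ h => ⟨h.1.symm, fun x y hx hy => (h.2 y x hy hx).imp
    (fun h => ⟨h.1.symm, h.2.symm⟩) Eq.symm⟩⟩
  loopless := ⟨fun _ h => h.1 rfl⟩

theorem even_card_of_involution {α : Type*} (s : Finset α) (g : α → α) (hg : ∀ a ∈ s, g a ∈ s)
    (hgg : ∀ a ∈ s, g (g a) = a) (hne : ∀ a ∈ s, g a ≠ a) : Even s.card := by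
  have h : ∑ _a ∈ s, (1 : ZMod 2) = 0 :=
    Finset.sum_involution (fun a _ => g a) (fun _ _ => by decide) (fun a ha _ => hne a ha)
      (fun a ha => hg a ha) fun a ha => hgg a ha
  rw [Finset.sum_const, nsmul_eq_mul, mul_one, ZMod.natCast_eq_zero_iff] at h
  exact even_iff_two_dvd.2 h

/-! ### Odd paths from a perfect matching of the double cover. -/

section Matching
variable {d : ℕ} {M : (coverGraph G A φ d).Subgraph}

/-- The graph on `V` of the matching edges inside the copies. -/
def projGraph (M : (coverGraph G A φ d).Subgraph) : SimpleGraph V where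
  Adj u v := u ≠ v ∧ ∃ x y : Cover A φ, x.1.1 = u ∧ y.1.1 = v ∧ x.1.2 = y.1.2 ∧ M.Adj (.inl x) (.inl y)
  symm := ⟨fun _ _ ⟨h, x, y, h1, h2, h3, h4⟩ => ⟨h.symm, y, x, h2, h1, h3.symm, h4.symm⟩⟩
  loopless := ⟨fun _ h => h.1 rfl⟩

theorem projGraph_le : projGraph M ≤ G := by
  rintro u v ⟨hne, x, y, rfl, rfl, h3, h4⟩
  exact (((M.adj_sub h4).2 x y rfl rfl).resolve_right hne).2

theorem cover_eq {x y : Cover A φ} (h : x.1.1 = y.1.1) (h' : x.1.2 = y.1.2) : x = y :=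
  Subtype.ext (Prod.ext h h')

/-- Along a path of matching edges the copies alternate. -/
theorem projGraph_path_parity (hM : M.IsMatching) {u e : V} (p : (projGraph M).Walk u e)
    (hp : p.IsPath) (he : e ∈ A) (hue : u ≠ e) :
    ∃ x y : Cover A φ, x.1.1 = u ∧ x.1.2 = y.1.2 ∧ y.1.1 ∈ p.support ∧ y.1.1 ≠ u ∧
      M.Adj (.inl x) (.inl y) ∧ (Odd p.length ↔ x.1.2 = φ e) := by
  induction p with
  | nil => exact absurd rfl hue
  | @cons u v w h q ih =>
    have hadj := h
    obtain ⟨hne, x, y, hx, hy, hxy, hMxy⟩ := hadj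
    rw [SimpleGraph.Walk.cons_isPath_iff] at hp
    refine ⟨x, y, hx, hxy, by simp [hy], hy ▸ hne.symm, hMxy, ?_⟩
    by_cases hvw : v = w
    · subst hvw
      have hq : q.length = 0 := SimpleGraph.Walk.length_eq_zero_iff.2 (SimpleGraph.Walk.isPath_iff_nil.1 hp.1)
      simp only [SimpleGraph.Walk.length_cons, hq, zero_add, odd_one, true_iff]
      have h1 := y.2 (hy ▸ he)
      rw [hxy, h1, hy]
    · obtain ⟨x', y', hx', hxy', hy's, hy'v, hM', hodd⟩ := ih hp.1 he hvw
      rw [SimpleGraph.Walk.length_cons, Nat.odd_add_one, hodd]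
      -- If two consecutive edges lay in the same copy, they would be the same matching edge and the
      -- path would turn back.
      have hflip : x.1.2 ≠ x'.1.2 := by
        intro heq
        have hyx' : y = x' := cover_eq (hy.trans hx'.symm) (hxy.symm.trans heq)
        subst hyx'
        have := hM.eq_of_adj_left hMxy.symm hM'
        rw [Sum.inl.injEq] at this
        subst this
        exact hp.2 (hx ▸ hy's)
      have hbool : ∀ a b c : Bool, a ≠ b → (¬ b = c ↔ a = c) := by decide
      exact hbool _ _ _ hflip

variable [Fintype V]

/-- Each edge at `v` uses up a copy of `v`, and a vertex of `A` has only one. -/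
theorem projGraph_degree_le (hM : M.IsMatching) (K : (projGraph M).ConnectedComponent)
    (v : K.supp) : ((projGraph M).induce K.supp).degree v + (if (v : V) ∈ A then 1 else 0) ≤ 2 := by
  set H := (projGraph M).induce K.supp
  have hcopy : ∀ w : K.supp, ∃ b : Bool, H.Adj v w → ((v : V) ∈ A → b = φ v) ∧
      ∃ x y : Cover A φ, x.1 = (v.1, b) ∧ y.1 = (w.1, b) ∧ M.Adj (.inl x) (.inl y) := by
    intro w
    by_cases h : H.Adj v w
    · obtain ⟨-, x, y, hx, hy, hxy, hMxy⟩ := h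
      refine ⟨x.1.2, fun _ => ⟨fun hv => ?_, x, y, Prod.ext hx rfl, Prod.ext hy hxy.symm, hMxy⟩⟩
      simp only [Function.Embedding.subtype_apply] at hx
      rw [← hx] at hv ⊢
      exact x.2 hv
    · exact ⟨true, fun h' => absurd h' h⟩
  choose b hb using hcopy
  have hinj : Set.InjOn b (H.neighborFinset v) := by
    intro w hw w' hw' hww
    rw [Finset.mem_coe, SimpleGraph.mem_neighborFinset] at hw hw'
    obtain ⟨-, x, y, hx, hy, h⟩ := hb w hw
    obtain ⟨-, x', y', hx', hy', h'⟩ := hb w' hw'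
    have hxx : x = x' := Subtype.ext (by rw [hx, hx', hww])
    subst hxx
    have := hM.eq_of_adj_left h h'
    rw [Sum.inl.injEq] at this
    subst this
    rw [hy] at hy'
    exact Subtype.ext (Prod.ext_iff.1 hy').1
  change (H.neighborFinset v).card + _ ≤ 2
  by_cases hv : (v : V) ∈ A
  · have : (H.neighborFinset v).card ≤ ({φ v} : Finset Bool).card := by
      refine Finset.card_le_card_of_injOn b (fun w hw => ?_) hinj
      rw [Finset.mem_coe, SimpleGraph.mem_neighborFinset] at hw
      simpa using (hb w hw).1 hv
    rw [Finset.card_singleton] at this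
    simp only [hv, if_true]; omega
  · have : (H.neighborFinset v).card ≤ (Finset.univ : Finset Bool).card :=
      Finset.card_le_card_of_injOn b (fun w _ => Finset.mem_univ _) hinj
    simpa [hv] using this

/-- In a component with `n` vertices the degree sum is at least `2n - 2` by connectedness, and at
most `2n` minus the number of vertices of `A`. -/
theorem card_inter_component_le (hM : M.IsMatching) (K : (projGraph M).ConnectedComponent) :
    (A.filter fun a => (projGraph M).connectedComponentMk a = K).card ≤ 2 := by
  set H := (projGraph M).induce K.supp with hH
  have hconn : H.Connected := K.connected_toSimpleGraph
  have h1 := hconn.card_vert_le_card_edgeSet_add_one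
  have h2 := H.sum_degrees_eq_twice_card_edges
  have h3 : ∑ v : K.supp, (H.degree v + (if (v : V) ∈ A then 1 else 0)) ≤ ∑ _v : K.supp, 2 :=
    Finset.sum_le_sum fun v _ => projGraph_degree_le hM K v
  rw [Finset.sum_add_distrib, h2] at h3
  have h4 : ∑ v : K.supp, (if (v : V) ∈ A then 1 else 0) =
      (A.filter fun a => (projGraph M).connectedComponentMk a = K).card := by
    rw [← Finset.card_filter]
    refine Finset.card_bij (fun v _ => v.1) ?_ ?_ ?_
    · intro v hv
      exact Finset.mem_filter.2 ⟨(Finset.mem_filter.1 hv).2, v.2⟩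
    · intro v _ w _ h; exact Subtype.ext h
    · intro a ha
      exact ⟨⟨a, (Finset.mem_filter.1 ha).2⟩, by simpa using (Finset.mem_filter.1 ha).1, rfl⟩
  rw [h4] at h3
  simp only [Finset.sum_const, Finset.card_univ, smul_eq_mul] at h3
  rw [Nat.card_eq_fintype_card, Nat.card_eq_fintype_card, ← SimpleGraph.edgeFinset_card] at h1
  omega

/-- A component without a vertex matched to a universal vertex contains an even number of
vertices of `A`. -/
theorem even_card_inter_component (hM : M.IsPerfectMatching) (K : (projGraph M).ConnectedComponent)
    (hK : ∀ i x, M.Adj (.inr i) (.inl x) → (projGraph M).connectedComponentMk x.1.1 ≠ K) :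
    Even (A.filter fun a => (projGraph M).connectedComponentMk a = K).card := by
  have hp : ∀ x : Cover A φ, ∃ y : Cover A φ, (projGraph M).connectedComponentMk x.1.1 = K →
      M.Adj (.inl x) (.inl y) := by
    intro x
    obtain ⟨w, hw, -⟩ := SimpleGraph.Subgraph.isPerfectMatching_iff.1 hM (.inl x)
    rcases w with y | i
    · exact ⟨y, fun _ => hw⟩
    · exact ⟨x, fun h => absurd h (hK i x hw.symm)⟩
  choose g hg using hp
  have hgK : ∀ x, (projGraph M).connectedComponentMk x.1.1 = K →
      (projGraph M).connectedComponentMk (g x).1.1 = K := by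
    intro x hx
    rw [← hx]
    by_cases h : x.1.1 = (g x).1.1
    · rw [h]
    · have hadj := hg x hx
      have h1 := ((M.adj_sub hadj).2 _ _ rfl rfl).resolve_right h
      exact (SimpleGraph.ConnectedComponent.connectedComponentMk_eq_of_adj
        (G := projGraph M) ⟨h, x, g x, rfl, rfl, h1.1, hadj⟩).symm
  have he := even_card_of_involution
    (Finset.univ.filter fun x : Cover A φ => (projGraph M).connectedComponentMk x.1.1 = K) g
    (fun x hx => by simpa using hgK x (by simpa using hx))
    (fun x hx => by
      have h1 := hg x (by simpa using hx)
      have h2 := hg _ (hgK x (by simpa using hx))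
      have := hM.1.eq_of_adj_left h1.symm h2
      rw [Sum.inl.injEq] at this
      exact this.symm)
    (fun x hx h => by
      have h1 := hg x (by simpa using hx)
      rw [h] at h1
      exact (M.adj_sub h1).ne rfl)
  -- Vertices have two copies each, except that those of `A` lack one. The matching pairs up the
  -- copies, so parity passes to `A`.
  have hcard : (Finset.univ.filter fun x : Cover A φ =>
      (projGraph M).connectedComponentMk x.1.1 = K).card +
      (A.filter fun a => (projGraph M).connectedComponentMk a = K).card =
      2 * (Finset.univ.filter fun v => (projGraph M).connectedComponentMk v = K).card := by
    have h1 : (Finset.univ.filter fun x : Cover A φ =>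
        (projGraph M).connectedComponentMk x.1.1 = K).card =
        ((Finset.univ.filter fun v => (projGraph M).connectedComponentMk v = K) ×ˢ
          (Finset.univ : Finset Bool) |>.filter fun x => x.1 ∈ A → x.2 = φ x.1).card := by
      refine Finset.card_bij (fun x _ => x.1) ?_ ?_ ?_
      · intro x hx
        simpa using ⟨(Finset.mem_filter.1 hx).2, x.2⟩
      · intro x _ y _ h; exact Subtype.ext h
      · intro x hx
        simp only [Finset.mem_filter, Finset.mem_product, Finset.mem_univ, true_and, and_true] at hx
        exact ⟨⟨x, hx.2⟩, by simpa using hx.1, rfl⟩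
    have h2 : (A.filter fun a => (projGraph M).connectedComponentMk a = K).card =
        ((Finset.univ.filter fun v => (projGraph M).connectedComponentMk v = K) ×ˢ
          (Finset.univ : Finset Bool) |>.filter fun x => ¬ (x.1 ∈ A → x.2 = φ x.1)).card := by
      refine Finset.card_bij (fun a _ => (a, !φ a)) ?_ ?_ ?_
      · intro a ha
        simp only [Finset.mem_filter] at ha
        simp [ha]
      · intro a _ b _ h; exact (Prod.ext_iff.1 h).1
      · rintro ⟨a, b⟩ hx
        simp only [Finset.mem_filter, Finset.mem_product, Finset.mem_univ, true_and, and_true,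
          Classical.not_imp] at hx
        refine ⟨a, by simpa using ⟨hx.2.1, hx.1⟩, ?_⟩
        have := hx.2.2
        ext1
        · rfl
        · revert this; cases b <;> cases φ a <;> simp
    rw [h1, h2, Finset.card_filter_add_card_filter_not, Finset.card_product]
    simp [mul_comm]
  rw [Nat.even_iff] at he ⊢
  omega

/-- A component with just one vertex of `A` has a vertex matched to a universal vertex, so there are
at most `d` of these. Counting `A` leaves `m` components with two vertices of `A`. A path joining
these two alternates between the copies from `φ c` to `φ e`, which gives its parity. -/
theorem exists_oddAPaths_of_isPerfectMatching {m : ℕ} (hM : M.IsPerfectMatching)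
    (hd : A.card = d + 2 * m) :
    ∃ (c e : Fin m → V) (p : ∀ i, G.Walk (c i) (e i)), (∀ i, IsOddAPath A φ (p i)) ∧
      ∀ i j, i ≠ j → ∀ w ∈ (p i).support, w ∉ (p j).support := by
  let mk := (projGraph M).connectedComponentMk
  let a : (projGraph M).ConnectedComponent → ℕ := fun K => (A.filter fun v => mk v = K).card
  let b : (projGraph M).ConnectedComponent → ℕ := fun K =>
    (Finset.univ.filter fun i : Fin d => ∃ x, M.Adj (.inr i) (.inl x) ∧ mk x.1.1 = K).card
  have hsa : ∑ K, a K = A.card :=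
    (Finset.card_eq_sum_card_fiberwise (f := mk) (t := Finset.univ) fun _ _ => Finset.mem_coe.2 (Finset.mem_univ _)).symm
  have hsb : ∑ K, b K ≤ d := by
    rw [← Finset.card_biUnion]
    · exact (Finset.card_le_univ _).trans (by simp)
    · intro K _ K' _ hne
      refine Finset.disjoint_left.2 fun i hi hi' => ?_
      obtain ⟨x, hx, hxK⟩ := (Finset.mem_filter.1 hi).2
      obtain ⟨x', hx', hxK'⟩ := (Finset.mem_filter.1 hi').2
      have := hM.1.eq_of_adj_left hx hx'
      rw [Sum.inl.injEq] at this
      subst this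
      exact hne (hxK.symm.trans hxK')
  have hle : ∀ K, a K ≤ b K + (if a K = 2 then 2 else 0) := by
    intro K
    have h2 : a K ≤ 2 := card_inter_component_le hM.1 K
    by_cases hK : a K = 2
    · simp [hK]
    · simp only [hK, if_false, add_zero]
      by_cases hb : b K = 0
      · have he : Even (a K) := even_card_inter_component hM K fun i x hx hxK => by
          rw [Finset.card_eq_zero] at hb
          have : i ∈ (∅ : Finset (Fin d)) := hb ▸ Finset.mem_filter.2 ⟨Finset.mem_univ _, x, hx, hxK⟩
          simp at this
        rw [Nat.even_iff] at he
        omega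
      · omega
  have hgood : m ≤ (Finset.univ.filter fun K => a K = 2).card := by
    have := Finset.sum_le_sum fun K (_ : K ∈ Finset.univ) => hle K
    rw [hsa, Finset.sum_add_distrib, ← Finset.sum_filter, Finset.sum_const, smul_eq_mul] at this
    omega
  have hpath : ∀ K, a K = 2 → ∃ c e, ∃ p : G.Walk c e, IsOddAPath A φ p ∧ ∀ w ∈ p.support, mk w = K := by
    intro K hK
    obtain ⟨c, e, hce, hset⟩ := Finset.card_eq_two.1 hK
    have hc : c ∈ A ∧ mk c = K := by
      have : c ∈ A.filter fun v => mk v = K := by rw [hset]; simp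
      simpa using this
    have he : e ∈ A ∧ mk e = K := by
      have : e ∈ A.filter fun v => mk v = K := by rw [hset]; simp
      simpa using this
    have hreach : (projGraph M).Reachable c e :=
      SimpleGraph.ConnectedComponent.eq.1 (hc.2.trans he.2.symm)
    obtain ⟨q, hq⟩ := hreach.exists_isPath
    have hsupp : ∀ w ∈ q.support, mk w = K := fun w hw => by
      rw [← hc.2]
      exact (SimpleGraph.ConnectedComponent.eq.2 ⟨q.takeUntil w hw⟩).symm
    refine ⟨c, e, q.mapLe projGraph_le, ⟨?_, hc.1, he.1, hce, ?_, ?_⟩, ?_⟩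
    · exact hq.mapLe _
    · intro x hx hxA
      rw [SimpleGraph.Walk.support_mapLe_eq_support] at hx
      have : x ∈ A.filter fun v => mk v = K := Finset.mem_filter.2 ⟨hxA, hsupp x hx⟩
      rw [hset] at this
      simpa using this
    · obtain ⟨x, y, hx, -, -, -, -, hodd⟩ := projGraph_path_parity hM.1 q hq he.1 hce
      rw [SimpleGraph.Walk.length_map, hodd, x.2 (hx ▸ hc.1), hx]
    · intro w hw
      rw [SimpleGraph.Walk.support_mapLe_eq_support] at hw
      exact hsupp w hw
  obtain ⟨ι⟩ : Nonempty (Fin m ↪ {K // K ∈ Finset.univ.filter fun K => a K = 2}) :=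
    Function.Embedding.nonempty_of_card_le (by rwa [Fintype.card_fin, Fintype.card_coe])
  have hι : ∀ i, a (ι i).1 = 2 := fun i => (Finset.mem_filter.1 (ι i).2).2
  choose c e p hp hpK using fun i => hpath (ι i).1 (hι i)
  refine ⟨c, e, p, hp, fun i j hij w hw hw' => hij (ι.injective (Subtype.ext ?_))⟩
  rw [← hpK i w hw, ← hpK j w hw']

end Matching
-- Components left by a Tutte violator separate odd paths.
section Violator
variable {d : ℕ} {u : Set (Cover A φ ⊕ Fin d)}

/-- What is left of the double cover after deleting `u`. -/
abbrev coverRest (G : SimpleGraph V) (A : Finset V) (φ : V → Bool) {d : ℕ}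
    (u : Set (Cover A φ ⊕ Fin d)) :=
  ((⊤ : (coverGraph G A φ d).Subgraph).deleteVerts u).coe

/-- The pair `x` is a vertex of the double cover that is not deleted. -/
def Surv (u : Set (Cover A φ ⊕ Fin d)) (x : V × Bool) : Prop :=
  ∃ h : x.1 ∈ A → x.2 = φ x.1, Sum.inl ⟨x, h⟩ ∉ u

/-- The component of `x` in the rest of the double cover. -/
noncomputable def comp (G : SimpleGraph V) (u : Set (Cover A φ ⊕ Fin d)) (x : V × Bool) :
    Option (coverRest G A φ u).ConnectedComponent :=
  if h : Surv u x then some ((coverRest G A φ u).connectedComponentMk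
    ⟨.inl ⟨x, h.choose⟩, by simpa using h.choose_spec⟩) else none

theorem comp_eq {x : V × Bool} (h : Surv u x) : comp G u x =
    some ((coverRest G A φ u).connectedComponentMk
      ⟨.inl ⟨x, h.choose⟩, by simpa using h.choose_spec⟩) := dif_pos h

theorem comp_eq_of_adj {x y : V × Bool} (hx : Surv u x) (hy : Surv u y)
    (h : (x.2 = y.2 ∧ G.Adj x.1 y.1) ∨ (x.1 = y.1 ∧ x ≠ y)) : comp G u x = comp G u y := by
  rw [comp_eq hx, comp_eq hy, Option.some_inj]
  apply SimpleGraph.ConnectedComponent.connectedComponentMk_eq_of_adj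
  have hxu := hx.choose_spec
  have hyu := hy.choose_spec
  simp only [SimpleGraph.Subgraph.coe_adj, SimpleGraph.Subgraph.deleteVerts_adj,
    SimpleGraph.Subgraph.verts_top, SimpleGraph.Subgraph.top_adj, Set.mem_univ, true_and]
  refine ⟨hxu, hyu, ?_, ?_⟩
  · intro e
    rw [Sum.inl.injEq, Subtype.mk.injEq] at e
    rcases h with h | h
    · rw [e] at h; exact G.loopless.irrefl _ h.2
    · exact h.2 e
  · intro a b ha hb
    rw [Sum.inl.injEq] at ha hb
    rw [← ha, ← hb]
    exact h.imp_right fun h => h.1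

variable [Fintype V]

/-- Surviving vertices which have no surviving twin. -/
noncomputable def lonely (u : Set (Cover A φ ⊕ Fin d)) : Finset (V × Bool) :=
  Finset.univ.filter fun x => Surv u x ∧ ¬ Surv u (x.1, !x.2)

theorem mem_lonely {x : V × Bool} : x ∈ lonely u ↔ Surv u x ∧ ¬ Surv u (x.1, !x.2) := by
  simp [lonely]

/-- Vertices without a surviving copy. -/
noncomputable def gone (u : Set (Cover A φ ⊕ Fin d)) : Finset V :=
  Finset.univ.filter fun v => ∀ b, ¬ Surv u (v, b)

/-- An odd path avoiding `Z` cannot exist if lonely vertices outside `Z` lie in different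
components. -/
theorem no_oddAPath_of_separated {Z : Finset V} (hZ : gone u ⊆ Z)
    (hsep : ∀ x ∈ lonely u, ∀ y ∈ lonely u, x.1 ∉ Z → y.1 ∉ Z → comp G u x = comp G u y → x = y)
    {v e : V} (p : G.Walk v e) (hp : p.IsPath) (hve : v ≠ e) (he : e ∈ A)
    (hA : ∀ x ∈ p.support.tail, x ∈ A → x = e) (hpZ : ∀ x ∈ p.support, x ∉ Z) (b : Bool)
    (hb : Surv u (v, b)) (θ : V × Bool) (hθ : θ ∈ lonely u) (hθZ : θ.1 ∉ Z)
    (hθp : θ.1 ∉ p.support.tail) (hcomp : comp G u θ = comp G u (v, b))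
    (hodd : Odd p.length ↔ b = φ e) : False := by
  -- The path is followed in the double cover: `b` is the current copy and `θ` a lonely vertex of
  -- the current component. Where both copies of the next vertex survive, the twin edge changes `b`;
  -- where only the other copy survives, it becomes the new `θ`. A surviving copy `b` without twin
  -- would be a second lonely vertex of the component, and so is the end `e`, which by parity is
  -- reached in the copy `φ e`.
  induction p generalizing b θ with
  | nil => exact hve rfl
  | @cons v w e h q ih =>
    rw [SimpleGraph.Walk.cons_isPath_iff] at hp
    simp only [SimpleGraph.Walk.support_cons, List.tail_cons] at hA hθp
    simp only [SimpleGraph.Walk.support_cons, List.mem_cons, forall_eq_or_imp] at hpZ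
    have hwZ := hpZ.2 w q.start_mem_support
    have hwgone : ∃ c, Surv u (w, c) := by
      by_contra hcon
      push Not at hcon
      exact hwZ (hZ (Finset.mem_filter.2 ⟨Finset.mem_univ _, hcon⟩))
    have hadj : ∀ c, Surv u (v, c) → Surv u (w, c) → comp G u (v, c) = comp G u (w, c) :=
      fun c h1 h2 => comp_eq_of_adj h1 h2 (Or.inl ⟨rfl, h⟩)
    by_cases hwe : w = e
    · subst hwe
      have hq : q.length = 0 := SimpleGraph.Walk.length_eq_zero_iff.2 (SimpleGraph.Walk.isPath_iff_nil.1 hp.1)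
      simp only [SimpleGraph.Walk.length_cons, hq, zero_add, odd_one, true_iff] at hodd
      obtain ⟨c, hc⟩ := hwgone
      have hcb : c = b := by rw [hodd]; exact hc.choose he
      subst hcb
      have hl : (w, c) ∈ lonely u := by
        refine mem_lonely.2 ⟨hc, fun ⟨h, _⟩ => ?_⟩
        have := h he
        simp only [← hodd] at this
        exact absurd this (by cases c <;> simp)
      have := hsep θ hθ _ hl hθZ hwZ (hcomp.trans (hadj c hb hc))
      apply hθp
      rw [this]
      exact q.start_mem_support
    · have hwA : w ∉ A := fun hwA => hwe (hA w q.start_mem_support hwA)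
      have hodd' : Odd q.length ↔ (!b) = φ e := by
        rw [SimpleGraph.Walk.length_cons, Nat.odd_add_one] at hodd
        rw [← not_iff_not, hodd]
        cases b <;> cases φ e <;> simp
      have hA' : ∀ x ∈ q.support.tail, x ∈ A → x = e := fun x hx => hA x (List.mem_of_mem_tail hx)
      have hqnd := hp.1.support_nodup
      rw [← q.cons_tail_support, List.nodup_cons] at hqnd
      by_cases h1 : Surv u (w, b)
      · by_cases h2 : Surv u (w, !b)
        · refine ih hp.1 hwe he hA' hpZ.2 (!b) h2 θ hθ hθZ (fun h => hθp (List.mem_of_mem_tail h)) ?_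
            hodd'
          rw [hcomp, hadj b hb h1]
          exact comp_eq_of_adj h1 h2 (Or.inr ⟨rfl, by simp⟩)
        · have := hsep θ hθ _ (mem_lonely.2 ⟨h1, h2⟩) hθZ hwZ (hcomp.trans (hadj b hb h1))
          apply hθp
          rw [this]
          exact q.start_mem_support
      · obtain ⟨c, hc⟩ := hwgone
        have hcb : c = !b := by
          have : c ≠ b := fun e => h1 (e ▸ hc)
          have hbool : ∀ b c : Bool, c ≠ b → c = !b := by decide
          exact hbool _ _ this
        subst hcb
        refine ih hp.1 hwe he hA' hpZ.2 (!b) hc (w, !b) (mem_lonely.2 ⟨hc, by simpa using h1⟩) hwZ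
          hqnd.1 rfl hodd'

end Violator
end OddPaths

/-! ### The min-max theorem for odd `A`-paths. -/

section OddPathsTheorem
open scoped Classical
variable {V : Type*} {G : SimpleGraph V} {A : Finset V} {φ : V → Bool} {d : ℕ}
  {u : Set (Cover A φ ⊕ Fin d)}

theorem surv_of_comp_eq {x : V × Bool} {K : (coverRest G A φ u).ConnectedComponent}
    (h : comp G u x = some K) : Surv u x := by
  by_contra hx
  rw [comp, dif_neg hx] at h
  cases h

variable [Fintype V]

theorem even_card_cover {m : ℕ} (hd : A.card = d + 2 * m) : Even (Nat.card (Cover A φ ⊕ Fin d)) := by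
  have h : (Finset.univ.filter fun x : V × Bool => ¬ (x.1 ∈ A → x.2 = φ x.1)).card = A.card := by
    refine (Finset.card_bij (fun a _ => (a, !φ a)) ?_ ?_ ?_).symm
    · intro a ha
      simp [ha]
    · intro a _ b _ h; exact (Prod.ext_iff.1 h).1
    · rintro ⟨a, b⟩ hx
      simp only [Finset.mem_filter, Finset.mem_univ, true_and, Classical.not_imp] at hx
      refine ⟨a, hx.1, ?_⟩
      have hb : ∀ b c : Bool, b ≠ c → (!c) = b := by decide
      rw [hb _ _ hx.2]
  have h2 := Finset.card_filter_add_card_filter_not (s := (Finset.univ : Finset (V × Bool)))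
    (fun x => x.1 ∈ A → x.2 = φ x.1)
  rw [h, Finset.card_univ, Fintype.card_prod, Fintype.card_bool, hd] at h2
  rw [Nat.card_eq_fintype_card, Fintype.card_sum, Fintype.card_fin, Fintype.card_subtype,
    Nat.even_iff]
  omega

/-- A surviving universal vertex keeps the rest connected, so a violator would be empty and the
number of vertices odd. But it is `2|V| - |A| + d`, which is even. -/
theorem range_inr_subset {m : ℕ} (hd : A.card = d + 2 * m)
    (hu : (coverGraph G A φ d).IsTutteViolator u) (i : Fin d) : Sum.inr i ∈ u := by
  by_contra hi
  rw [SimpleGraph.IsTutteViolator] at hu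
  change u.ncard < (coverRest G A φ u).oddComponents.ncard at hu
  have hsub : ∀ K : (coverRest G A φ u).ConnectedComponent,
      K = (coverRest G A φ u).connectedComponentMk ⟨.inr i, by simpa using hi⟩ := by
    refine SimpleGraph.ConnectedComponent.ind fun v => ?_
    by_cases hv : v.1 = .inr i
    · congr 1
      exact Subtype.ext hv
    · apply SimpleGraph.ConnectedComponent.connectedComponentMk_eq_of_adj
      simp only [SimpleGraph.Subgraph.coe_adj, SimpleGraph.Subgraph.deleteVerts_adj,
        SimpleGraph.Subgraph.verts_top, SimpleGraph.Subgraph.top_adj, Set.mem_univ, true_and]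
      exact ⟨by simpa using v.2, hi, hv, fun x y _ h => by cases h⟩
  have : Subsingleton (coverRest G A φ u).ConnectedComponent :=
    ⟨fun K L => (hsub K).trans (hsub L).symm⟩
  have hle := Set.ncard_le_one_of_subsingleton (coverRest G A φ u).oddComponents
  have hu0 : u.ncard = 0 := by omega
  have hodd : Odd (coverRest G A φ u).oddComponents.ncard := by
    rw [show (coverRest G A φ u).oddComponents.ncard = 1 by omega]
    exact odd_one
  rw [SimpleGraph.odd_ncard_oddComponents] at hodd
  rw [Set.ncard_eq_zero] at hu0
  subst hu0
  have hcard := even_card_cover (φ := φ) hd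
  rw [← Nat.not_odd_iff_even] at hcard
  apply hcard
  convert hodd using 1
  refine Nat.card_congr (Equiv.symm (Equiv.subtypeUnivEquiv fun x => ?_))
  simp

/-- Otherwise exchanging twins would be a fixed-point-free involution of the component. -/
theorem exists_lonely_of_odd (hu : ∀ i, Sum.inr i ∈ u)
    {K : (coverRest G A φ u).ConnectedComponent} (hK : Odd K.supp.ncard) :
    ∃ x ∈ lonely u, comp G u x = some K := by
  by_contra hcon
  push Not at hcon
  have htwin : ∀ x : V × Bool, comp G u x = some K → comp G u (x.1, !x.2) = some K := by
    intro x hx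
    have h1 := surv_of_comp_eq hx
    have h2 : Surv u (x.1, !x.2) := by
      by_contra h
      exact hcon x (mem_lonely.2 ⟨h1, h⟩) hx
    rw [← hx]
    refine comp_eq_of_adj h2 h1 (Or.inr ⟨rfl, fun h => ?_⟩)
    have := (Prod.ext_iff.1 h).2
    simp at this
  have heven := even_card_of_involution
    (Finset.univ.filter fun x : V × Bool => comp G u x = some K) (fun x => (x.1, !x.2))
    (fun x hx => by simpa using htwin x (by simpa using hx)) (fun x _ => by simp)
    (fun x _ h => by have := (Prod.ext_iff.1 h).2; simp at this)
  rw [← Nat.not_odd_iff_even] at heven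
  apply heven
  rw [← Set.ncard_coe_finset]
  convert hK using 1
  refine Set.ncard_congr (fun x hx => ⟨.inl ⟨x, (surv_of_comp_eq (K := K) (by simpa using hx)).choose⟩,
    by simpa using (surv_of_comp_eq (K := K) (by simpa using hx)).choose_spec⟩) ?_ ?_ ?_
  · intro x hx
    have hx' : comp G u x = some K := by simpa using hx
    rw [comp_eq (surv_of_comp_eq hx'), Option.some_inj] at hx'
    exact hx'
  · intro x y hx hy h
    rw [Subtype.mk.injEq, Sum.inl.injEq, Subtype.mk.injEq] at h
    exact h
  · rintro ⟨v | i, hv⟩ hvK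
    · have hs : Surv u v.1 := ⟨v.2, by simpa using hv⟩
      have : comp G u v.1 = some K := by
        rw [comp_eq hs, Option.some_inj]
        exact hvK
      exact ⟨v.1, by simpa using this, rfl⟩
    · simp only [SimpleGraph.Subgraph.induce_verts] at hv
      exact absurd (hu i) hv.2

/-- Charge each vertex counted on the left to itself if it is in `A`, and otherwise to a deleted
copy. The universal vertices account for `d` elements of `u`. -/
theorem card_gone_add_card_lonely_le (hu : ∀ i, Sum.inr i ∈ u) :
    (gone u).card + (lonely u).card + d ≤ A.card + u.ncard := by
  set Uc : Finset (Cover A φ) := Finset.univ.filter fun x => Sum.inl x ∈ u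
  have hUc : Uc.card + d ≤ u.ncard := by
    have h : ((Uc.disjSum (Finset.univ : Finset (Fin d)) : Finset _) : Set (Cover A φ ⊕ Fin d)) ⊆ u := by
      rintro (x | i) hx
      · simpa [Uc] using hx
      · exact hu i
    have := Set.ncard_le_ncard h
    rw [Set.ncard_coe_finset, Finset.card_disjSum, Finset.card_univ, Fintype.card_fin] at this
    exact this
  set U : Finset (V × Bool) := Uc.image Subtype.val
  have hU : U.card = Uc.card := Finset.card_image_of_injective _ Subtype.val_injective
  have hmem : ∀ v b, v ∉ A → ¬ Surv u (v, b) → (v, b) ∈ U := by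
    intro v b hv h
    refine Finset.mem_image.2 ⟨⟨(v, b), fun h => absurd h hv⟩, ?_, rfl⟩
    refine Finset.mem_filter.2 ⟨Finset.mem_univ _, ?_⟩
    by_contra hn
    exact h ⟨_, hn⟩
  have hgl : ∀ x ∈ lonely u, x.1 ∉ gone u := fun x hx h =>
    (Finset.mem_filter.1 h).2 x.2 (mem_lonely.1 hx).1
  have hgone : ∀ v ∈ gone u, ∀ b, ¬ Surv u (v, b) := fun v hv => (Finset.mem_filter.1 hv).2
  have : ((gone u).disjSum (lonely u)).card ≤ (A.disjSum U).card := by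
    refine Finset.card_le_card_of_injOn (fun z => match z with
      | .inl v => if v ∈ A then .inl v else .inr (v, true)
      | .inr x => if x.1 ∈ A then .inl x.1 else .inr (x.1, !x.2)) ?_ ?_
    · rintro (v | x) hz
      · have hv : v ∈ gone u := by simpa using hz
        by_cases hA : v ∈ A
        · simp [hA]
        · simpa [hA] using hmem v true hA (hgone v hv true)
      · have hx : x ∈ lonely u := by simpa using hz
        by_cases hA : x.1 ∈ A
        · simp [hA]
        · simpa [hA] using hmem x.1 (!x.2) hA (mem_lonely.1 hx).2
    · rintro (v | x) hz (w | y) hz' h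
      · by_cases hA : v ∈ A <;> by_cases hA' : w ∈ A <;> simp [hA, hA'] at h ⊢ <;> exact h
      · have hv : v ∈ gone u := by simpa using hz
        have hy : y ∈ lonely u := by simpa using hz'
        have hne : v ≠ y.1 := fun e => hgl y hy (e ▸ hv)
        by_cases hA : v ∈ A <;> by_cases hA' : y.1 ∈ A <;> simp [hA, hA', hne] at h
      · have hv : w ∈ gone u := by simpa using hz'
        have hy : x ∈ lonely u := by simpa using hz
        have hne : x.1 ≠ w := fun e => hgl x hy (e ▸ hv)
        by_cases hA : x.1 ∈ A <;> by_cases hA' : w ∈ A <;> simp [hA, hA', hne] at h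
      · have hx : x ∈ lonely u := by simpa using hz
        have hy : y ∈ lonely u := by simpa using hz'
        obtain ⟨hx1, -⟩ := (mem_lonely.1 hx).1
        obtain ⟨hy1, -⟩ := (mem_lonely.1 hy).1
        by_cases hA : x.1 ∈ A <;> by_cases hA' : y.1 ∈ A <;> simp [hA, hA'] at h
        · rw [Sum.inr.injEq]
          exact Prod.ext h (by rw [hx1 hA, hy1 hA', h])
        · rw [Sum.inr.injEq]
          exact Prod.ext h.1 h.2
  rw [Finset.card_disjSum, Finset.card_disjSum, hU] at this
  omega

/-- Either there are `m` disjoint odd `A`-paths or fewer than `2m` vertices meet all of them. -/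
theorem disjoint_oddAPaths_or_hitting (G : SimpleGraph V) (A : Finset V) (φ : V → Bool) (m : ℕ)
    (hA : 2 * m ≤ A.card) :
    (∃ (c e : Fin m → V) (p : ∀ i, G.Walk (c i) (e i)), (∀ i, IsOddAPath A φ (p i)) ∧
      ∀ i j, i ≠ j → ∀ w ∈ (p i).support, w ∉ (p j).support) ∨
    ∃ Z : Finset V, Z.card < 2 * m ∧ ∀ c e (p : G.Walk c e), IsOddAPath A φ p → ∃ x ∈ p.support, x ∈ Z := by
  obtain ⟨d, hd⟩ : ∃ d, A.card = d + 2 * m := ⟨A.card - 2 * m, by omega⟩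
  by_cases hpm : ∃ M : (coverGraph G A φ d).Subgraph, M.IsPerfectMatching
  · obtain ⟨M, hM⟩ := hpm
    exact Or.inl (exists_oddAPaths_of_isPerfectMatching hM hd)
  right
  rw [SimpleGraph.tutte] at hpm
  push Not at hpm
  obtain ⟨u, hu⟩ := hpm
  have hr := range_inr_subset hd hu
  have hcard := card_gone_add_card_lonely_le hr
  rw [SimpleGraph.IsTutteViolator] at hu
  change u.ncard < (coverRest G A φ u).oddComponents.ncard at hu
  have hq : (coverRest G A φ u).oddComponents.ncard ≤ ((lonely u).image (comp G u)).card := by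
    rw [← Set.ncard_coe_finset]
    refine Set.ncard_le_ncard_of_injOn some ?_ (Option.some_injective _).injOn
    intro K hK
    obtain ⟨x, hx, hxK⟩ := exists_lonely_of_odd hr hK
    exact Finset.mem_coe.2 (Finset.mem_image.2 ⟨x, hx, hxK⟩)
  -- `R` keeps one lonely vertex per component; the hitting set consists of `gone u` and the other
  -- lonely vertices. As `|R| > |u|`, it has fewer than `|A| - d = 2m` vertices.
  obtain ⟨R, hRl, hRinj, hRim⟩ := Finset.exists_subset_injOn_image_eq_of_surjOn (f := comp G u)
    (lonely u : Set (V × Bool)) ((lonely u).image (comp G u)) (by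
      rw [Finset.coe_image]; exact Set.surjOn_image _ _)
  have hRc : R.card = ((lonely u).image (comp G u)).card := by
    rw [← hRim, Finset.card_image_of_injOn hRinj]
  have hRl' : R ⊆ lonely u := fun x hx => by simpa using hRl hx
  refine ⟨gone u ∪ (lonely u \ R).image Prod.fst, ?_, ?_⟩
  · have h1 := Finset.card_union_le (gone u) ((lonely u \ R).image Prod.fst)
    have h2 := Finset.card_image_le (s := lonely u \ R) (f := Prod.fst)
    have h3 := Finset.card_sdiff_add_card_eq_card hRl'
    omega
  · intro c e p hp
    by_contra hcon
    push Not at hcon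
    obtain ⟨hpath, hc, he, hce, hint, hodd⟩ := hp
    have hnd := hpath.support_nodup
    rw [← p.cons_tail_support, List.nodup_cons] at hnd
    have hcZ := hcon c p.start_mem_support
    have hlR : ∀ x ∈ lonely u, x.1 ∉ gone u ∪ (lonely u \ R).image Prod.fst → x ∈ R := by
      intro x hx hxZ
      by_contra hxR
      exact hxZ (Finset.mem_union_right _ (Finset.mem_image_of_mem _ (Finset.mem_sdiff.2 ⟨hx, hxR⟩)))
    have hcs : ∃ b, Surv u (c, b) := by
      by_contra h
      push Not at h
      exact hcZ (Finset.mem_union_left _ (Finset.mem_filter.2 ⟨Finset.mem_univ _, h⟩))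
    obtain ⟨b, hb⟩ := hcs
    have hbc : b = φ c := hb.choose hc
    subst hbc
    refine no_oddAPath_of_separated (G := G) (u := u) Finset.subset_union_left ?_ p hpath hce he ?_
      hcon (φ c) hb (c, φ c) (mem_lonely.2 ⟨hb, fun h => ?_⟩) hcZ hnd.1 rfl hodd
    · intro x hx y hy hxZ hyZ h
      exact hRinj (hlR x hx hxZ) (hlR y hy hyZ) h
    · intro x hx hxA
      exact (hint x (List.mem_of_mem_tail hx) hxA).resolve_left fun h => hnd.1 (h ▸ hx)
    · have := h.choose hc
      simp at this

end OddPathsTheorem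

/-! ### Assembling odd `S`-cycles from ears, odd paths and links. -/

section Assembly
open scoped Classical
variable {V : Type*} {G K : SimpleGraph V} {W : Finset V} {ψ : V → Bool} {S : Set V}

theorem isPath_append {a b c : V} {p : G.Walk a b} {q : G.Walk b c} (hp : p.IsPath) (hq : q.IsPath)
    (h : ∀ x ∈ p.support, x ∈ q.support → x = b) : (p.append q).IsPath := by
  rw [SimpleGraph.Walk.isPath_def, SimpleGraph.Walk.support_append, List.nodup_append']
  have hnd := hq.support_nodup
  rw [← q.cons_tail_support, List.nodup_cons] at hnd
  refine ⟨hp.support_nodup, hnd.2, fun x hx hx' => ?_⟩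
  exact hnd.1 (h x hx (List.mem_of_mem_tail hx') ▸ hx')

/-- Odd length excludes the walk that goes forth and back along one edge. -/
theorem isCycle_append_of_odd {a b : V} {p : G.Walk a b} {q : G.Walk b a} (hp : p.IsPath)
    (hq : q.IsPath) (hab : a ≠ b) (h : ∀ x ∈ p.support, x ∈ q.support → x = a ∨ x = b)
    (hodd : Odd (p.append q).length) : (p.append q).IsCycle := by
  have hnp := hp.support_nodup
  rw [← p.cons_tail_support, List.nodup_cons] at hnp
  have hnq := hq.support_nodup
  rw [← q.cons_tail_support, List.nodup_cons] at hnq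
  refine hp.isCycle_append hq (fun x hx hx' => ?_) ?_
  · rcases h x (List.mem_of_mem_tail hx) (List.mem_of_mem_tail hx') with rfl | rfl
    · exact hnp.1 hx
    · exact hnq.1 hx'
  · have h1 : p.length ≠ 0 := fun h => hab (SimpleGraph.Walk.eq_of_length_eq_zero h)
    have h2 : q.length ≠ 0 := fun h => hab (SimpleGraph.Walk.eq_of_length_eq_zero h).symm
    rw [SimpleGraph.Walk.length_append, Nat.odd_iff] at hodd
    omega

/-- A path between distinct vertices of `W` that is otherwise outside `W`. -/
def IsEar (W : Finset V) {a b : V} (f : G.Walk a b) : Prop :=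
  f.IsPath ∧ a ∈ W ∧ b ∈ W ∧ a ≠ b ∧ ∀ x ∈ f.support, x ∈ W → x = a ∨ x = b

theorem odd_length_iff_of_bichromatic {C : Finset V}
    (hK : ∀ x ∈ C, ∀ y ∈ C, K.Adj x y → ψ x ≠ ψ y) {a b : V} (r : K.Walk a b)
    (hr : ∀ x ∈ r.support, x ∈ C) : Odd r.length ↔ ψ a ≠ ψ b := by
  induction r with
  | nil => simp
  | @cons u v w h q ih =>
    simp only [SimpleGraph.Walk.support_cons, List.mem_cons, forall_eq_or_imp] at hr
    have h1 := hK u hr.1 v (hr.2 v q.start_mem_support) h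
    rw [SimpleGraph.Walk.length_cons, Nat.odd_add_one, ih hr.2]
    have hbool : ∀ a b c : Bool, a ≠ b → (¬ (b ≠ c) ↔ a ≠ c) := by decide
    exact hbool _ _ _ h1

theorem Conn.exists_path {C : Finset V} {a b : V} (h : Conn K C a b) (hKG : K ≤ G)
    (hK : ∀ x ∈ C, ∀ y ∈ C, K.Adj x y → ψ x ≠ ψ y) :
    ∃ r : G.Walk a b, r.IsPath ∧ (∀ x ∈ r.support, x ∈ C) ∧ (Odd r.length ↔ ψ a ≠ ψ b) := by
  obtain ⟨w, hw⟩ := h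
  have hb : ∀ x ∈ w.bypass.support, x ∈ C := fun x hx => hw x (w.support_bypass_subset_support hx)
  refine ⟨w.bypass.mapLe hKG, w.bypass_isPath.mapLe _, ?_, ?_⟩
  · rwa [SimpleGraph.Walk.support_mapLe_eq_support]
  · rw [SimpleGraph.Walk.length_map]
    exact odd_length_iff_of_bichromatic hK _ hb

/-- The set `D` can be completed to an odd `S`-cycle by at most two links in `K[W]`. -/
def Completable (G K : SimpleGraph V) (S : Set V) (W D : Finset V) : Prop :=
  ∃ M : Finset (V × V), M.card ≤ 2 ∧ (∀ p ∈ M, (p.1 ∈ D ∧ p.1 ∈ W) ∧ p.2 ∈ D ∧ p.2 ∈ W) ∧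
    DisjointPairs M ∧ (∀ x ∈ D, x ∈ W → ∃ p ∈ M, x = p.1 ∨ x = p.2) ∧
    ∀ C : V × V → Finset V, (∀ p ∈ M, C p ⊆ W ∧ Conn K (C p) p.1 p.2) →
      (∀ p ∈ M, ∀ q ∈ M, p ≠ q → Disjoint (C p) (C q)) →
      ∃ v, ∃ c : G.Walk v v, IsOddSCycle S c ∧ ∀ x ∈ c.support, x ∈ D ∨ ∃ p ∈ M, x ∈ C p

/-- One link closes the path. Its parity agrees with the end colours and that of the path does not,
so the cycle is odd. -/
theorem completable_of_isOddAPath (hKG : K ≤ G) (hK : ∀ x ∈ W, ∀ y ∈ W, K.Adj x y → ψ x ≠ ψ y)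
    {a b : V} {f : G.Walk a b} (hf : IsOddAPath W ψ f) (hS : ∃ s ∈ S, s ∈ f.support) :
    Completable G K S W f.support.toFinset := by
  obtain ⟨hp, ha, hb, hab, hW, hodd⟩ := hf
  refine ⟨{(b, a)}, by simp, ?_, ?_, ?_, ?_⟩
  · simp [ha, hb]
  · intro p hp q hq hne
    rw [Finset.mem_singleton] at hp hq
    exact absurd (hp.trans hq.symm) hne
  · intro x hx hxW
    rw [List.mem_toFinset] at hx
    simpa [or_comm] using hW x hx hxW
  · intro C hC _
    obtain ⟨hCW, hconn⟩ := hC (b, a) (by simp)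
    obtain ⟨r, hr, hrC, hrodd⟩ := hconn.exists_path hKG
      fun x hx y hy => hK x (hCW hx) y (hCW hy)
    have hlen : Odd (f.append r).length := by
      rw [SimpleGraph.Walk.length_append, Nat.odd_add, ← Nat.not_odd_iff_even, hodd, hrodd]
      simp [eq_comm]
    refine ⟨a, f.append r, ⟨isCycle_append_of_odd hp hr hab
      (fun x hx hx' => hW x hx (hCW (hrC x hx'))) hlen, hlen, ?_⟩, ?_⟩
    · obtain ⟨s, hs, hsf⟩ := hS
      exact ⟨s, hs, (SimpleGraph.Walk.mem_support_append_iff _ _).2 (Or.inl hsf)⟩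
    · intro x hx
      rcases (SimpleGraph.Walk.mem_support_append_iff _ _).1 hx with h | h
      · exact Or.inl (by simpa using h)
      · exact Or.inr ⟨_, by simp, hrC x h⟩

/-- If the parity of the ear disagrees with its end colours, the ear suffices. Otherwise two links,
from `b` to `c` and from `d` to `a`, join it with `g` into one cycle, in which `g` is the only piece
that disagrees with the colours. -/
theorem completable_of_isEar (hKG : K ≤ G) (hK : ∀ x ∈ W, ∀ y ∈ W, K.Adj x y → ψ x ≠ ψ y)
    {a b c d : V} {f : G.Walk a b} (hf : IsEar W f) (hS : ∃ s ∈ S, s ∈ f.support)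
    {g : G.Walk c d} (hg : IsOddAPath W ψ g) (hfg : ∀ x ∈ f.support, x ∉ g.support) :
    ∃ D ⊆ f.support.toFinset ∪ g.support.toFinset, Completable G K S W D := by
  by_cases hfo : Odd f.length ↔ ψ a = ψ b
  · exact ⟨_, Finset.subset_union_left, completable_of_isOddAPath (ψ := ψ) hKG hK
      ⟨hf.1, hf.2.1, hf.2.2.1, hf.2.2.2.1, hf.2.2.2.2, hfo⟩ hS⟩
  refine ⟨_, subset_rfl, ?_⟩
  obtain ⟨hp, ha, hb, hab, hW⟩ := hf
  obtain ⟨hpg, hc, hd, hcd, hWg, hodd⟩ := hg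
  have hac : a ≠ c := fun h => hfg a f.start_mem_support (h ▸ g.start_mem_support)
  have had : a ≠ d := fun h => hfg a f.start_mem_support (h ▸ g.end_mem_support)
  have hbc : b ≠ c := fun h => hfg b f.end_mem_support (h ▸ g.start_mem_support)
  have hbd : b ≠ d := fun h => hfg b f.end_mem_support (h ▸ g.end_mem_support)
  refine ⟨{(b, c), (d, a)}, Finset.card_le_two, ?_, ?_, ?_, ?_⟩
  · simp [ha, hb, hc, hd]
  · intro p hp q hq hne
    simp only [Finset.mem_insert, Finset.mem_singleton] at hp hq
    rcases hp with rfl | rfl <;> rcases hq with rfl | rfl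
    · exact absurd rfl hne
    · exact ⟨hbd, hab.symm, hcd, hac.symm⟩
    · exact ⟨hbd.symm, hcd.symm, hab, hac⟩
    · exact absurd rfl hne
  · intro x hx hxW
    rw [Finset.mem_union, List.mem_toFinset, List.mem_toFinset] at hx
    simp only [Finset.mem_insert, Finset.mem_singleton, exists_eq_or_imp, exists_eq_left]
    rcases hx with hx | hx
    · rcases hW x hx hxW with h | h <;> simp [h]
    · rcases hWg x hx hxW with h | h <;> simp [h]
  · intro C hC hdis
    obtain ⟨hCW, hconn⟩ := hC (b, c) (by simp)
    obtain ⟨hCW', hconn'⟩ := hC (d, a) (by simp)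
    have hCC : ∀ x ∈ C (b, c), x ∉ C (d, a) := fun x hx => Finset.disjoint_left.1
      (hdis (b, c) (by simp) (d, a) (by simp) fun h => hbd (Prod.ext_iff.1 h).1) hx
    obtain ⟨r, hr, hrC, hrodd⟩ := hconn.exists_path hKG
      fun x hx y hy => hK x (hCW hx) y (hCW hy)
    obtain ⟨r', hr', hrC', hrodd'⟩ := hconn'.exists_path hKG
      fun x hx y hy => hK x (hCW' hx) y (hCW' hy)
    have h1 : (f.append r).IsPath := isPath_append hp hr fun x hx hx' =>
      (hW x hx (hCW (hrC x hx'))).resolve_left fun h => hCC x (hrC x hx') (h ▸ hconn'.right)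
    have h2 : ((f.append r).append g).IsPath := by
      refine isPath_append h1 hpg fun x hx hx' => ?_
      rcases (SimpleGraph.Walk.mem_support_append_iff _ _).1 hx with h | h
      · exact absurd hx' (hfg x h)
      · exact (hWg x hx' (hCW (hrC x h))).resolve_right fun e => hCC x (hrC x h) (e ▸ hconn'.left)
    have hlen : Odd (((f.append r).append g).append r').length := by
      have e : ∀ n m : ℕ, Odd (n + m) ↔ (Odd n ↔ ¬ Odd m) := fun n m => by
        rw [Nat.odd_add, Nat.not_odd_iff_even]
      rw [SimpleGraph.Walk.length_append, SimpleGraph.Walk.length_append,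
        SimpleGraph.Walk.length_append, e, e, e, hodd, hrodd, hrodd']
      have hbool : ∀ (P : Prop) (a b c d : Bool), ¬ (P ↔ a = b) →
          ((((P ↔ ¬ (b ≠ c)) ↔ ¬ (c = d)) ↔ ¬ (d ≠ a))) := by
        intro P a b c d
        by_cases hP : P <;> simp only [hP] <;> revert a b c d <;> decide
      exact hbool _ _ _ _ _ hfo
    refine ⟨a, _, ⟨isCycle_append_of_odd h2 hr' had (fun x hx hx' => ?_) hlen, hlen, ?_⟩, ?_⟩
    · have hxC := hrC' x hx'
      rcases (SimpleGraph.Walk.mem_support_append_iff _ _).1 hx with h | h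
      · rcases (SimpleGraph.Walk.mem_support_append_iff _ _).1 h with h | h
        · exact Or.inl ((hW x h (hCW' hxC)).resolve_right fun e => hCC x (e ▸ hconn.left) hxC)
        · exact absurd hxC (hCC x (hrC x h))
      · exact Or.inr ((hWg x h (hCW' hxC)).resolve_left fun e => hCC x (e ▸ hconn.right) hxC)
    · obtain ⟨s, hs, hsf⟩ := hS
      exact ⟨s, hs, by simp only [SimpleGraph.Walk.mem_support_append_iff]; simp [hsf]⟩
    · intro x hx
      simp only [SimpleGraph.Walk.mem_support_append_iff] at hx
      rcases hx with ((h | h) | h) | h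
      · exact Or.inl (by simp [h])
      · exact Or.inr ⟨_, by simp, hrC x h⟩
      · exact Or.inl (by simp [h])
      · exact Or.inr ⟨(d, a), by simp, hrC' x h⟩

/-- All links, at most `2k`, are requested at once. A vertex of `D' i` on a link lies in `W`, so it
is an end of a pair in `M i`, and that link belongs to cycle `i`. -/
theorem hasDisjointOddSCycles_of_completable {k : ℕ} (D : Fin k → Finset V)
    (hD : ∀ i j, i ≠ j → Disjoint (D i) (D j)) (hc : ∀ i, ∃ D' ⊆ D i, Completable G K S W D')
    (hlink : ∀ M : Finset (V × V), (∀ p ∈ M, p.1 ∈ W ∧ p.2 ∈ W) → DisjointPairs M →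
      M.card ≤ 2 * k → Linkable K W M) : HasDisjointOddSCycles G S k := by
  choose D' hD' hc using hc
  replace hD : ∀ i j, i ≠ j → ∀ x ∈ D' i, x ∉ D' j := fun i j hij x hx hx' =>
    Finset.disjoint_left.1 (hD i j hij) (hD' i hx) (hD' j hx')
  choose M hM2 hMD hMdis hMW hclose using hc
  have hcross : ∀ i j, ∀ p ∈ M i, ∀ q ∈ M j, i ≠ j →
      p.1 ≠ q.1 ∧ p.1 ≠ q.2 ∧ p.2 ≠ q.1 ∧ p.2 ≠ q.2 := by
    intro i j p hp q hq hij
    obtain ⟨⟨h1, -⟩, h2, -⟩ := hMD i p hp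
    obtain ⟨⟨h3, -⟩, h4, -⟩ := hMD j q hq
    have h := hD i j hij
    exact ⟨fun e => h _ h1 (e ▸ h3), fun e => h _ h1 (e ▸ h4), fun e => h _ h2 (e ▸ h3),
      fun e => h _ h2 (e ▸ h4)⟩
  obtain ⟨C, hC, hCdis⟩ := hlink (Finset.univ.biUnion M)
    (fun p hp => by
      obtain ⟨i, -, hp⟩ := Finset.mem_biUnion.1 hp
      exact ⟨(hMD i p hp).1.2, (hMD i p hp).2.2⟩)
    (fun p hp q hq hne => by
      obtain ⟨i, -, hp⟩ := Finset.mem_biUnion.1 hp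
      obtain ⟨j, -, hq⟩ := Finset.mem_biUnion.1 hq
      by_cases hij : i = j
      · subst hij
        exact hMdis i p hp q hq hne
      · exact hcross i j p hp q hq hij)
    (by
      refine Finset.card_biUnion_le.trans ((Finset.sum_le_sum fun i _ => hM2 i).trans ?_)
      simp [mul_comm])
  have hmem : ∀ i, ∀ p ∈ M i, p ∈ Finset.univ.biUnion M := fun i p hp =>
    Finset.mem_biUnion.2 ⟨i, Finset.mem_univ _, hp⟩
  have hCC : ∀ i j, i ≠ j → ∀ p ∈ M i, ∀ q ∈ M j, ∀ x ∈ C p, x ∉ C q := by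
    intro i j hij p hp q hq x hx
    refine Finset.disjoint_left.1 (hCdis p (hmem i p hp) q (hmem j q hq) fun e => ?_) hx
    exact (hcross i j p hp q hq hij).1 (by rw [e])
  have hDC : ∀ i j, i ≠ j → ∀ x ∈ D' i, ∀ q ∈ M j, x ∉ C q := by
    intro i j hij x hx q hq hxq
    obtain ⟨p, hp, hxp⟩ := hMW i x hx ((hC q (hmem j q hq)).1 hxq)
    have hconn := (hC p (hmem i p hp)).2
    refine hCC i j hij p hp q hq x ?_ hxq
    rcases hxp with rfl | rfl
    · exact hconn.left
    · exact hconn.right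
  have hcyc := fun i => hclose i C (fun p hp => hC p (hmem i p hp))
    fun p hp q hq => hCdis p (hmem i p hp) q (hmem i q hq)
  choose v c hodd hsupp using hcyc
  refine ⟨v, c, hodd, fun i j hij x hx hx' => ?_⟩
  rcases hsupp i x hx with h | ⟨p, hp, h⟩ <;> rcases hsupp j x hx' with h' | ⟨q, hq, h'⟩
  · exact hD i j hij x h h'
  · exact hDC i j hij x h q hq h'
  · exact hDC j i hij.symm x h' p hp h
  · exact hCC i j hij p hp q hq x h h'

end Assembly

/-! ### Linkages in highly connected graphs. -/

section Core
open scoped Classical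
variable {V : Type*} {G K : SimpleGraph V} {W A B X : Finset V} {n k : ℕ}

theorem Sep.mem_sdiff_of_conn {C : Finset V} {a b : V} (h : Sep G W A B) (hc : Conn G C a b)
    (hC : ∀ x ∈ C, x ∈ W ∧ x ∉ A ∩ B) (ha : a ∈ A) : b ∈ A := by
  obtain ⟨w, hw⟩ := hc
  induction w with
  | nil => exact ha
  | @cons u v w hadj q ih =>
    simp only [SimpleGraph.Walk.support_cons, List.mem_cons, forall_eq_or_imp] at hw
    refine ih ?_ hw.2
    have hu := hC u hw.1
    have hv := hC v (hw.2 v q.start_mem_support)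
    by_contra hvA
    have hvB := (h.mem_or hv.1).resolve_left hvA
    exact h.2 u ha v hvB (fun huB => hu.2 (Finset.mem_inter.2 ⟨ha, huB⟩)) hvA hadj

theorem exists_injective_choice {ι : Type*} [Fintype ι] (N : ι → Finset V)
    (h : ∀ i, Fintype.card ι ≤ (N i).card) : ∃ f : ι → V, Function.Injective f ∧ ∀ i, f i ∈ N i := by
  refine (Finset.all_card_le_biUnion_card_iff_exists_injective N).1 fun s => ?_
  rcases s.eq_empty_or_nonempty with rfl | ⟨i, hi⟩
  · simp
  · exact (Finset.card_le_univ s).trans ((h i).trans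
      (Finset.card_le_card (Finset.subset_biUnion_of_mem N hi)))

/-- `2k` pairs have at most `4k` ends, so `Massed.linked` is used with `t = 2k`. -/
theorem linkable_of_massed [Finite V] (hk : 1 ≤ k) (hW : 4 * k ≤ W.card)
    (hm : ∀ X ⊆ W, X.card = 4 * k → Massed (2 * k) K W X) (M : Finset (V × V))
    (hM : ∀ p ∈ M, p.1 ∈ W ∧ p.2 ∈ W) (hd : DisjointPairs M) (hc : M.card ≤ 2 * k) :
    Linkable K W M := by
  have hE : M.image Prod.fst ∪ M.image Prod.snd ⊆ W := by
    intro x hx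
    simp only [Finset.mem_union, Finset.mem_image] at hx
    rcases hx with ⟨p, hp, rfl⟩ | ⟨p, hp, rfl⟩
    exacts [(hM p hp).1, (hM p hp).2]
  have hEc : (M.image Prod.fst ∪ M.image Prod.snd).card ≤ 4 * k := by
    have h1 := Finset.card_union_le (M.image Prod.fst) (M.image Prod.snd)
    have h2 := Finset.card_image_le (s := M) (f := Prod.fst)
    have h3 := Finset.card_image_le (s := M) (f := Prod.snd)
    omega
  obtain ⟨X, hEX, hXW, hX⟩ := Finset.exists_subsuperset_card_eq hE hEc hW
  refine Massed.linked (denseSetsContainLinked V (t := 2 * k) (by omega)) (by omega) _ K W X rfl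
    (by omega) (hm X hXW hX) M (fun p hp => ⟨hEX ?_, hEX ?_⟩) hd
  · exact Finset.mem_union_left _ (Finset.mem_image_of_mem _ hp)
  · exact Finset.mem_union_right _ (Finset.mem_image_of_mem _ hp)

theorem exists_walk_of_deleteVertices {a b : {v : V | v ∉ X}} (w : (deleteVertices G X).Walk a b) :
    ∃ w' : G.Walk a.1 b.1, w'.length = w.length ∧ ∀ x ∈ w'.support, x ∉ X := by
  induction w with
  | @nil u => exact ⟨.nil, rfl, fun x hx => by
      rw [SimpleGraph.Walk.support_nil, List.mem_singleton] at hx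
      exact hx ▸ u.2⟩
  | @cons u v w h q ih =>
    obtain ⟨q', hl, hs⟩ := ih
    have h' : G.Adj u.1 v.1 := h
    refine ⟨.cons h' q', by simp [hl], ?_⟩
    simp only [SimpleGraph.Walk.support_cons, List.mem_cons, forall_eq_or_imp]
    exact ⟨u.2, hs⟩

variable [Fintype V]

theorem IsVertexConnected.conn (hG : IsVertexConnected G n) (hX : X.card < n) {a b : V}
    (ha : a ∉ X) (hb : b ∉ X) : Conn G Xᶜ a b := by
  obtain ⟨w⟩ := (hG.2 X hX).preconnected ⟨a, ha⟩ ⟨b, hb⟩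
  obtain ⟨w', -, hw⟩ := exists_walk_of_deleteVertices w
  exact ⟨w', fun x hx => by simpa using hw x hx⟩

theorem IsVertexConnected.card_lt (hG : IsVertexConnected G n) : n < Fintype.card V := by
  rw [← Nat.card_eq_fintype_card]; exact hG.1

theorem IsVertexConnected.le_degree (hG : IsVertexConnected G n) (v : V) :
    n ≤ (Finset.univ.filter (G.Adj v)).card := by
  by_contra hlt
  push Not at hlt
  set N := Finset.univ.filter (G.Adj v)
  have hN : ∀ x, x ∈ N ↔ G.Adj v x := by simp [N]
  have hcard : (insert v N).card < (Finset.univ : Finset V).card := by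
    have := Finset.card_insert_le v N
    have := hG.card_lt
    rw [Finset.card_univ]
    omega
  obtain ⟨w, -, hw⟩ := Finset.exists_mem_notMem_of_card_lt_card hcard
  rw [Finset.mem_insert, not_or] at hw
  obtain ⟨p, hp⟩ := hG.conn hlt (a := v) (b := w) (fun h => G.loopless.irrefl v ((hN v).1 h)) hw.2
  cases p with
  | nil => exact hw.1 rfl
  | cons h q =>
    have := hp _ (List.mem_cons_of_mem _ q.start_mem_support)
    exact (Finset.mem_compl.1 this) ((hN _).2 h)

/-- A separation of small order of a large part of the graph is trivial. -/
theorem IsVertexConnected.sep_trivial (hG : IsVertexConnected G n) (h : Sep G W A B)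
    (hc : (Wᶜ ∪ A ∩ B).card < n) : A ⊆ B ∨ B ⊆ A := by
  by_contra hcon
  rw [not_or, Finset.not_subset, Finset.not_subset] at hcon
  obtain ⟨⟨a, haA, haB⟩, b, hbB, hbA⟩ := hcon
  have hW := h.subset_left haA
  have hW' := h.subset_right hbB
  refine hbA (h.mem_sdiff_of_conn (hG.conn hc (a := a) (b := b) ?_ ?_) ?_ haA)
  · simp [hW, haB]
  · simp [hW', hbA]
  · intro x hx
    simpa [imp_iff_not_or] using hx

/-- Degrees into `W` are at least `40k`, above the required `24k`, and by connectivity every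
separation of `G[W]` of order below `4k` is trivial. -/
theorem massed_of_connected (hk : 1 ≤ k) (hG : IsVertexConnected G (50 * k)) (hW : Wᶜ.card ≤ 10 * k)
    (hXW : X ⊆ W) (hX : X.card = 4 * k) : Massed (2 * k) G W X := by
  refine ⟨hXW, ?_, fun A B hS hXA hAB => ?_⟩
  · have hdeg : ∀ v, 40 * k ≤ (W.filter (G.Adj v)).card := by
      intro v
      have h1 := hG.le_degree v
      have h2 : Finset.univ.filter (G.Adj v) ⊆ W.filter (G.Adj v) ∪ Wᶜ := by
        intro x hx
        have := (Finset.mem_filter.1 hx).2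
        by_cases hxW : x ∈ W <;> simp [hxW, this]
      have h3 := (Finset.card_le_card h2).trans (Finset.card_union_le _ _)
      omega
    have h1 := Finset.sum_le_sum (s := W \ X) fun v _ => hdeg v
    have h2 := sum_card_neighbors_le (G := G) (Finset.sdiff_subset (s := W) (t := X))
    rw [Finset.sum_const, smul_eq_mul] at h1
    have h3 := Finset.card_sdiff_add_card_eq_card hXW
    have h4 := Finset.card_add_card_compl W
    have h5 := hG.card_lt
    have h6 : 0 < (W \ X).card := by omega
    nlinarith [Nat.mul_pos h6 hk]
  · have hBA : B ⊆ A := by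
      refine (hG.sep_trivial hS ?_).resolve_left fun hAsub => ?_
      · have := Finset.card_union_le Wᶜ (A ∩ B)
        omega
      · rw [Finset.inter_eq_left.2 hAsub] at hAB
        exact absurd (Finset.card_le_card hXA) (by omega)
    rw [Finset.sdiff_eq_empty_iff_subset.2 hBA]
    simp [incid]

end Core

/-! ### Packing from a matching of monochromatic edges. -/

section ConflictMatching
open scoped Classical
variable {V : Type*} [Fintype V] {G : SimpleGraph V} {S : Set V} {k : ℕ} {Y : Finset V} {ψ : V → Bool}

/-- With neighbours of opposite colour in `W`, each edge `c d` extends to an odd `W`-path `h₀ c d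
h₁`, and each `s` not on its edge to an ear `h₂ s h₃`. The `4k` neighbours can be chosen distinct
because each vertex has at least `21k - 3k` candidates. -/
theorem hasDisjointOddSCycles_of_conflicts (hk : 1 ≤ k) (hG : IsVertexConnected G (50 * k))
    (hY : Y.card ≤ 7 * k) (hψ : ∀ x y, x ∉ Y → y ∉ Y → G.Adj x y → ψ x ≠ ψ y)
    (hdeg : ∀ v, 21 * k ≤ (Finset.univ.filter fun w => G.Adj v w ∧ ψ v ≠ ψ w ∧ w ∉ Y).card)
    (c d s : Fin k → V) (hcd : ∀ i, G.Adj (c i) (d i)) (hcol : ∀ i, ψ (c i) = ψ (d i))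
    (hsS : ∀ i, s i ∈ S)
    (hdis : ∀ i j, i ≠ j → Disjoint ({c i, d i, s i} : Finset V) {c j, d j, s j}) :
    HasDisjointOddSCycles G S k := by
  set B : Finset V := Finset.univ.biUnion fun i => {c i, d i, s i}
  have hB : B.card ≤ 3 * k := by
    refine Finset.card_biUnion_le.trans ((Finset.sum_le_sum fun i _ => Finset.card_le_three).trans ?_)
    simp [mul_comm]
  have hBmem : ∀ i, c i ∈ B ∧ d i ∈ B ∧ s i ∈ B := fun i =>
    ⟨Finset.mem_biUnion.2 ⟨i, by simp⟩, Finset.mem_biUnion.2 ⟨i, by simp⟩,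
      Finset.mem_biUnion.2 ⟨i, by simp⟩⟩
  set W : Finset V := (Y ∪ B)ᶜ
  have hWc : Wᶜ.card ≤ 10 * k := by
    have := Finset.card_union_le Y B
    rw [compl_compl]
    omega
  have hWB : ∀ x ∈ W, x ∉ B := fun x hx hxB => by simp [W, hxB] at hx
  have hWY : ∀ x ∈ W, x ∉ Y := fun x hx hxB => by simp [W, hxB] at hx
  obtain ⟨h, hinj, hN⟩ := exists_injective_choice (ι := Fin k × Fin 4)
    (fun p => W.filter fun w => G.Adj (![c p.1, d p.1, s p.1, s p.1] p.2) w ∧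
      ψ (![c p.1, d p.1, s p.1, s p.1] p.2) ≠ ψ w) (by
    intro p
    generalize ![c p.1, d p.1, s p.1, s p.1] p.2 = v
    have h1 := hdeg v
    have h2 : (Finset.univ.filter fun w => G.Adj v w ∧ ψ v ≠ ψ w ∧ w ∉ Y) ⊆
        (W.filter fun w => G.Adj v w ∧ ψ v ≠ ψ w) ∪ B := by
      intro x hx
      obtain ⟨-, h1, h2, h3⟩ := Finset.mem_filter.1 hx
      by_cases hxB : x ∈ B <;> simp [W, hxB, h1, h2, h3]
    have h3 := (Finset.card_le_card h2).trans (Finset.card_union_le _ _)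
    rw [Fintype.card_prod, Fintype.card_fin, Fintype.card_fin]
    omega)
  simp only [Finset.mem_filter] at hN
  have h0 := fun i => hN (i, 0)
  have h1 := fun i => hN (i, 1)
  have h2 := fun i => hN (i, 2)
  have h3 := fun i => hN (i, 3)
  simp only [Matrix.cons_val] at h0 h1 h2 h3
  have hne : ∀ i (x y : Fin 4), x ≠ y → h (i, x) ≠ h (i, y) := fun i x y hxy e =>
    hxy (Prod.ext_iff.1 (hinj e)).2
  have hWne : ∀ x ∈ W, ∀ y ∈ B, x ≠ y := fun x hx y hy e => hWB x hx (e ▸ hy)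
  have hK : ∀ x ∈ W, ∀ y ∈ W, G.Adj x y → ψ x ≠ ψ y := fun x hx y hy =>
    hψ x y (hWY x hx) (hWY y hy)
  have hbool : ∀ a b c d : Bool, a = b → a ≠ c → b ≠ d → c = d := by decide
  have hbase : ∀ i, ∃ g : G.Walk (h (i, 0)) (h (i, 1)), IsOddAPath W ψ g ∧
      g.support = [h (i, 0), c i, d i, h (i, 1)] := by
    intro i
    obtain ⟨b1, b2, b3⟩ := hBmem i
    refine ⟨.cons (h0 i).2.1.symm (.cons (hcd i) (.cons (h1 i).2.1 .nil)),
      ⟨?_, (h0 i).1, (h1 i).1, hne i _ _ (by decide), ?_, ?_⟩, rfl⟩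
    · simp only [SimpleGraph.Walk.cons_isPath_iff, SimpleGraph.Walk.support_cons,
        SimpleGraph.Walk.support_nil, List.mem_cons, List.not_mem_nil, or_false, not_or,
        SimpleGraph.Walk.IsPath.nil, true_and]
      exact ⟨⟨(hWne _ (h1 i).1 _ b2).symm, (hcd i).ne, (hWne _ (h1 i).1 _ b1).symm⟩,
        hWne _ (h0 i).1 _ b1, hWne _ (h0 i).1 _ b2, hne i _ _ (by decide)⟩
    · simp only [SimpleGraph.Walk.support_cons, SimpleGraph.Walk.support_nil, List.mem_cons,
        List.not_mem_nil, or_false]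
      rintro x (rfl | rfl | rfl | rfl) hx
      exacts [Or.inl rfl, absurd b1 (hWB _ hx), absurd b2 (hWB _ hx), Or.inr rfl]
    · simp only [SimpleGraph.Walk.length_cons, SimpleGraph.Walk.length_nil]
      exact iff_of_true (by decide) (hbool _ _ _ _ (hcol i) (h0 i).2.2 (h1 i).2.2)
  refine hasDisjointOddSCycles_of_completable (G := G) (K := G) (W := W)
    (fun i => {c i, d i, s i} ∪ Finset.univ.image fun t => h (i, t)) ?_ ?_
    (linkable_of_massed hk ?_ fun X hXW hX => massed_of_connected hk hG hWc hXW hX)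
  · intro i j hij
    have hfB : ∀ i j (y : V), y ∈ ({c i, d i, s i} : Finset V) →
        y ∉ Finset.univ.image fun t => h (j, t) := by
      intro i j y hy hy'
      obtain ⟨t, -, rfl⟩ := Finset.mem_image.1 hy'
      exact hWB _ (hN (j, t)).1 (Finset.mem_biUnion.2 ⟨i, Finset.mem_univ _, hy⟩)
    rw [Finset.disjoint_left]
    intro x hx hx'
    rcases Finset.mem_union.1 hx with hx | hx <;> rcases Finset.mem_union.1 hx' with hx' | hx'
    · exact Finset.disjoint_left.1 (hdis i j hij) hx hx'
    · exact hfB _ _ _ hx hx'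
    · exact hfB _ _ _ hx' hx
    · obtain ⟨t, -, rfl⟩ := Finset.mem_image.1 hx
      obtain ⟨t', -, e⟩ := Finset.mem_image.1 hx'
      exact hij (Prod.ext_iff.1 (hinj e)).1.symm
  · intro i
    obtain ⟨g, hg, hgs⟩ := hbase i
    obtain ⟨b1, b2, b3⟩ := hBmem i
    by_cases hs : s i = c i ∨ s i = d i
    · refine ⟨_, ?_, completable_of_isOddAPath (ψ := ψ) le_rfl hK hg ⟨s i, hsS i, ?_⟩⟩
      · rw [hgs]
        intro x hx
        simp only [List.mem_toFinset, List.mem_cons, List.not_mem_nil, or_false] at hx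
        simp only [Finset.mem_union, Finset.mem_insert, Finset.mem_singleton, Finset.mem_image,
          Finset.mem_univ, true_and]
        rcases hx with rfl | rfl | rfl | rfl <;> simp
      · rw [hgs]
        rcases hs with hs | hs <;> simp [hs]
    · rw [not_or] at hs
      have hf : IsEar W (.cons (h2 i).2.1.symm (.cons (h3 i).2.1 .nil) :
          G.Walk (h (i, 2)) (h (i, 3))) := by
        refine ⟨?_, (h2 i).1, (h3 i).1, hne i _ _ (by decide), ?_⟩
        · simp only [SimpleGraph.Walk.cons_isPath_iff, SimpleGraph.Walk.support_cons,
            SimpleGraph.Walk.support_nil, List.mem_cons, List.not_mem_nil, or_false, not_or,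
            SimpleGraph.Walk.IsPath.nil, true_and]
          exact ⟨(hWne _ (h3 i).1 _ b3).symm, hWne _ (h2 i).1 _ b3, hne i _ _ (by decide)⟩
        · simp only [SimpleGraph.Walk.support_cons, SimpleGraph.Walk.support_nil, List.mem_cons,
            List.not_mem_nil, or_false]
          rintro x (rfl | rfl | rfl) hx
          exacts [Or.inl rfl, absurd b3 (hWB _ hx), Or.inr rfl]
      obtain ⟨D, hD, hDc⟩ := completable_of_isEar (S := S) (K := G) (ψ := ψ) le_rfl hK hf
        ⟨s i, hsS i, by simp⟩ hg (by
          rw [hgs]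
          simp only [SimpleGraph.Walk.support_cons, SimpleGraph.Walk.support_nil, List.mem_cons,
            List.not_mem_nil, or_false, not_or]
          rintro x (rfl | rfl | rfl)
          · exact ⟨hne i _ _ (by decide), hWne _ (h2 i).1 _ b1, hWne _ (h2 i).1 _ b2,
              hne i _ _ (by decide)⟩
          · exact ⟨(hWne _ (h0 i).1 _ b3).symm, hs.1, hs.2, (hWne _ (h1 i).1 _ b3).symm⟩
          · exact ⟨hne i _ _ (by decide), hWne _ (h3 i).1 _ b1, hWne _ (h3 i).1 _ b2,
              hne i _ _ (by decide)⟩)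
      refine ⟨D, hD.trans fun x hx => ?_, hDc⟩
      rw [hgs] at hx
      simp only [SimpleGraph.Walk.support_cons, SimpleGraph.Walk.support_nil, Finset.mem_union,
        List.mem_toFinset, List.mem_cons, List.not_mem_nil, or_false] at hx
      simp only [Finset.mem_union, Finset.mem_insert, Finset.mem_singleton, Finset.mem_image,
          Finset.mem_univ, true_and]
      rcases hx with (rfl | rfl | rfl) | rfl | rfl | rfl | rfl <;> simp
  · have h4 := Finset.card_add_card_compl W
    have h5 := hG.card_lt
    omega

end ConflictMatching

/-! ### Matchings as sets of disjoint ordered pairs. -/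

section Matchings
open scoped Classical
variable {V : Type*} {R : V → V → Prop} {N : Finset (V × V)} {T : Finset V}

/-- `N` is a set of disjoint pairs satisfying `R`. -/
def IsPairMatching (R : V → V → Prop) (N : Finset (V × V)) : Prop :=
  (∀ p ∈ N, R p.1 p.2) ∧ DisjointPairs N

/-- The ends of the pairs in `N`. -/
noncomputable def ends (N : Finset (V × V)) : Finset V := N.biUnion fun p => {p.1, p.2}

theorem mem_ends {x : V} : x ∈ ends N ↔ ∃ p ∈ N, x = p.1 ∨ x = p.2 := by
  simp [ends]

theorem card_ends_le : (ends N).card ≤ 2 * N.card := by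
  rw [mul_comm]
  exact Finset.card_biUnion_le_card_mul _ _ _ fun _ _ => Finset.card_le_two

theorem exists_max_pairMatching [Finite V] (R : V → V → Prop) : ∃ N, IsPairMatching R N ∧
    ∀ N', IsPairMatching R N' → N'.card ≤ N.card := by
  have := Fintype.ofFinite V
  obtain ⟨N, hN, hmax⟩ := Finset.exists_max_image (Finset.univ.filter (IsPairMatching R)) Finset.card
    ⟨∅, by simp [IsPairMatching, DisjointPairs]⟩
  simp only [Finset.mem_filter, Finset.mem_univ, true_and] at hN hmax
  exact ⟨N, hN, hmax⟩

theorem IsPairMatching.insert (hN : IsPairMatching R N) {x y : V} (h : R x y) (hx : x ∉ ends N)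
    (hy : y ∉ ends N) : IsPairMatching R (insert (x, y) N) := by
  have key : ∀ q ∈ N, x ≠ q.1 ∧ x ≠ q.2 ∧ y ≠ q.1 ∧ y ≠ q.2 := fun q hq =>
    ⟨fun e => hx (mem_ends.2 ⟨q, hq, Or.inl e⟩), fun e => hx (mem_ends.2 ⟨q, hq, Or.inr e⟩),
      fun e => hy (mem_ends.2 ⟨q, hq, Or.inl e⟩), fun e => hy (mem_ends.2 ⟨q, hq, Or.inr e⟩)⟩
  refine ⟨fun p hp => ?_, fun p hp q hq hne => ?_⟩
  · rcases Finset.mem_insert.1 hp with rfl | hp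
    exacts [h, hN.1 p hp]
  · rcases Finset.mem_insert.1 hp with rfl | hp' <;> rcases Finset.mem_insert.1 hq with rfl | hq'
    · exact absurd rfl hne
    · exact key q hq'
    · obtain ⟨h1, h2, h3, h4⟩ := key p hp'
      exact ⟨h1.symm, h3.symm, h2.symm, h4.symm⟩
    · exact hN.2 p hp' q hq' hne

theorem notMem_of_notMem_ends {x y : V} (hx : x ∉ ends N) : (x, y) ∉ N :=
  fun h => hx (mem_ends.2 ⟨_, h, Or.inl rfl⟩)

theorem IsPairMatching.subset {N' : Finset (V × V)} (hN : IsPairMatching R N) (h : N' ⊆ N) :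
    IsPairMatching R N' :=
  ⟨fun p hp => hN.1 p (h hp), fun p hp q hq => hN.2 p (h hp) q (h hq)⟩

/-- The ends of a maximum matching meet all edges. -/
theorem mem_ends_of_max (hN : IsPairMatching R N)
    (hmax : ∀ N', IsPairMatching R N' → N'.card ≤ N.card) {x y : V} (h : R x y) :
    x ∈ ends N ∨ y ∈ ends N := by
  by_contra hcon
  rw [not_or] at hcon
  have := hmax _ (hN.insert h hcon.1 hcon.2)
  rw [Finset.card_insert_of_notMem (notMem_of_notMem_ends hcon.1)] at this
  omega

theorem card_inter_ends_le (r : ℕ) (hr : ∀ p ∈ N, (T ∩ {p.1, p.2}).card ≤ r) :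
    (T ∩ ends N).card ≤ (N.filter fun p => ¬ (p.1 ∉ T ∧ p.2 ∉ T)).card * r := by
  refine (Finset.card_le_card fun x hx => ?_).trans (Finset.card_biUnion_le_card_mul
    (N.filter fun p => ¬ (p.1 ∉ T ∧ p.2 ∉ T)) (fun p => T ∩ {p.1, p.2}) r
    fun p hp => hr p (Finset.mem_filter.1 hp).1)
  obtain ⟨hxT, hx⟩ := Finset.mem_inter.1 hx
  obtain ⟨p, hp, h⟩ := mem_ends.1 hx
  refine Finset.mem_biUnion.2 ⟨p, Finset.mem_filter.2 ⟨hp, ?_⟩, ?_⟩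
  · rcases h with rfl | rfl <;> simp [hxT]
  · rcases h with rfl | rfl <;> simp [hxT]

end Matchings

/-! ### The case that few vertices meet all odd cycles. -/

section Conflicts
open scoped Classical
variable {V : Type*} {G : SimpleGraph V} {S : Set V} {k : ℕ} {Y : Finset V} {ψ : V → Bool}

theorem isOddCycleCover_of_bichromatic (h : ∀ x y, x ∉ Y → y ∉ Y → G.Adj x y → ψ x ≠ ψ y) :
    IsOddCycleCover G Y := by
  have := (SimpleGraph.Coloring.mk (G := deleteVertices G Y) (fun v => ψ v)
    fun {v w} hvw => h v w v.2 w.2 hvw).colorable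
  rw [Fintype.card_bool] at this
  exact this

theorem IsOddCycleCover.isOddSCycleCover (h : IsOddCycleCover G Y) : IsOddSCycleCover G S Y :=
  fun v c hc => Nat.not_odd_iff_even.2
    (SimpleGraph.two_colorable_iff_forall_loop_even.1 h v c) hc.2.1

variable [Fintype V]

/-- Vertices of the deleted set can be coloured against the majority of their neighbours. -/
theorem IsOddCycleCover.exists_coloring (hG : IsVertexConnected G (50 * k))
    (hY : Y.card ≤ 7 * k) (h : IsOddCycleCover G Y) :
    ∃ ψ : V → Bool, (∀ x y, x ∉ Y → y ∉ Y → G.Adj x y → ψ x ≠ ψ y) ∧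
      ∀ v, 21 * k ≤ (Finset.univ.filter fun w => G.Adj v w ∧ ψ v ≠ ψ w ∧ w ∉ Y).card := by
  obtain ⟨c⟩ := h
  let χ : V → Bool := fun v => if h : v ∉ Y then decide (c ⟨v, h⟩ = 0) else true
  have hχ : ∀ x y, x ∉ Y → y ∉ Y → G.Adj x y → χ x ≠ χ y := by
    intro x y hx hy hxy
    have h1 : c ⟨x, hx⟩ ≠ c ⟨y, hy⟩ := c.valid hxy
    simp only [χ, hx, hy, not_false_eq_true, dite_true]
    generalize c ⟨x, hx⟩ = a at *
    generalize c ⟨y, hy⟩ = b at *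
    revert a b
    decide
  let N : V → Bool → Finset V := fun v b => Finset.univ.filter fun w => G.Adj v w ∧ χ w = b ∧ w ∉ Y
  have hN : ∀ v, 43 * k ≤ (N v true).card + (N v false).card := by
    intro v
    have h1 := hG.le_degree v
    have h2 : Finset.univ.filter (G.Adj v) ⊆ (N v true ∪ N v false) ∪ Y := by
      intro w hw
      have := (Finset.mem_filter.1 hw).2
      by_cases hwY : w ∈ Y
      · simp [hwY]
      · cases hw' : χ w <;> simp [N, this, hwY, hw']
    have h3 := (Finset.card_le_card h2).trans (Finset.card_union_le _ _)
    have h4 := Finset.card_union_le (N v true) (N v false)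
    omega
  -- A vertex of `Y` gets the colour that is rarer among its at least `43k` neighbours outside `Y`;
  -- ties are harmless.
  let ψ : V → Bool := fun v => if v ∈ Y then decide ((N v true).card < (N v false).card) else χ v
  have hψχ : ∀ x, x ∉ Y → ψ x = χ x := fun x hx => by simp [ψ, hx]
  refine ⟨ψ, fun x y hx hy hxy => ?_, fun v => ?_⟩
  · rw [hψχ x hx, hψχ y hy]
    exact hχ x y hx hy hxy
  · have hsub : ∀ b, ψ v ≠ b → N v b ⊆ Finset.univ.filter fun w => G.Adj v w ∧ ψ v ≠ ψ w ∧ w ∉ Y := by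
      intro b hb w hw
      obtain ⟨-, h1, h2, h3⟩ := Finset.mem_filter.1 hw
      refine Finset.mem_filter.2 ⟨Finset.mem_univ _, h1, ?_, h3⟩
      rwa [hψχ w h3, h2]
    have hNv := hN v
    by_cases hv : v ∈ Y
    · by_cases hlt : (N v true).card < (N v false).card
      · have := Finset.card_le_card (hsub false (by simp [ψ, hv, hlt]))
        omega
      · have := Finset.card_le_card (hsub true (by simp [ψ, hv, hlt]))
        omega
    · have hall : N v true ∪ N v false ⊆
          Finset.univ.filter fun w => G.Adj v w ∧ ψ v ≠ ψ w ∧ w ∉ Y := by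
        intro w hw
        have hw' : G.Adj v w ∧ w ∉ Y := by
          rcases Finset.mem_union.1 hw with hw | hw <;>
          · obtain ⟨-, h1, h2, h3⟩ := Finset.mem_filter.1 hw
            exact ⟨h1, h3⟩
        refine Finset.mem_filter.2 ⟨Finset.mem_univ _, hw'.1, ?_, hw'.2⟩
        rw [hψχ v hv, hψχ w hw'.2]
        exact hχ v w hv hw'.2 hw'.1
      have h1 := Finset.card_le_card hall
      rw [Finset.card_union_of_disjoint] at h1
      · omega
      · rw [Finset.disjoint_left]
        intro w hw hw'
        have h1 := (Finset.mem_filter.1 hw).2.2.1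
        have h2 := (Finset.mem_filter.1 hw').2.2.1
        rw [h1] at h2
        cases h2

/-- Enough vertices of `S` next to a matching of conflicting edges. -/
theorem hasDisjointOddSCycles_of_matching (hk : 1 ≤ k) (hG : IsVertexConnected G (50 * k))
    (hY : Y.card ≤ 7 * k) (hψ : ∀ x y, x ∉ Y → y ∉ Y → G.Adj x y → ψ x ≠ ψ y)
    (hdeg : ∀ v, 21 * k ≤ (Finset.univ.filter fun w => G.Adj v w ∧ ψ v ≠ ψ w ∧ w ∉ Y).card)
    {N : Finset (V × V)} (hN : IsPairMatching (fun x y => G.Adj x y ∧ ψ x = ψ y) N)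
    (hNk : N.card = k) {T : Finset V} (hT : ∀ x ∈ T, x ∈ S)
    (hc : (N.filter fun p => p.1 ∉ T ∧ p.2 ∉ T).card ≤ (T \ ends N).card) :
    HasDisjointOddSCycles G S k := by
  set F := N.filter fun p => p.1 ∉ T ∧ p.2 ∉ T
  obtain ⟨ι⟩ : Nonempty (F ↪ (T \ ends N : Finset V)) :=
    Function.Embedding.nonempty_of_card_le (by rwa [Fintype.card_coe, Fintype.card_coe])
  -- The vertex of `S` for a pair is an end in `T` if there is one, and otherwise a private vertex
  -- of `T` off the matching.
  let σ : V × V → V := fun p => if h : p ∈ F then ι ⟨p, h⟩ else if p.1 ∈ T then p.1 else p.2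
  have hσF : ∀ p, ∀ h : p ∈ F, σ p = ι ⟨p, h⟩ := fun p h => dif_pos h
  have hσN : ∀ p ∈ N, p ∉ F → (σ p = p.1 ∨ σ p = p.2) ∧ σ p ∈ T := by
    intro p hp hpF
    simp only [σ, hpF, dite_false]
    split_ifs with h
    · exact ⟨Or.inl rfl, h⟩
    · refine ⟨Or.inr rfl, ?_⟩
      by_contra h'
      exact hpF (Finset.mem_filter.2 ⟨hp, h, h'⟩)
  have hσFm : ∀ p ∈ F, σ p ∈ T ∧ σ p ∉ ends N := by
    intro p hp
    rw [hσF p hp]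
    exact Finset.mem_sdiff.1 (ι ⟨p, hp⟩).2
  have hout : ∀ p ∈ F, ∀ q ∈ N, σ p ≠ q.1 ∧ σ p ≠ q.2 := fun p hp q hq =>
    ⟨fun e => (hσFm p hp).2 (mem_ends.2 ⟨q, hq, Or.inl e⟩),
      fun e => (hσFm p hp).2 (mem_ends.2 ⟨q, hq, Or.inr e⟩)⟩
  have hdis : ∀ p ∈ N, ∀ q ∈ N, p ≠ q → Disjoint ({p.1, p.2, σ p} : Finset V) {q.1, q.2, σ q} := by
    intro p hp q hq hpq
    have h1 := hN.2 p hp q hq hpq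
    have h2 : σ p ≠ q.1 ∧ σ p ≠ q.2 := by
      by_cases hpF : p ∈ F
      · exact hout p hpF q hq
      · rcases (hσN p hp hpF).1 with e | e <;> rw [e]
        exacts [⟨h1.1, h1.2.1⟩, h1.2.2]
    have h3 : p.1 ≠ σ q ∧ p.2 ≠ σ q := by
      by_cases hqF : q ∈ F
      · exact ⟨(hout q hqF p hp).1.symm, (hout q hqF p hp).2.symm⟩
      · rcases (hσN q hq hqF).1 with e | e <;> rw [e]
        exacts [⟨h1.1, h1.2.2.1⟩, ⟨h1.2.1, h1.2.2.2⟩]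
    have h4 : σ p ≠ σ q := by
      by_cases hpF : p ∈ F
      · by_cases hqF : q ∈ F
        · rw [hσF p hpF, hσF q hqF]
          intro e
          have := ι.injective (Subtype.ext e)
          exact hpq (Subtype.ext_iff.1 this)
        · rcases (hσN q hq hqF).1 with e | e <;> rw [e]
          exacts [h2.1, h2.2]
      · rcases (hσN p hp hpF).1 with e | e <;> rw [e]
        exacts [h3.1, h3.2]
    rw [Finset.disjoint_left]
    simp only [Finset.mem_insert, Finset.mem_singleton, not_or]
    rintro x (rfl | rfl | rfl)
    exacts [⟨h1.1, h1.2.1, h3.1⟩, ⟨h1.2.2.1, h1.2.2.2, h3.2⟩, ⟨h2.1, h2.2, h4⟩]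
  let e : Fin k ≃ N := (finCongr hNk.symm).trans N.equivFin.symm
  refine hasDisjointOddSCycles_of_conflicts hk hG hY hψ hdeg (fun i => (e i).1.1) (fun i => (e i).1.2)
    (fun i => σ (e i).1) (fun i => (hN.1 _ (e i).2).1) (fun i => (hN.1 _ (e i).2).2) (fun i => ?_)
    fun i j hij => hdis _ (e i).2 _ (e j).2 fun h => hij (e.injective (Subtype.ext h))
  apply hT
  by_cases h : (e i).1 ∈ F
  · exact (hσFm _ h).1
  · exact (hσN _ (e i).2 h).2

/-- If `|S| ≤ 2k - 2`, delete `S`. Otherwise a matching of `k` monochromatic edges, `m` of them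
meeting `S`, would leave at least `2k - 1 - 2m` vertices of `S` for the other `k - m`, enough for
the packing. So a maximum matching has at most `2k - 2` ends, and these meet all monochromatic
edges. -/
theorem exists_isOddSCycleCover_of_coloring (hk : 1 ≤ k) (hG : IsVertexConnected G (50 * k))
    (hY : Y.card ≤ 7 * k) (hψ : ∀ x y, x ∉ Y → y ∉ Y → G.Adj x y → ψ x ≠ ψ y)
    (hdeg : ∀ v, 21 * k ≤ (Finset.univ.filter fun w => G.Adj v w ∧ ψ v ≠ ψ w ∧ w ∉ Y).card)
    (hno : ¬ HasDisjointOddSCycles G S k) :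
    ∃ X : Finset V, X.card ≤ 2 * k - 2 ∧ IsOddSCycleCover G S X := by
  set T : Finset V := Finset.univ.filter (· ∈ S)
  by_cases hS : T.card ≤ 2 * k - 2
  · refine ⟨T, hS, fun v c hc => ?_⟩
    obtain ⟨s, hs, -⟩ := hc.2.2
    exact s.2 (Finset.mem_filter.2 ⟨Finset.mem_univ _, hs⟩)
  obtain ⟨N, hN, hmax⟩ := exists_max_pairMatching fun x y => G.Adj x y ∧ ψ x = ψ y
  by_cases hNk : N.card < k
  · refine ⟨ends N, ?_, (isOddCycleCover_of_bichromatic (ψ := ψ) ?_).isOddSCycleCover⟩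
    · have := card_ends_le (N := N)
      omega
    · intro x y hx hy hxy he
      exact (mem_ends_of_max hN hmax ⟨hxy, he⟩).elim hx hy
  · exfalso
    obtain ⟨N', hN', hc⟩ := Finset.exists_subset_card_eq (not_lt.1 hNk)
    refine hno (hasDisjointOddSCycles_of_matching hk hG hY hψ hdeg (hN.subset hN') hc (T := T)
      (fun x hx => (Finset.mem_filter.1 hx).2) ?_)
    have h1 := card_inter_ends_le (N := N') (T := T) 2 fun p _ =>
      (Finset.card_le_card Finset.inter_subset_right).trans Finset.card_le_two
    have h2 := Finset.card_filter_add_card_filter_not (s := N') (fun p => p.1 ∉ T ∧ p.2 ∉ T)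
    have h3 := Finset.card_sdiff_add_card_inter T (ends N')
    omega

/-- Fix `T ⊆ S` with `k` vertices and disregard monochromatic edges inside `T`. A matching pair then
has at most one end in `T`, so `k` pairs would give the packing. The ends of a maximum matching
together with `T` form a cover of at most `3k - 2` vertices, one too many. If some maximum matching
meets `T`, the overlap saves one; if none does, no monochromatic edge leaves `T`, and one vertex of
`T` can be spared. -/
theorem exists_isOddCycleCover_of_coloring (hk : 1 ≤ k) (hG : IsVertexConnected G (50 * k))
    (hY : Y.card ≤ 7 * k) (hψ : ∀ x y, x ∉ Y → y ∉ Y → G.Adj x y → ψ x ≠ ψ y)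
    (hdeg : ∀ v, 21 * k ≤ (Finset.univ.filter fun w => G.Adj v w ∧ ψ v ≠ ψ w ∧ w ∉ Y).card)
    (hno : ¬ HasDisjointOddSCycles G S k) (hS : k ≤ S.ncard) :
    ∃ X : Finset V, X.card ≤ 3 * k - 3 ∧ IsOddCycleCover G X := by
  obtain ⟨T, hTS, hTk⟩ : ∃ T : Finset V, (∀ x ∈ T, x ∈ S) ∧ T.card = k := by
    rw [Set.ncard_eq_toFinset_card'] at hS
    obtain ⟨T, hT, hc⟩ := Finset.exists_subset_card_eq hS
    exact ⟨T, fun x hx => by simpa using hT hx, hc⟩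
  let R : V → V → Prop := fun x y => G.Adj x y ∧ ψ x = ψ y ∧ ¬ (x ∈ T ∧ y ∈ T)
  have hlt : ∀ N, IsPairMatching R N → N.card < k := by
    intro N hN
    by_contra hNk
    obtain ⟨N', hN', hc⟩ := Finset.exists_subset_card_eq (not_lt.1 hNk)
    have hm := hN.subset hN'
    refine hno (hasDisjointOddSCycles_of_matching hk hG hY hψ hdeg
      ⟨fun p hp => ⟨(hm.1 p hp).1, (hm.1 p hp).2.1⟩, hm.2⟩ hc (T := T) hTS ?_)
    have h1 := card_inter_ends_le (N := N') (T := T) 1 fun p hp => by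
      rw [Finset.card_le_one]
      intro a ha b hb
      have := (hm.1 p hp).2.2
      simp only [Finset.mem_inter, Finset.mem_insert, Finset.mem_singleton] at ha hb
      rcases ha with ⟨haT, rfl | rfl⟩ <;> rcases hb with ⟨hbT, rfl | rfl⟩
      · rfl
      · exact absurd ⟨haT, hbT⟩ this
      · exact absurd ⟨hbT, haT⟩ this
      · rfl
    have h2 := Finset.card_filter_add_card_filter_not (s := N') (fun p => p.1 ∉ T ∧ p.2 ∉ T)
    have h3 := Finset.card_sdiff_add_card_inter T (ends N')
    omega
  have hcover : ∀ N, IsPairMatching R N → (∀ N', IsPairMatching R N' → N'.card ≤ N.card) →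
      IsOddCycleCover G (ends N ∪ T) := by
    intro N hN hmax
    refine isOddCycleCover_of_bichromatic (ψ := ψ) fun x y hx hy hxy he => ?_
    rw [Finset.mem_union, not_or] at hx hy
    exact (mem_ends_of_max hN hmax (x := x) (y := y) ⟨hxy, he, fun h => hx.2 h.1⟩).elim hx.1 hy.1
  by_cases hmeet : ∃ N, IsPairMatching R N ∧ (∀ N', IsPairMatching R N' → N'.card ≤ N.card) ∧
      (ends N ∩ T).Nonempty
  · obtain ⟨N, hN, hmax, hne⟩ := hmeet
    refine ⟨_, ?_, hcover N hN hmax⟩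
    have h1 := Finset.card_union_add_card_inter (ends N) T
    have h2 := card_ends_le (N := N)
    have h3 := hlt N hN
    have h4 := hne.card_pos
    omega
  obtain ⟨N, hN, hmax⟩ := exists_max_pairMatching R
  have hNT : ∀ x ∈ T, x ∉ ends N := fun x hx hx' =>
    hmeet ⟨N, hN, hmax, x, Finset.mem_inter.2 ⟨hx', hx⟩⟩
  -- Otherwise exchanging the matching pair at `y` for `(x, y)` would give a maximum matching that
  -- meets `T`.
  have hcross : ∀ x ∈ T, ∀ y, y ∉ T → G.Adj x y → ψ x ≠ ψ y := by
    intro x hx y hy hxy he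
    have hR : R x y := ⟨hxy, he, fun h => hy h.2⟩
    have hyN := (mem_ends_of_max hN hmax hR).resolve_left (hNT x hx)
    obtain ⟨p, hp, hpy⟩ := mem_ends.1 hyN
    have hsub := hN.subset (N.erase_subset p)
    have hy' : y ∉ ends (N.erase p) := by
      intro h
      obtain ⟨q, hq, hqy⟩ := mem_ends.1 h
      have h1 := hN.2 p hp q (Finset.mem_of_mem_erase hq) (Finset.ne_of_mem_erase hq).symm
      rcases hpy with e | e <;> rcases hqy with e' | e' <;> rw [e] at e'
      exacts [h1.1 e', h1.2.1 e', h1.2.2.1 e', h1.2.2.2 e']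
    have hx' : x ∉ ends (N.erase p) := by
      intro h
      obtain ⟨q, hq, hqx⟩ := mem_ends.1 h
      exact hNT x hx (mem_ends.2 ⟨q, Finset.mem_of_mem_erase hq, hqx⟩)
    refine hmeet ⟨_, hsub.insert hR hx' hy', fun N' hN' => ?_, x, Finset.mem_inter.2
      ⟨mem_ends.2 ⟨(x, y), Finset.mem_insert_self _ _, Or.inl rfl⟩, hx⟩⟩
    rw [Finset.card_insert_of_notMem (notMem_of_notMem_ends hx'), Finset.card_erase_add_one hp]
    exact hmax N' hN'
  obtain ⟨t, ht⟩ : T.Nonempty := Finset.card_pos.1 (by omega)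
  refine ⟨ends N ∪ T.erase t, ?_, isOddCycleCover_of_bichromatic (ψ := ψ) ?_⟩
  · have h1 := Finset.card_union_le (ends N) (T.erase t)
    have h2 := card_ends_le (N := N)
    have h3 := hlt N hN
    have h4 := Finset.card_erase_of_mem ht
    omega
  · intro x y hx hy hxy he
    rw [Finset.mem_union, not_or, Finset.mem_erase, not_and_or, not_not] at hx hy
    by_cases hxT : x ∈ T <;> by_cases hyT : y ∈ T
    · have e1 := hx.2.resolve_right fun h => h hxT
      have e2 := hy.2.resolve_right fun h => h hyT
      exact hxy.ne (e1.trans e2.symm)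
    · exact hcross x hxT y hyT hxy he
    · exact hcross y hyT x hxT hxy.symm he.symm
    · exact (mem_ends_of_max hN hmax (x := x) (y := y) ⟨hxy, he, fun h => hxT h.1⟩).elim hx.1 hy.1

/-- The theorem holds if a few vertices meet all odd cycles. -/
theorem packing_or_covers_of_isOddCycleCover (hk : 1 ≤ k) (hG : IsVertexConnected G (50 * k))
    (hY : Y.card ≤ 7 * k) (h : IsOddCycleCover G Y) :
    HasDisjointOddSCycles G S k ∨ ((∃ X : Finset V, X.card ≤ 2 * k - 2 ∧ IsOddSCycleCover G S X) ∧
      (k ≤ S.ncard → ∃ Y : Finset V, Y.card ≤ 3 * k - 3 ∧ IsOddCycleCover G Y)) := by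
  obtain ⟨ψ, hψ, hdeg⟩ := h.exists_coloring hG hY
  by_cases hno : HasDisjointOddSCycles G S k
  · exact Or.inl hno
  · exact Or.inr ⟨exists_isOddSCycleCover_of_coloring hk hG hY hψ hdeg hno,
      exists_isOddCycleCover_of_coloring hk hG hY hψ hdeg hno⟩

end Conflicts

/-! ### Maximum cuts. -/

section MaxCut
open scoped Classical
variable {V : Type*} [Fintype V] {G : SimpleGraph V}

/-- Ordered adjacent pairs with differently coloured ends. -/
noncomputable def cutPairs (G : SimpleGraph V) (φ : V → Bool) : Finset (V × V) :=
  Finset.univ.filter fun p => G.Adj p.1 p.2 ∧ φ p.1 ≠ φ p.2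

theorem card_cutPairs (φ : V → Bool) (v : V) : (cutPairs G φ).card =
    ((cutPairs G φ).filter fun p => p.1 ≠ v ∧ p.2 ≠ v).card +
      2 * (Finset.univ.filter fun w => G.Adj v w ∧ φ v ≠ φ w).card := by
  set N := Finset.univ.filter fun w => G.Adj v w ∧ φ v ≠ φ w
  have hN : ∀ w, w ∈ N ↔ G.Adj v w ∧ φ v ≠ φ w := by simp [N]
  have h : (cutPairs G φ).filter (fun p => ¬ (p.1 ≠ v ∧ p.2 ≠ v)) =
      N.image (fun w => (v, w)) ∪ N.image (fun w => (w, v)) := by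
    ext ⟨a, b⟩
    simp only [cutPairs, Finset.mem_filter, Finset.mem_univ, true_and, Finset.mem_union,
      Finset.mem_image, hN, Prod.mk.injEq]
    constructor
    · rintro ⟨⟨h1, h2⟩, h3⟩
      by_cases ha : a = v
      · subst ha
        exact Or.inl ⟨b, ⟨h1, h2⟩, rfl, rfl⟩
      · have hb : b = v := by tauto
        subst hb
        exact Or.inr ⟨a, ⟨h1.symm, h2.symm⟩, rfl, rfl⟩
    · rintro (⟨w, ⟨h1, h2⟩, rfl, rfl⟩ | ⟨w, ⟨h1, h2⟩, rfl, rfl⟩)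
      · exact ⟨⟨h1, h2⟩, fun h => h.1 rfl⟩
      · exact ⟨⟨h1.symm, h2.symm⟩, fun h => h.2 rfl⟩
  rw [← Finset.card_filter_add_card_filter_not (s := cutPairs G φ) (fun p => p.1 ≠ v ∧ p.2 ≠ v), h,
    Finset.card_union_of_disjoint, Finset.card_image_of_injective, Finset.card_image_of_injective,
    two_mul]
  · exact fun _ _ h => (Prod.ext_iff.1 h).1
  · exact fun _ _ h => (Prod.ext_iff.1 h).2
  · rw [Finset.disjoint_left]
    intro p hp hp'
    obtain ⟨w, hw, rfl⟩ := Finset.mem_image.1 hp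
    obtain ⟨w', hw', e⟩ := Finset.mem_image.1 hp'
    rw [Prod.mk.injEq] at e
    rw [← e.2] at hw
    exact G.loopless.irrefl _ ((hN _).1 hw).1

/-- In a maximum cut, changing the colour of one vertex gains nothing. -/
theorem exists_max_cut (G : SimpleGraph V) : ∃ φ : V → Bool, ∀ v,
    (Finset.univ.filter (G.Adj v)).card ≤ 2 * (Finset.univ.filter fun w => G.Adj v w ∧ φ v ≠ φ w).card := by
  obtain ⟨φ, -, hφ⟩ := Finset.exists_max_image (Finset.univ : Finset (V → Bool))
    (fun φ => (cutPairs G φ).card) ⟨fun _ => true, Finset.mem_univ _⟩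
  refine ⟨φ, fun v => ?_⟩
  have h1 := hφ (Function.update φ v (!φ v)) (Finset.mem_univ _)
  rw [card_cutPairs φ v, card_cutPairs _ v] at h1
  have h2 : (cutPairs G (Function.update φ v (!φ v))).filter (fun p => p.1 ≠ v ∧ p.2 ≠ v) =
      (cutPairs G φ).filter fun p => p.1 ≠ v ∧ p.2 ≠ v := by
    ext ⟨a, b⟩
    simp only [cutPairs, Finset.mem_filter, Finset.mem_univ, true_and]
    constructor <;>
    · rintro ⟨h, ha, hb⟩
      simp_all
  have h3 : (Finset.univ.filter fun w => G.Adj v w ∧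
      Function.update φ v (!φ v) v ≠ Function.update φ v (!φ v) w) =
      (Finset.univ.filter (G.Adj v)).filter fun w => ¬ φ v ≠ φ w := by
    ext w
    simp only [Finset.mem_filter, Finset.mem_univ, true_and, Function.update_self]
    refine and_congr_right fun hw => ?_
    rw [Function.update_of_ne hw.ne']
    have hbool : ∀ a b : Bool, (!a) ≠ b ↔ ¬ a ≠ b := by decide
    exact hbool _ _
  have h4 := Finset.card_filter_add_card_filter_not (s := Finset.univ.filter (G.Adj v))
    fun w => φ v ≠ φ w
  rw [Finset.filter_filter] at h4
  rw [h2, h3] at h1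
  omega

end MaxCut

/-! ### A highly linked set in a bipartite graph of large minimum degree. -/

section DenseCore
open scoped Classical
variable {V : Type*} {K : SimpleGraph V} {φ : V → Bool} {U W A B X : Finset V} {k : ℕ}

theorem card_incid_self_le_erase (v : V) : (incid K U U).card ≤
    (incid K (U.erase v) (U.erase v)).card + 2 * (U.filter (K.Adj v)).card := by
  have h : incid K U U ⊆ incid K (U.erase v) (U.erase v) ∪
      ((U.filter (K.Adj v)).image (fun w => (v, w)) ∪ (U.filter (K.Adj v)).image fun w => (w, v)) := by
    rintro ⟨a, b⟩ hp
    obtain ⟨h1, h2, h3, -⟩ := mem_incid.1 hp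
    dsimp only at h1 h2 h3
    by_cases ha : a = v
    · subst ha
      simp [h2, h3]
    · by_cases hb : b = v
      · subst hb
        simp [h1, h3.symm]
      · exact Finset.mem_union_left _ (mem_incid.2 ⟨Finset.mem_erase.2 ⟨ha, h1⟩,
          Finset.mem_erase.2 ⟨hb, h2⟩, h3, Or.inl (Finset.mem_erase.2 ⟨ha, h1⟩)⟩)
  have h1 := (Finset.card_le_card h).trans (Finset.card_union_le _ _)
  have h2 := Finset.card_union_le ((U.filter (K.Adj v)).image (fun w => (v, w)))
    ((U.filter (K.Adj v)).image fun w => (w, v))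
  have h3 := Finset.card_image_le (s := U.filter (K.Adj v)) (f := fun w => (v, w))
  have h4 := Finset.card_image_le (s := U.filter (K.Adj v)) (f := fun w => (w, v))
  omega

theorem two_mul_card_incid_self_le (hφ : ∀ x y, K.Adj x y → φ x ≠ φ y) :
    2 * (incid K U U).card ≤ U.card ^ 2 := by
  set P := U.filter fun x => φ x = true
  set Q := U.filter fun x => ¬ φ x = true
  have h : incid K U U ⊆ P ×ˢ Q ∪ Q ×ˢ P := by
    rintro ⟨a, b⟩ hp
    obtain ⟨h1, h2, h3, -⟩ := mem_incid.1 hp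
    dsimp only at h1 h2 h3
    have h4 := hφ a b h3
    simp only [P, Q, Finset.mem_union, Finset.mem_product, Finset.mem_filter, h1, h2, true_and]
    revert h4
    generalize φ a = x
    generalize φ b = y
    revert x y
    decide
  have h1 := (Finset.card_le_card h).trans (Finset.card_union_le _ _)
  rw [Finset.card_product, Finset.card_product] at h1
  have h2 : P.card + Q.card = U.card := Finset.card_filter_add_card_filter_not _
  rw [← h2]
  zify at h1 ⊢
  nlinarith [sq_nonneg ((P.card : ℤ) - Q.card)]

theorem Sep.card_incid_self_le (h : Sep K U A B) :
    (incid K U U).card ≤ (incid K A A).card + (incid K B B).card := by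
  refine (Finset.card_le_card ?_).trans (Finset.card_union_le _ _)
  rintro ⟨a, b⟩ hp
  obtain ⟨h1, h2, h3, -⟩ := mem_incid.1 hp
  dsimp only at h1 h2 h3
  rw [Finset.mem_union, mem_incid, mem_incid]
  dsimp only
  have ha := h.mem_or h1
  have hb := h.mem_or h2
  have h4 := h.2 a
  have h5 := h.2 b
  by_cases h6 : a ∈ A ∧ b ∈ A
  · exact Or.inl ⟨h6.1, h6.2, h3, Or.inl h6.1⟩
  by_cases h7 : a ∈ B ∧ b ∈ B
  · exact Or.inr ⟨h7.1, h7.2, h3, Or.inl h7.1⟩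
  have h3' := h3.symm
  exfalso
  tauto

/-- The density that defines the core of a bipartite graph of large minimum degree. -/
def IsDense (k : ℕ) (K : SimpleGraph V) (U : Finset V) : Prop :=
  8 * k ≤ U.card ∧ 49 * k * U.card < 2 * (incid K U U).card + 196 * k ^ 2

theorem IsDense.lt_card (hφ : ∀ x y, K.Adj x y → φ x ≠ φ y) (h : IsDense k K U) :
    8 * k < U.card := by
  refine lt_of_le_of_ne h.1 fun e => ?_
  have h1 := h.2
  have h2 := two_mul_card_incid_self_le (U := U) hφ
  rw [← e] at h1 h2
  nlinarith

/-- Deleting a vertex of smaller degree would leave a dense set. -/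
theorem IsDense.lt_degree (hφ : ∀ x y, K.Adj x y → φ x ≠ φ y) (h : IsDense k K U)
    (hmin : ∀ W ⊆ U, W.card < U.card → ¬ IsDense k K W) {v : V} (hv : v ∈ U) :
    49 * k < 4 * (U.filter (K.Adj v)).card := by
  have h1 := h.lt_card hφ
  have h2 := Finset.card_erase_add_one hv
  have h3 := hmin _ (U.erase_subset v) (by omega)
  rw [IsDense, not_and, not_lt] at h3
  have h4 := h3 (by omega)
  have h5 := card_incid_self_le_erase (K := K) (U := U) v
  have h6 := h.2
  rw [← h2] at h6
  nlinarith

/-- Adjacent vertices have disjoint neighbourhoods, each larger than `49k / 4`. -/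
theorem IsDense.lt_two_mul_card (hφ : ∀ x y, K.Adj x y → φ x ≠ φ y) (hk : 1 ≤ k) (h : IsDense k K U)
    (hmin : ∀ W ⊆ U, W.card < U.card → ¬ IsDense k K W) : 49 * k < 2 * U.card := by
  obtain ⟨v, hv⟩ : U.Nonempty := Finset.card_pos.1 (by have := h.1; omega)
  have h1 := h.lt_degree hφ hmin hv
  obtain ⟨w, hw⟩ : (U.filter (K.Adj v)).Nonempty := Finset.card_pos.1 (by omega)
  obtain ⟨hwU, hvw⟩ := Finset.mem_filter.1 hw
  have h2 := h.lt_degree hφ hmin hwU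
  have h3 : Disjoint (U.filter (K.Adj v)) (U.filter (K.Adj w)) := by
    rw [Finset.disjoint_left]
    intro x hx hx'
    have e1 := hφ _ _ (Finset.mem_filter.1 hx).2
    have e2 := hφ _ _ (Finset.mem_filter.1 hx').2
    have e3 := hφ _ _ hvw
    revert e1 e2 e3
    generalize φ v = a
    generalize φ w = b
    generalize φ x = c
    revert a b c
    decide
  have h4 := Finset.card_le_card (Finset.union_subset (Finset.filter_subset (K.Adj v) U)
    (Finset.filter_subset (K.Adj w) U))
  rw [Finset.card_union_of_disjoint h3] at h4
  omega

/-- In terms of the number `e` of edges, dense means `4e > 49k(|U| - 4k)`. Since `K` is bipartite,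
at most `4k²` edges lie inside `X`, a negligible loss as `|U| > 49k / 2`. In a nontrivial separation
of order below `4k` neither side is dense, by minimality, and the sum of the two edge bounds falls
short of the density of `U`, as the overlap is smaller than `4k`. -/
theorem IsDense.massed (hφ : ∀ x y, K.Adj x y → φ x ≠ φ y) (hk : 1 ≤ k) (h : IsDense k K U)
    (hmin : ∀ W ⊆ U, W.card < U.card → ¬ IsDense k K W) (hXU : X ⊆ U) (hX : X.card = 4 * k) :
    Massed (2 * k) K U X := by
  refine ⟨hXU, ?_, fun A B hS hXA hAB => ?_⟩
  · have h1 : (incid K U U).card ≤ (incid K U (U \ X)).card + (incid K X X).card := by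
      refine (Finset.card_le_card ?_).trans (Finset.card_union_le _ _)
      rintro ⟨a, b⟩ hp
      obtain ⟨h1, h2, h3, -⟩ := mem_incid.1 hp
      rw [Finset.mem_union, mem_incid, mem_incid, Finset.mem_sdiff, Finset.mem_sdiff]
      tauto
    have h2 := two_mul_card_incid_self_le (U := X) hφ
    have h3 := h.2
    have h4 := h.lt_two_mul_card hφ hk hmin
    have h5 := Finset.card_sdiff_add_card_eq_card hXU
    rw [hX] at h2 h5
    rw [← h5] at h3 h4
    nlinarith
  · have hBA : B \ A = ∅ := by
      by_contra hne
      obtain ⟨b, hb⟩ := Finset.nonempty_iff_ne_empty.2 hne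
      obtain ⟨a, ha⟩ : (A \ B).Nonempty := by
        rw [Finset.sdiff_nonempty]
        intro hsub
        rw [Finset.inter_eq_left.2 hsub] at hAB
        exact absurd (Finset.card_le_card hXA) (by omega)
      rw [Finset.mem_sdiff] at ha hb
      have hdeg : ∀ {P Q : Finset V}, Sep K U P Q → ∀ x ∈ P, x ∉ Q → 8 * k ≤ P.card := by
        intro P Q hPQ x hxP hxQ
        have h1 := h.lt_degree hφ hmin (hPQ.subset_left hxP)
        have h2 : U.filter (K.Adj x) ⊆ P := by
          intro y hy
          obtain ⟨hyU, hxy⟩ := Finset.mem_filter.1 hy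
          by_contra hyP
          exact hPQ.2 x hxP y ((hPQ.mem_or hyU).resolve_left hyP) hxQ hyP hxy
        have := Finset.card_le_card h2
        omega
      have hAc := hdeg hS a ha.1 ha.2
      have hBc := hdeg hS.symm b hb.1 hb.2
      have hAlt : A.card < U.card := Finset.card_lt_card
        ⟨hS.subset_left, fun h => hb.2 (h (hS.subset_right hb.1))⟩
      have hBlt : B.card < U.card := Finset.card_lt_card
        ⟨hS.subset_right, fun h => ha.2 (h (hS.subset_left ha.1))⟩
      have h1 := hmin A hS.subset_left hAlt
      have h2 := hmin B hS.subset_right hBlt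
      rw [IsDense, not_and, not_lt] at h1 h2
      have h1 := h1 hAc
      have h2 := h2 hBc
      have h3 := hS.card_incid_self_le
      have h4 := Finset.card_union_add_card_inter A B
      rw [hS.1] at h4
      have h5 := h.2
      nlinarith
    rw [hBA]
    simp [incid]

/-- A bipartite graph of large minimum degree contains a highly linked subset. -/
theorem exists_massed_core (hφ : ∀ x y, K.Adj x y → φ x ≠ φ y) (hk : 1 ≤ k) (hW : 8 * k ≤ W.card)
    (hdeg : ∀ v ∈ W, 49 * k ≤ 2 * (W.filter (K.Adj v)).card) :
    ∃ U ⊆ W, 24 * k ≤ U.card ∧ ∀ X ⊆ U, X.card = 4 * k → Massed (2 * k) K U X := by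
  obtain ⟨U, hU, hmin⟩ := Finset.exists_min_image (W.powerset.filter (IsDense k K)) Finset.card (by
    refine ⟨W, Finset.mem_filter.2 ⟨Finset.mem_powerset_self W, hW, ?_⟩⟩
    have h1 := sum_card_neighbors_le (G := K) (subset_refl W)
    have h2 : ∑ _v ∈ W, 49 * k ≤ 2 * ∑ v ∈ W, (W.filter (K.Adj v)).card := by
      rw [Finset.mul_sum]
      exact Finset.sum_le_sum hdeg
    rw [Finset.sum_const, smul_eq_mul] at h2
    have h3 : 0 < k ^ 2 := by positivity
    nlinarith)
  rw [Finset.mem_filter, Finset.mem_powerset] at hU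
  have hmin' : ∀ W ⊆ U, W.card < U.card → ¬ IsDense k K W := fun W' hW' hlt hd =>
    absurd (hmin W' (Finset.mem_filter.2 ⟨Finset.mem_powerset.2 (hW'.trans hU.1), hd⟩)) (by omega)
  have := hU.2.lt_two_mul_card hφ hk hmin'
  exact ⟨U, hU.1, by omega, fun X hXU hX => hU.2.massed hφ hk hmin' hXU hX⟩

end DenseCore

/-! ### From hitting odd `A`-paths to hitting odd cycles. -/

section OddCycles
open scoped Classical
variable {V : Type*} {G : SimpleGraph V} {φ : V → Bool} {A : Finset V}

/-- A path of the wrong parity between vertices of `A` contains an odd `A`-path. -/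
theorem exists_isOddAPath_of_path : ∀ (n : ℕ) {a b : V} (p : G.Walk a b), p.length = n → p.IsPath →
    a ∈ A → b ∈ A → a ≠ b → (Odd p.length ↔ φ a = φ b) →
    ∃ c d, ∃ q : G.Walk c d, IsOddAPath A φ q ∧ ∀ x ∈ q.support, x ∈ p.support := by
  intro n
  induction n using Nat.strong_induction_on with
  | _ n ih =>
  intro a b p hn hp ha hb hab hodd
  by_cases hint : ∀ x ∈ p.support, x ∈ A → x = a ∨ x = b
  · exact ⟨a, b, p, ⟨hp, ha, hb, hab, hint, hodd⟩, fun _ => id⟩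
  push Not at hint
  obtain ⟨x, hx, hxA, hxa, hxb⟩ := hint
  have hlen : (p.takeUntil x hx).length + (p.dropUntil x hx).length = p.length := by
    rw [← SimpleGraph.Walk.length_append, SimpleGraph.Walk.take_spec]
  have h1 : (p.takeUntil x hx).length ≠ 0 := fun h =>
    hxa (SimpleGraph.Walk.eq_of_length_eq_zero h).symm
  have h2 : (p.dropUntil x hx).length ≠ 0 := fun h => hxb (SimpleGraph.Walk.eq_of_length_eq_zero h)
  by_cases ho : Odd (p.takeUntil x hx).length ↔ φ a = φ x
  · obtain ⟨c, d, q, hq, hqs⟩ := ih _ (by omega) _ rfl (hp.takeUntil hx) ha hxA (Ne.symm hxa) ho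
    exact ⟨c, d, q, hq, fun y hy => p.support_takeUntil_subset_support hx (hqs y hy)⟩
  · obtain ⟨c, d, q, hq, hqs⟩ := ih _ (by omega) _ rfl (hp.dropUntil hx) hxA hb hxb (by
      rw [← hlen, Nat.odd_add, ← Nat.not_odd_iff_even] at hodd
      have hbool : ∀ (P Q : Prop) (a b c : Bool), ((P ↔ ¬ Q) ↔ a = b) → ¬ (P ↔ a = c) →
          (Q ↔ c = b) := by
        intro P Q a b c
        by_cases hP : P <;> by_cases hQ : Q <;> simp only [hP, hQ] <;> revert a b c <;> decide
      exact hbool _ _ _ _ _ hodd ho)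
    exact ⟨c, d, q, hq, fun y hy => p.support_dropUntil_subset_support hx (hqs y hy)⟩

/-- Every closed piece removed by `bypass` is a path and one edge. If it is odd, it is an odd cycle;
if all are even, parity is preserved. -/
theorem exists_odd_cycle_or_parity {a b : V} (p : G.Walk a b) :
    (∃ v, ∃ c : G.Walk v v, c.IsCycle ∧ Odd c.length ∧ ∀ x ∈ c.support, x ∈ p.support) ∨
      (Odd p.bypass.length ↔ Odd p.length) := by
  induction p with
  | nil => right; simp [SimpleGraph.Walk.bypass]
  | @cons u v w h q ih =>
    rcases ih with ⟨z, c, hc, ho, hs⟩ | ih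
    · exact Or.inl ⟨z, c, hc, ho, fun x hx => List.mem_cons_of_mem _ (hs x hx)⟩
    by_cases hu : u ∈ q.bypass.support
    · have hb : (SimpleGraph.Walk.cons h q).bypass = q.bypass.dropUntil u hu := by
        simp [SimpleGraph.Walk.bypass, hu]
      have hlen : (q.bypass.takeUntil u hu).length + (q.bypass.dropUntil u hu).length =
          q.bypass.length := by
        rw [← SimpleGraph.Walk.length_append, SimpleGraph.Walk.take_spec]
      by_cases he : Odd (q.bypass.takeUntil u hu).length
      · right
        rw [hb, SimpleGraph.Walk.length_cons, Nat.odd_add_one, ← ih, ← hlen, Nat.odd_add,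
          ← Nat.not_odd_iff_even]
        tauto
      · left
        have hpath := q.bypass_isPath.takeUntil hu
        refine ⟨u, .cons h (q.bypass.takeUntil u hu), ?_, ?_, ?_⟩
        · refine (SimpleGraph.Walk.cons_isCycle_iff _ _).2 ⟨hpath, fun hmem => he ?_⟩
          rw [Sym2.eq_swap] at hmem
          rw [hpath.length_eq_one_of_mem_edges hmem]
          exact odd_one
        · rw [SimpleGraph.Walk.length_cons, Nat.odd_add_one]
          exact he
        · simp only [SimpleGraph.Walk.support_cons, List.mem_cons]
          rintro x (rfl | hx)
          · exact Or.inl rfl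
          · exact Or.inr (q.support_bypass_subset_support
              (q.bypass.support_takeUntil_subset_support hu hx))
    · right
      have hb : (SimpleGraph.Walk.cons h q).bypass = .cons h q.bypass := by
        simp [SimpleGraph.Walk.bypass, hu]
      rw [hb, SimpleGraph.Walk.length_cons, SimpleGraph.Walk.length_cons, Nat.odd_add_one,
        Nat.odd_add_one, ih]

theorem exists_odd_cycle_of_odd_closed {a : V} (p : G.Walk a a) (hp : Odd p.length) :
    ∃ v, ∃ c : G.Walk v v, c.IsCycle ∧ Odd c.length ∧ ∀ x ∈ c.support, x ∈ p.support := by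
  refine (exists_odd_cycle_or_parity p).resolve_right fun h => ?_
  have h1 := h.2 hp
  rw [SimpleGraph.Walk.length_eq_zero_iff.2
    (SimpleGraph.Walk.isPath_iff_nil.1 p.bypass_isPath)] at h1
  exact absurd h1 (by decide)

theorem exists_odd_cycle_of_not_isOddCycleCover {Y : Finset V} (h : ¬ IsOddCycleCover G Y) :
    ∃ v, ∃ c : G.Walk v v, c.IsCycle ∧ Odd c.length ∧ ∀ x ∈ c.support, x ∉ Y := by
  change ¬ (deleteVertices G Y).Colorable 2 at h
  rw [SimpleGraph.two_colorable_iff_forall_loop_even] at h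
  push Not at h
  obtain ⟨u, w, hw⟩ := h
  obtain ⟨w', hl, hs⟩ := exists_walk_of_deleteVertices w
  obtain ⟨v, c, hc, ho, hcs⟩ := exists_odd_cycle_of_odd_closed w' (by rwa [hl, ← Nat.not_even_iff_odd])
  exact ⟨v, c, hc, ho, fun x hx => hs x (hcs x hx)⟩

/-- Two vertices of an odd cycle are joined by paths of both parities. -/
theorem exists_path_of_odd_cycle {v : V} {c : G.Walk v v} (hc : c.IsCycle) (ho : Odd c.length)
    {a b : V} (ha : a ∈ c.support) (hb : b ∈ c.support) (hab : a ≠ b) (P : Prop) :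
    ∃ p : G.Walk a b, p.IsPath ∧ (Odd p.length ↔ P) ∧ ∀ x ∈ p.support, x ∈ c.support := by
  have hc' := hc.rotate ha
  have hmem : ∀ x, x ∈ (c.rotate a ha).support ↔ x ∈ c.support := fun x =>
    SimpleGraph.Walk.mem_support_rotate_iff _ _ ha
  have hb' : b ∈ (c.rotate a ha).support := (hmem b).2 hb
  have hlen : ((c.rotate a ha).takeUntil b hb').length + ((c.rotate a ha).dropUntil b hb').length =
      c.length := by
    rw [← SimpleGraph.Walk.length_append, SimpleGraph.Walk.take_spec,
      SimpleGraph.Walk.length_rotate]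
  have hp1 := hc'.isPath_takeUntil hb'
  have hp2 : ((c.rotate a ha).dropUntil b hb').IsPath := by
    refine SimpleGraph.Walk.IsCycle.isPath_of_append_right (p := (c.rotate a ha).takeUntil b hb')
      (fun h => hab h.eq) ?_
    rwa [SimpleGraph.Walk.take_spec]
  by_cases hP : Odd ((c.rotate a ha).takeUntil b hb').length ↔ P
  · exact ⟨_, hp1, hP, fun x hx => (hmem x).1 (SimpleGraph.Walk.support_takeUntil_subset_support _ hb' hx)⟩
  · refine ⟨((c.rotate a ha).dropUntil b hb').reverse, hp2.reverse, ?_, fun x hx => ?_⟩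
    · rw [SimpleGraph.Walk.length_reverse]
      rw [← hlen, Nat.odd_add, ← Nat.not_odd_iff_even] at ho
      tauto
    · rw [SimpleGraph.Walk.support_reverse, List.mem_reverse] at hx
      exact (hmem x).1 (SimpleGraph.Walk.support_dropUntil_subset_support _ hb' hx)

/-- Deleting a set that meets all odd `A`-paths destroys all odd cycles. -/
theorem isOddCycleCover_of_hitting [Fintype V] {n : ℕ} (hG : IsVertexConnected G n) {Y : Finset V}
    (hY : Y.card + 1 < n) (hA : 2 ≤ (A \ Y).card)
    (hit : ∀ c d, ∀ q : G.Walk c d, IsOddAPath A φ q → ∃ x ∈ q.support, x ∈ Y) :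
    IsOddCycleCover G Y := by
  by_contra hcon
  obtain ⟨v, c, hc, ho, hcY⟩ := exists_odd_cycle_of_not_isOddCycleCover hcon
  obtain ⟨X, hX, hX2⟩ := Finset.exists_subset_card_eq hA
  have hXY : X ⊆ Yᶜ := fun x hx => Finset.mem_compl.2 (Finset.mem_sdiff.1 (hX hx)).2
  have hcW : c.support.toFinset ⊆ Yᶜ := fun x hx =>
    Finset.mem_compl.2 (hcY x (List.mem_toFinset.1 hx))
  have hc3 : 2 < c.support.toFinset.card := by
    have h1 := hc.three_le_length
    have h2 : c.support.tail.toFinset ⊆ c.support.toFinset := fun x hx =>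
      List.mem_toFinset.2 (List.mem_of_mem_tail (List.mem_toFinset.1 hx))
    have h3 := Finset.card_le_card h2
    rw [List.toFinset_card_of_nodup hc.support_nodup, List.length_tail,
      SimpleGraph.Walk.length_support] at h3
    omega
  rcases menger G Yᶜ X c.support.toFinset hXY hcW with ⟨C, f, hL, hdis⟩ | ⟨P, Q, hS, hXP, hcQ, hlt⟩
  · obtain ⟨a, b, hab, rfl⟩ := Finset.card_eq_two.1 hX2
    obtain ⟨hfa, hCa, hcona, hCac⟩ := hL a (by simp)
    obtain ⟨hfb, hCb, hconb, hCbc⟩ := hL b (by simp)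
    have hCC := Finset.disjoint_left.1 (hdis a (by simp) b (by simp) hab)
    obtain ⟨wa, hwa⟩ := hcona
    obtain ⟨wb, hwb⟩ := hconb
    have hfab : f a ≠ f b := fun e => hCC (hwa _ wa.end_mem_support) (e ▸ hwb _ wb.end_mem_support)
    rw [List.mem_toFinset] at hfa hfb
    -- The cycle offers both parities; the one chosen makes the whole path from `a` to `b` disagree
    -- with the colours of its ends.
    obtain ⟨p, hp, hpo, hps⟩ := exists_path_of_odd_cycle hc ho hfa hfb hfab
      ((Odd wa.bypass.length ↔ (Odd wb.bypass.length ↔ φ a = φ b)))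
    have hsa : ∀ x ∈ wa.bypass.support, x ∈ C a := fun x hx =>
      hwa x (wa.support_bypass_subset_support hx)
    have hsb : ∀ x ∈ wb.bypass.support, x ∈ C b := fun x hx =>
      hwb x (wb.support_bypass_subset_support hx)
    have h1 : (wa.bypass.append p).IsPath := isPath_append wa.bypass_isPath hp fun x hx hx' =>
      hCac x (hsa x hx) (List.mem_toFinset.2 (hps x hx'))
    have h2 : ((wa.bypass.append p).append wb.bypass.reverse).IsPath := by
      refine isPath_append h1 wb.bypass_isPath.reverse fun x hx hx' => ?_
      rw [SimpleGraph.Walk.support_reverse, List.mem_reverse] at hx'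
      rcases (SimpleGraph.Walk.mem_support_append_iff _ _).1 hx with h | h
      · exact absurd (hsb x hx') (hCC (hsa x h))
      · exact hCbc x (hsb x hx') (List.mem_toFinset.2 (hps x h))
    have h3 : Odd ((wa.bypass.append p).append wb.bypass.reverse).length ↔ φ a = φ b := by
      have e : ∀ n m : ℕ, Odd (n + m) ↔ (Odd n ↔ ¬ Odd m) := fun n m => by
        rw [Nat.odd_add, Nat.not_odd_iff_even]
      rw [SimpleGraph.Walk.length_append, SimpleGraph.Walk.length_append,
        SimpleGraph.Walk.length_reverse, e, e, hpo]
      tauto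
    obtain ⟨c', d', q, hq, hqs⟩ := exists_isOddAPath_of_path (A := A) _ _ rfl h2
      (Finset.mem_sdiff.1 (hX (by simp))).1 (Finset.mem_sdiff.1 (hX (by simp))).1 hab h3
    obtain ⟨x, hx, hxY⟩ := hit _ _ q hq
    have hx := hqs x hx
    simp only [SimpleGraph.Walk.mem_support_append_iff, SimpleGraph.Walk.support_reverse,
      List.mem_reverse] at hx
    rcases hx with (hx | hx) | hx
    · exact Finset.mem_compl.1 (hCa (hsa x hx)) hxY
    · exact hcY x (hps x hx) hxY
    · exact Finset.mem_compl.1 (hCb (hsb x hx)) hxY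
  · have hc1 := Finset.card_union_le (Yᶜ)ᶜ (P ∩ Q)
    rw [compl_compl] at hc1
    rcases hG.sep_trivial hS (by rw [compl_compl]; omega) with h | h
    · rw [Finset.inter_eq_left.2 h] at hlt
      exact absurd (Finset.card_le_card hXP) (by omega)
    · rw [Finset.inter_eq_right.2 h] at hlt
      exact absurd (Finset.card_le_card hcQ) (by omega)

end OddCycles

/-! ### Fans that avoid most of a family of disjoint paths. -/

section Fan
open scoped Classical
variable {V : Type*} {G : SimpleGraph V} {φ : V → Bool} {A W X : Finset V} {m : ℕ}

theorem eq_of_isPath_append {a b c x : V} {p : G.Walk a b} {q : G.Walk b c} (h : (p.append q).IsPath)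
    (hp : x ∈ p.support) (hq : x ∈ q.support) : x = b := by
  rw [SimpleGraph.Walk.isPath_def, SimpleGraph.Walk.support_append, List.nodup_append'] at h
  rw [← q.cons_tail_support, List.mem_cons] at hq
  exact hq.resolve_right fun hq => h.2.2 hp hq

theorem exists_exit_edge (P : V → Prop) {a b : V} (p : G.Walk a b) (ha : P a) (hb : ¬ P b) :
    ∃ y z, P y ∧ ¬ P z ∧ G.Adj y z ∧ z ∈ p.support := by
  induction p with
  | nil => exact absurd ha hb
  | @cons u v w h q ih =>
    by_cases hv : P v
    · obtain ⟨y, z, h1, h2, h3, h4⟩ := ih hv hb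
      exact ⟨y, z, h1, h2, h3, List.mem_cons_of_mem _ h4⟩
    · exact ⟨u, v, ha, hv, h, List.mem_cons_of_mem _ q.start_mem_support⟩

/-- If a fan path meets `P` and no fan path ends on it, then an edge outside `P` is superfluous. -/
theorem Linkage.reroute {C : V → Finset V} {f : V → V} (hL : Linkage G W X A C f)
    (hC : ∀ x ∈ X, ∃ w : G.Walk x (f x), w.IsPath ∧ w.support.toFinset = C x)
    {c e : V} {p : G.Walk c e} (hp : IsOddAPath A φ p) (hpW : ∀ x ∈ p.support, x ∈ W)
    (hf : ∀ x ∈ X, f x ∉ p.support) (hmeet : ∃ x ∈ X, ∃ v ∈ C x, v ∈ p.support) :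
    ∃ y z, G.Adj y z ∧ y ∈ p.support ∧ z ∉ p.support ∧
      ∃ C f, Linkage (G.deleteEdges {s(y, z)}) W X A C f := by
  obtain ⟨hpath, hcA, heA, -, hpA, -⟩ := hp
  obtain ⟨x₀, hx₀, v₀, hv₀, hv₀p⟩ := hmeet
  have hv₀e : e ≠ v₀ := by
    rintro rfl
    exact hf x₀ hx₀ ((hL.1 x₀ hx₀).2.2.2 _ hv₀ heA ▸ hv₀p)
  have her := SimpleGraph.Walk.endpoint_notMem_support_takeUntil hpath hv₀p hv₀e
  -- `q` is the first fan vertex on `p` seen from `c`. Its fan path is rerouted at `q` along `p` to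
  -- `c`. The old path does not end on `p`, so after `q` it leaves `p` by an edge `yz` that is now
  -- unused.
  obtain ⟨q, r, ⟨x, hx, hq⟩, hr, hr'⟩ := exists_first_hit (fun v => ∃ x ∈ X, v ∈ C x)
    (p.takeUntil v₀ hv₀p) ⟨v₀, SimpleGraph.Walk.end_mem_support _, x₀, hx₀, hv₀⟩
  have hrp : ∀ y ∈ r.support, y ∈ p.support := fun y hy =>
    p.support_takeUntil_subset_support hv₀p (hr y hy)
  obtain ⟨w, hw, hwC⟩ := hC x hx
  have hwmem : ∀ y, y ∈ w.support ↔ y ∈ C x := fun y => by rw [← hwC, List.mem_toFinset]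
  obtain ⟨-, hCW, -, hCA⟩ := hL.1 x hx
  have hqw : q ∈ w.support := (hwmem q).2 hq
  have hqp : q ∈ p.support := hrp q r.end_mem_support
  have hw12 : ((w.takeUntil q hqw).append (w.dropUntil q hqw)).IsPath := by
    rwa [SimpleGraph.Walk.take_spec]
  obtain ⟨y, z, hy, hz, hyz, hzw⟩ := exists_exit_edge (· ∈ p.support) (w.dropUntil q hqw) hqp (hf x hx)
  have hzC : z ∈ C x := (hwmem z).1 (w.support_dropUntil_subset_support hqw hzw)
  have hzD : ∀ v ∈ (w.takeUntil q hqw).support.toFinset ∪ r.support.toFinset, v ≠ z := by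
    rintro v hv rfl
    rcases Finset.mem_union.1 hv with hv | hv <;> rw [List.mem_toFinset] at hv
    · exact hz (eq_of_isPath_append hw12 hv hzw ▸ hqp)
    · exact hz (hrp _ hv)
  have hdel : ∀ {D : Finset V} {a b : V}, Conn G D a b → (∀ v ∈ D, v ≠ z) →
      Conn (G.deleteEdges {s(y, z)}) D a b := by
    intro D a b h hD
    refine h.mono subset_rfl fun u v hu hv huv => SimpleGraph.deleteEdges_adj.2 ⟨huv, fun he => ?_⟩
    rcases Sym2.eq_iff.1 he with ⟨-, h⟩ | ⟨h, -⟩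
    exacts [hD v hv h, hD u hu h]
  have hDC : ∀ x' ∈ X, x' ≠ x →
      Disjoint ((w.takeUntil q hqw).support.toFinset ∪ r.support.toFinset) (C x') := by
    intro x' hx' hne
    have hd := Finset.disjoint_left.1 (hL.2 x hx x' hx' hne.symm)
    rw [Finset.disjoint_left]
    intro v hv hv'
    rcases Finset.mem_union.1 hv with hv | hv <;> rw [List.mem_toFinset] at hv
    · exact hd ((hwmem v).1 (w.support_takeUntil_subset_support hqw hv)) hv'
    · exact hd (hr' v hv ⟨x', hx', hv'⟩ ▸ hq) hv'
  refine ⟨y, z, hyz, hy, hz, Function.update C x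
    ((w.takeUntil q hqw).support.toFinset ∪ r.support.toFinset), Function.update f x c, ?_, ?_⟩
  · intro x' hx'
    by_cases hxx : x' = x
    · rw [hxx, Function.update_self, Function.update_self]
      refine ⟨hcA, fun v hv => ?_, hdel ?_ hzD, fun v hv hvA => ?_⟩
      · rcases Finset.mem_union.1 hv with hv | hv <;> rw [List.mem_toFinset] at hv
        · exact hCW ((hwmem v).1 (w.support_takeUntil_subset_support hqw hv))
        · exact hpW v (hrp v hv)
      · refine ⟨(w.takeUntil q hqw).append r.reverse, fun v hv => ?_⟩
        simpa [SimpleGraph.Walk.mem_support_append_iff] using hv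
      · rcases Finset.mem_union.1 hv with hv | hv <;> rw [List.mem_toFinset] at hv
        · have h1 := hCA v ((hwmem v).1 (w.support_takeUntil_subset_support hqw hv)) hvA
          have hv2 : v ∈ (w.dropUntil q hqw).support := by
            rw [h1]
            exact SimpleGraph.Walk.end_mem_support _
          have h2 := eq_of_isPath_append hw12 hv hv2
          exact absurd (by rwa [← h1, h2]) (hf x hx)
        · exact (hpA v (hrp v hv) hvA).resolve_right fun h => her (h ▸ hr v hv)
    · rw [Function.update_of_ne hxx, Function.update_of_ne hxx]
      obtain ⟨h1, h2, h3, h4⟩ := hL.1 x' hx'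
      refine ⟨h1, h2, hdel h3 ?_, h4⟩
      rintro v hv rfl
      exact Finset.disjoint_left.1 (hL.2 x hx x' hx' (Ne.symm hxx)) hzC hv
  · intro a ha b hb hab
    by_cases hax : a = x
    · subst hax
      rw [Function.update_self, Function.update_of_ne hab.symm]
      exact hDC b hb hab.symm
    · by_cases hbx : b = x
      · subst hbx
        rw [Function.update_self, Function.update_of_ne hab]
        exact (hDC a ha hab).symm
      · rw [Function.update_of_ne hax, Function.update_of_ne hbx]
        exact hL.2 a ha b hb hab

/-- A fan to `A` can be chosen so that it avoids all but few of given disjoint `A`-paths. -/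
theorem Linkage.exists_avoiding [Finite V] (hL : ∃ C f, Linkage G W X A C f) {c e : Fin m → V}
    {p : ∀ i, G.Walk (c i) (e i)} (hp : ∀ i, IsOddAPath A φ (p i))
    (hdis : ∀ i j, i ≠ j → ∀ w ∈ (p i).support, w ∉ (p j).support)
    (hpW : ∀ i, ∀ x ∈ (p i).support, x ∈ W) :
    ∃ C f, Linkage G W X A C f ∧
      m ≤ X.card + (Finset.univ.filter fun j => ∀ x ∈ X, ∀ v ∈ C x, v ∉ (p j).support).card := by
  -- In a minimal subgraph that contains the given paths and a fan, `Linkage.reroute` is impossible.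
  -- So each path met by the fan contains the end of a fan path, and at most `|X|` paths are met.
  obtain ⟨H, ⟨hHG, hpH, C₀, f, hL⟩, hmin⟩ := (wellFounded_lt (α := SimpleGraph V)).has_min
    {H | H ≤ G ∧ (∀ i, ∀ x y, s(x, y) ∈ (p i).edges → H.Adj x y) ∧ ∃ C f, Linkage H W X A C f}
    ⟨G, le_rfl, fun i x y h => (p i).adj_of_mem_edges h, hL⟩
  have hpath : ∀ x, ∃ D : Finset V, x ∈ X → D ⊆ C₀ x ∧ ∃ w : H.Walk x (f x), w.IsPath ∧
      w.support.toFinset = D := by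
    intro x
    by_cases hx : x ∈ X
    · obtain ⟨w, hw⟩ := (hL.1 x hx).2.2.1
      exact ⟨_, fun _ => ⟨fun v hv => hw v (w.support_bypass_subset_support (List.mem_toFinset.1 hv)),
        w.bypass, w.bypass_isPath, rfl⟩⟩
    · exact ⟨∅, fun h => absurd h hx⟩
  choose C hC using hpath
  have hLC : Linkage H W X A C f := by
    refine ⟨fun x hx => ?_, fun x hx y hy hxy =>
      Finset.disjoint_of_subset_left (hC x hx).1 (Finset.disjoint_of_subset_right (hC y hy).1
        (hL.2 x hx y hy hxy))⟩
    obtain ⟨h1, h2, h3, h4⟩ := hL.1 x hx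
    obtain ⟨h5, w, hw, hwC⟩ := hC x hx
    exact ⟨h1, h5.trans h2, ⟨w, fun v hv => hwC ▸ List.mem_toFinset.2 hv⟩, fun z hz => h4 z (h5 hz)⟩
  have key : ∀ j, (∃ x ∈ X, ∃ v ∈ C x, v ∈ (p j).support) → ∃ x ∈ X, f x ∈ (p j).support := by
    intro j hj
    by_contra hf
    push Not at hf
    have hedge : ∀ s ∈ (p j).edges, s ∈ H.edgeSet := by
      intro s
      refine Sym2.ind (fun x y h => ?_) s
      exact hpH j x y h
    obtain ⟨hp1, hp2, hp3, hp4, hp5, hp6⟩ := hp j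
    obtain ⟨y, z, hyz, hy, hz, hL'⟩ := hLC.reroute (φ := φ) (fun x hx => (hC x hx).2)
      (p := (p j).transfer H hedge)
      ⟨hp1.transfer hedge, hp2, hp3, hp4, by simpa using hp5, by simpa using hp6⟩
      (by simpa using hpW j) (by simpa using hf) (by simpa using hj)
    rw [SimpleGraph.Walk.support_transfer] at hy hz
    refine hmin (H.deleteEdges {s(y, z)}) ⟨(SimpleGraph.deleteEdges_le _).trans hHG,
      fun i a b hab => SimpleGraph.deleteEdges_adj.2 ⟨hpH i a b hab, fun he => ?_⟩, hL'⟩ ?_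
    · rw [Set.mem_singleton_iff] at he
      rw [he] at hab
      have hyi := (p i).fst_mem_support_of_mem_edges hab
      have hzi := (p i).snd_mem_support_of_mem_edges hab
      by_cases hij : i = j
      · exact hz (hij ▸ hzi)
      · exact hdis i j hij y hyi hy
    · refine lt_of_le_of_ne (SimpleGraph.deleteEdges_le _) fun he => ?_
      rw [← he, SimpleGraph.deleteEdges_adj] at hyz
      exact hyz.2 rfl
  refine ⟨C, f, ⟨fun x hx => ?_, hLC.2⟩, ?_⟩
  · obtain ⟨h1, h2, h3, h4⟩ := hLC.1 x hx
    exact ⟨h1, h2, h3.mono subset_rfl fun _ _ _ _ h => hHG h, h4⟩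
  · have h1 := Finset.card_filter_add_card_filter_not (s := (Finset.univ : Finset (Fin m)))
      (fun j => ∀ x ∈ X, ∀ v ∈ C x, v ∉ (p j).support)
    rw [Finset.card_univ, Fintype.card_fin] at h1
    have h2 : (Finset.univ.filter fun j => ¬ ∀ x ∈ X, ∀ v ∈ C x, v ∉ (p j).support).card ≤ X.card := by
      have hkey : ∀ j, ∃ x, (¬ ∀ x ∈ X, ∀ v ∈ C x, v ∉ (p j).support) →
          x ∈ X ∧ f x ∈ (p j).support := by
        intro j
        by_cases hj : ∀ x ∈ X, ∀ v ∈ C x, v ∉ (p j).support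
        · exact ⟨c j, fun h => absurd hj h⟩
        · push Not at hj
          obtain ⟨x, hx, h⟩ := key j hj
          exact ⟨x, fun _ => ⟨hx, h⟩⟩
      choose g hg using hkey
      refine Finset.card_le_card_of_injOn g (fun j hj => (hg j (Finset.mem_filter.1 hj).2).1) ?_
      intro i hi j hj hij
      have hi' := (hg i (Finset.mem_filter.1 hi).2).2
      have hj' := (hg j (Finset.mem_filter.1 hj).2).2
      by_contra hne
      exact hdis i j hne _ hi' (hij ▸ hj')
    omega

end Fan

/-! ### The case of many disjoint odd paths, and the theorem. -/

section FarFromBipartite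
open scoped Classical
variable {V : Type*} {G : SimpleGraph V} {φ : V → Bool} {A W T : Finset V} {S : Set V} {k : ℕ}

/-- The graph without the edges at `T`. -/
def isolate (G : SimpleGraph V) (T : Finset V) : SimpleGraph V where
  Adj x y := G.Adj x y ∧ x ∉ T ∧ y ∉ T
  symm := ⟨fun _ _ h => ⟨h.1.symm, h.2.2, h.2.1⟩⟩
  loopless := ⟨fun _ h => h.1.ne rfl⟩

theorem isolate_le : isolate G T ≤ G := fun _ _ h => h.1

theorem notMem_of_isolate_walk {a b : V} (p : (isolate G T).Walk a b) (ha : a ∉ T) :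
    ∀ x ∈ p.support, x ∉ T := by
  induction p with
  | nil => simpa using ha
  | @cons u v w h q ih =>
    simp only [SimpleGraph.Walk.support_cons, List.mem_cons, forall_eq_or_imp]
    exact ⟨ha, ih h.2.2⟩

/-- The properly coloured edges. -/
def properPart (G : SimpleGraph V) (φ : V → Bool) : SimpleGraph V where
  Adj x y := G.Adj x y ∧ φ x ≠ φ y
  symm := ⟨fun _ _ h => ⟨h.1.symm, h.2.symm⟩⟩
  loopless := ⟨fun _ h => h.2 rfl⟩

theorem IsOddAPath.transfer {H : SimpleGraph V} {a b : V} {p : G.Walk a b} (hp : IsOddAPath A φ p)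
    (h : ∀ s ∈ p.edges, s ∈ H.edgeSet) : IsOddAPath A φ (p.transfer H h) := by
  obtain ⟨h1, h2, h3, h4, h5, h6⟩ := hp
  exact ⟨h1.transfer h, h2, h3, h4, by simpa using h5, by simpa using h6⟩

theorem exists_ear {H : SimpleGraph V} (hH : H ≤ G) {C C' : Finset V} {t u w a b : V}
    (hu : Conn H C u a) (hw : Conn H C' w b) (hCC : Disjoint C C') (ht : t ∉ C) (ht' : t ∉ C')
    (htA : t ∉ A) (hut : G.Adj t u) (htw : G.Adj t w) (ha : a ∈ A) (hb : b ∈ A)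
    (hCA : ∀ z ∈ C, z ∈ A → z = a) (hCA' : ∀ z ∈ C', z ∈ A → z = b) :
    ∃ f : G.Walk a b, IsEar A f ∧ t ∈ f.support ∧ ∀ x ∈ f.support, x = t ∨ x ∈ C ∨ x ∈ C' := by
  rw [Finset.disjoint_left] at hCC
  have hab : a ≠ b := fun e => hCC hu.right (e ▸ hw.right)
  obtain ⟨p₀, hp₀⟩ := hu
  obtain ⟨q₀, hq₀⟩ := hw
  have hpC : ∀ x ∈ (p₀.bypass.mapLe hH).reverse.support, x ∈ C := by
    intro x hx
    rw [SimpleGraph.Walk.support_reverse, List.mem_reverse,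
      SimpleGraph.Walk.support_mapLe_eq_support] at hx
    exact hp₀ x (p₀.support_bypass_subset_support hx)
  have hqC : ∀ x ∈ (q₀.bypass.mapLe hH).support, x ∈ C' := by
    intro x hx
    rw [SimpleGraph.Walk.support_mapLe_eq_support] at hx
    exact hq₀ x (q₀.support_bypass_subset_support hx)
  have hp := (p₀.bypass_isPath.mapLe hH).reverse
  have hq := q₀.bypass_isPath.mapLe hH
  revert hp hq hpC hqC
  generalize (p₀.bypass.mapLe hH).reverse = p
  generalize q₀.bypass.mapLe hH = q
  intro hpC hqC hp hq
  have hs : ∀ x ∈ (p.append (.cons hut.symm (.cons htw q))).support, x = t ∨ x ∈ C ∨ x ∈ C' := by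
    intro x hx
    simp only [SimpleGraph.Walk.mem_support_append_iff, SimpleGraph.Walk.support_cons,
      List.mem_cons] at hx
    rcases hx with hx | rfl | rfl | hx
    exacts [Or.inr (Or.inl (hpC x hx)), Or.inr (Or.inl (hpC _ p.end_mem_support)), Or.inl rfl,
      Or.inr (Or.inr (hqC x hx))]
  refine ⟨p.append (.cons hut.symm (.cons htw q)), ⟨isPath_append hp ?_ ?_, ha, hb, hab, ?_⟩, ?_, hs⟩
  · rw [SimpleGraph.Walk.cons_isPath_iff, SimpleGraph.Walk.cons_isPath_iff,
      SimpleGraph.Walk.support_cons, List.mem_cons, not_or]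
    exact ⟨⟨hq, fun h => ht' (hqC _ h)⟩, hut.ne', fun h => hCC (hpC _ p.end_mem_support) (hqC _ h)⟩
  · intro x hx hx'
    simp only [SimpleGraph.Walk.support_cons, List.mem_cons] at hx'
    rcases hx' with rfl | rfl | hx'
    exacts [rfl, absurd (hpC _ hx) ht, absurd (hqC _ hx') (hCC (hpC _ hx))]
  · intro x hx hxA
    rcases hs x hx with rfl | h | h
    exacts [absurd hxA htA, Or.inl (hCA x h hxA), Or.inr (hCA' x h hxA)]
  · simp [SimpleGraph.Walk.mem_support_append_iff]

variable [Fintype V]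

/-- Either the packing exists or few vertices meet all odd cycles. -/
theorem packing_or_isOddCycleCover (hk : 1 ≤ k) (hG : IsVertexConnected G (50 * k))
    (hS : k ≤ S.ncard) :
    HasDisjointOddSCycles G S k ∨ ∃ Y : Finset V, Y.card ≤ 7 * k ∧ IsOddCycleCover G Y := by
  obtain ⟨T, hTS, hTk⟩ : ∃ T : Finset V, (∀ x ∈ T, x ∈ S) ∧ T.card = k := by
    rw [Set.ncard_eq_toFinset_card'] at hS
    obtain ⟨T, hT, hc⟩ := Finset.exists_subset_card_eq hS
    exact ⟨T, fun x hx => by simpa using hT hx, hc⟩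
  obtain ⟨φ, hφ⟩ := exists_max_cut (isolate G T)
  have hdegT : ∀ v, 49 * k ≤ (Tᶜ.filter (G.Adj v)).card := by
    intro v
    have h1 := hG.le_degree v
    have h2 : Finset.univ.filter (G.Adj v) ⊆ Tᶜ.filter (G.Adj v) ∪ T := by
      intro x hx
      have := (Finset.mem_filter.1 hx).2
      by_cases hxT : x ∈ T <;> simp [hxT, this]
    have h3 := (Finset.card_le_card h2).trans (Finset.card_union_le _ _)
    omega
  have hTc := Finset.card_add_card_compl T
  have hV := hG.card_lt
  set K := properPart (isolate G T) φ
  have hKφ : ∀ x y, K.Adj x y → φ x ≠ φ y := fun x y h => h.2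
  have hKG : K ≤ G := fun x y h => h.1.1
  obtain ⟨U, hUT, hU, hmass⟩ := exists_massed_core (K := K) (W := Tᶜ) hKφ hk (by omega) (by
    intro v hv
    have hvT := Finset.mem_compl.1 hv
    have h1 : Finset.univ.filter ((isolate G T).Adj v) = Tᶜ.filter (G.Adj v) := by
      ext x
      simp only [Finset.mem_filter, Finset.mem_univ, true_and, Finset.mem_compl]
      exact ⟨fun h => ⟨h.2.2, h.1⟩, fun h => ⟨h.2, hvT, h.1⟩⟩
    have h2 : (Finset.univ.filter fun w => (isolate G T).Adj v w ∧ φ v ≠ φ w) ⊆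
        Tᶜ.filter (K.Adj v) := by
      intro x hx
      have h := (Finset.mem_filter.1 hx).2
      exact Finset.mem_filter.2 ⟨Finset.mem_compl.2 h.1.2.2, h⟩
    have h3 := hφ v
    have h4 := hdegT v
    have h5 := Finset.card_le_card h2
    rw [h1] at h3
    omega)
  have hUnT : ∀ x ∈ U, x ∉ T := fun x hx => Finset.mem_compl.1 (hUT hx)
  -- Three times `k`, because the fan below may meet `2k` of the paths. Failing that, `|T ∪ Z| < k +
  -- 6k`.
  rcases disjoint_oddAPaths_or_hitting (isolate G T) U φ (3 * k) (by omega) with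
    ⟨c, e, p, hp, hpdis⟩ | ⟨Z, hZ, hit⟩
  swap
  · right
    have hTZ := Finset.card_union_le T Z
    refine ⟨T ∪ Z, by omega, isOddCycleCover_of_hitting (A := U) (φ := φ) hG (by omega) ?_ ?_⟩
    · have := Finset.le_card_sdiff (T ∪ Z) U
      omega
    · intro a b q hq
      by_contra hcon
      push Not at hcon
      have hqT : ∀ x ∈ q.support, x ∉ T := fun x hx hxT => hcon x hx (Finset.mem_union_left _ hxT)
      have hedge : ∀ s ∈ q.edges, s ∈ (isolate G T).edgeSet := by
        intro s
        refine Sym2.ind (fun x y h => ?_) s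
        exact ⟨q.adj_of_mem_edges h, hqT x (q.fst_mem_support_of_mem_edges h),
          hqT y (q.snd_mem_support_of_mem_edges h)⟩
      obtain ⟨x, hx, hxZ⟩ := hit a b _ (hq.transfer hedge)
      rw [SimpleGraph.Walk.support_transfer] at hx
      exact hcon x hx (Finset.mem_union_right _ hxZ)
  left
  let t : Fin k → V := fun i => ((finCongr hTk.symm).trans T.equivFin.symm i : T)
  have htT : ∀ i, t i ∈ T := fun i => Subtype.property _
  have htinj : Function.Injective t := fun i j h =>
    ((finCongr hTk.symm).trans T.equivFin.symm).injective (Subtype.ext h)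
  -- Two private neighbours for each vertex of `T`, from which the fan to `U` starts.
  obtain ⟨h, hinj, hN⟩ := exists_injective_choice (ι := Fin k × Bool)
    (fun x => Tᶜ.filter (G.Adj (t x.1))) (by
      intro x
      have := hdegT (t x.1)
      rw [Fintype.card_prod, Fintype.card_fin, Fintype.card_bool]
      omega)
  simp only [Finset.mem_filter] at hN
  have hX : (Finset.univ.image h).card = 2 * k := by
    rw [Finset.card_image_of_injective _ hinj, Finset.card_univ, Fintype.card_prod, Fintype.card_fin,
      Fintype.card_bool, mul_comm]
  have hXT : Finset.univ.image h ⊆ Tᶜ := by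
    intro x hx
    obtain ⟨i, -, rfl⟩ := Finset.mem_image.1 hx
    exact (hN i).1
  have hfan : ∃ C f, Linkage (isolate G T) Tᶜ (Finset.univ.image h) U C f := by
    refine (menger (isolate G T) Tᶜ _ U hXT hUT).resolve_right ?_
    rintro ⟨P, Q, hPQ, hXP, hUQ, hlt⟩
    have hPQ' : Sep G Tᶜ P Q := hPQ.mono fun x hx y hy hxy =>
      ⟨hxy, Finset.mem_compl.1 hx, Finset.mem_compl.1 hy⟩
    have hc := Finset.card_union_le (Tᶜ)ᶜ (P ∩ Q)
    rw [compl_compl] at hc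
    rcases hG.sep_trivial hPQ' (by rw [compl_compl]; omega) with h | h
    · rw [Finset.inter_eq_left.2 h] at hlt
      exact absurd (Finset.card_le_card hXP) (by omega)
    · rw [Finset.inter_eq_right.2 h] at hlt
      exact absurd (Finset.card_le_card hUQ) (by omega)
  have hpT : ∀ i, ∀ x ∈ (p i).support, x ∉ T := fun i =>
    notMem_of_isolate_walk (p i) (hUnT _ (hp i).2.1)
  obtain ⟨C, f, ⟨hL, hLdis⟩, hcount⟩ := Linkage.exists_avoiding hfan hp hpdis
    fun i x hx => Finset.mem_compl.2 (hpT i x hx)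
  rw [hX] at hcount
  obtain ⟨ι⟩ : Nonempty (Fin k ↪ (Finset.univ.filter fun j => ∀ x ∈ Finset.univ.image h,
      ∀ v ∈ C x, v ∉ (p j).support : Finset _)) :=
    Function.Embedding.nonempty_of_card_le (by
      rw [Fintype.card_fin, Fintype.card_coe]
      refine le_trans (Nat.le_of_add_le_add_left
        ((by omega : 2 * k + k ≤ 3 * k).trans hcount)) (le_of_eq ?_)
      congr!)
  have hι : ∀ i x, ∀ v ∈ C (h x), v ∉ (p (ι i).1).support := fun i x =>
    (Finset.mem_filter.1 (ι i).2).2 _ (Finset.mem_image_of_mem _ (Finset.mem_univ x))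
  have hιinj : ∀ i j, i ≠ j → (ι i).1 ≠ (ι j).1 := fun i j hij e =>
    hij (ι.injective (Subtype.ext e))
  have hL' := fun x => hL (h x) (Finset.mem_image_of_mem _ (Finset.mem_univ x))
  have hCdis : ∀ x y, x ≠ y → ∀ v ∈ C (h x), v ∉ C (h y) := fun x y hxy v hv =>
    Finset.disjoint_left.1 (hLdis _ (Finset.mem_image_of_mem _ (Finset.mem_univ x)) _
      (Finset.mem_image_of_mem _ (Finset.mem_univ y)) fun e => hxy (hinj e)) hv
  have hCT : ∀ x, ∀ v ∈ C (h x), v ∉ T := fun x v hv => Finset.mem_compl.1 ((hL' x).2.1 hv)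
  -- Cycle `i` consists of `t i` with its two fan paths, which form an ear, and possibly one odd
  -- path that the fan misses, completed by links in `U`.
  refine hasDisjointOddSCycles_of_completable (G := G) (K := K) (W := U)
    (fun i => {t i} ∪ (C (h (i, true)) ∪ C (h (i, false))) ∪ (p (ι i).1).support.toFinset) ?_ ?_
    (linkable_of_massed hk (by omega) hmass)
  · intro i j hij
    have hCC : ∀ b b', ∀ v ∈ C (h (i, b)), v ∉ C (h (j, b')) := fun b b' =>
      hCdis _ _ fun e => hij (Prod.ext_iff.1 e).1
    rw [Finset.disjoint_left]
    intro v hv hv'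
    simp only [Finset.mem_union, Finset.mem_singleton, List.mem_toFinset] at hv hv'
    rcases hv with (rfl | hv | hv) | hv
    · rcases hv' with (hv' | hv' | hv') | hv'
      exacts [hij (htinj hv'), hCT _ _ hv' (htT i), hCT _ _ hv' (htT i), hpT _ _ hv' (htT i)]
    · rcases hv' with (rfl | hv' | hv') | hv'
      exacts [hCT _ _ hv (htT j), hCC _ _ _ hv hv', hCC _ _ _ hv hv', hι _ _ _ hv hv']
    · rcases hv' with (rfl | hv' | hv') | hv'
      exacts [hCT _ _ hv (htT j), hCC _ _ _ hv hv', hCC _ _ _ hv hv', hι _ _ _ hv hv']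
    · rcases hv' with (rfl | hv' | hv') | hv'
      exacts [hpT _ _ hv (htT j), hι _ _ _ hv' hv, hι _ _ _ hv' hv,
        hpdis _ _ (hιinj i j hij) _ hv hv']
  · intro i
    obtain ⟨ha, -, hconn, hCA⟩ := hL' (i, true)
    obtain ⟨hb, -, hconn', hCA'⟩ := hL' (i, false)
    obtain ⟨g, hg, htg, hgs⟩ := exists_ear (isolate_le (G := G) (T := T)) hconn hconn'
      (Finset.disjoint_left.2 (hCdis (i, true) (i, false) (by simp)))
      (fun h => hCT _ _ h (htT i)) (fun h => hCT _ _ h (htT i)) (fun h => hUnT _ h (htT i))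
      (hN (i, true)).2 (hN (i, false)).2 ha hb hCA hCA'
    obtain ⟨hp1, hp2, hp3, hp4, hp5, hp6⟩ := hp (ι i).1
    have hsupp : ((p (ι i).1).mapLe (isolate_le (G := G) (T := T))).support = (p (ι i).1).support :=
      SimpleGraph.Walk.support_mapLe_eq_support _ _
    have hodd : IsOddAPath U φ ((p (ι i).1).mapLe (isolate_le (G := G) (T := T))) :=
      ⟨hp1.mapLe _, hp2, hp3, hp4, by rwa [hsupp], by rwa [SimpleGraph.Walk.length_map]⟩
    obtain ⟨D, hD, hDc⟩ := completable_of_isEar (S := S) (K := K) (ψ := φ) hKG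
      (fun x _ y _ => hKφ x y) hg ⟨t i, hTS _ (htT i), htg⟩ hodd (by
        rw [hsupp]
        intro x hx hx'
        rcases hgs x hx with rfl | hx | hx
        exacts [hpT _ _ hx' (htT i), hι _ _ _ hx hx', hι _ _ _ hx hx'])
    refine ⟨D, hD.trans fun x hx => ?_, hDc⟩
    rw [hsupp, Finset.mem_union, List.mem_toFinset, List.mem_toFinset] at hx
    simp only [Finset.mem_union, Finset.mem_singleton, List.mem_toFinset]
    exact hx.imp_left (hgs x)

end FarFromBipartite
end OddCyclePacking

theorem theorem1 {V : Type*} [Finite V] (G : SimpleGraph V) (S : Set V) (k : ℕ)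
    (hG : OddCyclePacking.IsVertexConnected G (50 * k)) :
    OddCyclePacking.HasDisjointOddSCycles G S k ∨
      ((∃ X : Finset V, X.card ≤ 2 * k - 2 ∧ OddCyclePacking.IsOddSCycleCover G S X) ∧
        (k ≤ S.ncard →
          ∃ Y : Finset V, Y.card ≤ 3 * k - 3 ∧ OddCyclePacking.IsOddCycleCover G Y)) := by
  classical
  have := Fintype.ofFinite V
  rcases Nat.eq_zero_or_pos k with rfl | hk
  -- For `k = 0` the subtractions in the bounds truncate, but the empty packing is available.
  · exact Or.inl ⟨Fin.elim0, fun i => i.elim0, fun i => i.elim0, fun i => i.elim0⟩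
  by_cases hS : k ≤ S.ncard
  · rcases OddCyclePacking.packing_or_isOddCycleCover hk hG hS with h | ⟨Y, hY, h⟩
    · exact Or.inl h
    · exact OddCyclePacking.packing_or_covers_of_isOddCycleCover hk hG hY h
  -- With fewer than `k` vertices `S` is itself a cover, and `k - 1 ≤ 2k - 2`.
  · refine Or.inr ⟨⟨S.toFinset, ?_, fun v c hc => ?_⟩, fun h => absurd h hS⟩
    · rw [← Set.ncard_eq_toFinset_card']
      omega
    · obtain ⟨s, hs, -⟩ := hc.2.2
      exact s.2 (Set.mem_toFinset.2 hs)
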